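/- **Conventions.** $K$ is a field, modules are right modules unless stated otherwise, $\mathrm{Mod}$ means all (not only finite-dimensional) modules. A *ditalgebra* $\mathcal A=(T_R(W),d)$ over $K$ consists of a $K$-algebra $R$, an $R$-bimodule $W=W_0\oplus W_1$ (with $K$ acting centrally), the tensor algebra $T=T_R(W)$, graded so that $R$ and $W_0$ have degree $0$ and $W_1$ has degree $1$, and a $K$-linear map $d:T\to T$ with $d(T_n)\subseteq T_{n+1}$, $d(R)=0$, $d(ab)=d(a)b+(-1)^{\deg a}a\,d(b)$ for homogeneous $a,b$, and $d^2=0$. The objects of $\mathrm{Mod}\,\mathcal A$ are the right $T_0$-modules. A morphism $f:M\to N$ is a pair $(f^0,f^1)$ of an $R$-linear map $f^0:M\to N$ and a morphism of $T_0$-bimodules $f^1:T_1\to \mathrm{Hom}_K(M,N)$ (where $(ah)(m)=h(ma)$ and $(ha)(m)=h(m)a$) such that $f^0(m)a=f^0(ma)+f^1(d(a))(m)$ for $a\in T_0$, $m\in M$. Composition is $(gf)^0=g^0f^0$, $(gf)^1(v)=g^1(v)f^0+g^0f^1(v)-\sum_i g^1(v_i^2)f^1(v_i^1)$, where $d(v)=\sum_i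 v_i^1v_i^2$ with $v_i^1,v_i^2\in T_1$; the identity is $(\mathrm{id},0)$. Let $\Lambda$ be a $K$-algebra, $S\subseteq\Lambda$ a subalgebra and $J\subseteq \Lambda$ a two-sided ideal with a dual basis $\{p_i,\gamma_i\}_{i=1}^n$ of the left $S$-module $J$: $p_i\in J$, $\gamma_i\in{}^*J=\mathrm{Hom}_S({}_SJ,S)$, $x=\sum_i\gamma_i(x)p_i$ for $x\in J$. The $S$-bimodule structure of ${}^*J$ is $(s\gamma)(x)=\gamma(xs)$, $(\gamma s)(x)=\gamma(x)s$. Put $\mu(\gamma)=\sum_{i,j}\gamma_i\otimes\gamma_j\gamma(p_jp_i)$. * $\mathcal A=(T_S({}^*J),\delta)$ is the ditalgebra with $W_0=0$, $W_1={}^*J$ and $\delta|_{{}^*J}=\mu$. * *Drozd's ditalgebra* $\mathcal D=(T_R(W),d)$ has $R=S\times S$ (diagonal $2\times2$ matrices), $W_0=w_{12}{}^*J$, $W_1=w_1{}^*J\oplus w_2{}^*J$, where $w_1,w_2,w_{12}$ are the matrix units at $(1,1),(2,2),(1,2)$, and $$d(w_k\gamma)=-\sum_{i,j}w_k\gamma_i\otimes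 w_k\gamma_j\gamma(p_jp_i)\ (k=1,2),\qquad d(w_{12}\gamma)=\sum_{i,j}\bigl(w_{12}\gamma_i\otimes w_2\gamma_j\gamma(p_jp_i)-w_1\gamma_i\otimes w_{12}\gamma_j\gamma(p_jp_i)\bigr).$$ * $\mathcal M^1_\Lambda(\mathcal A)$ is the category whose objects are the morphisms of $\mathrm{Mod}\,\mathcal A$ of the form $(0,\psi)$ and whose morphisms are the commutative squares in $\mathrm{Mod}\,\mathcal A$. * $\mathcal M^1(\Lambda)$ is the category whose objects are the homomorphisms $\varphi:P\to Q$ of projective right $\Lambda$-modules with $\mathrm{Im}\,\varphi\subseteq\mathrm{rad}\,Q$, and whose morphisms are the commutative squares. * For $M\in\mathrm{Mod}\,\mathcal D$ put $M_k=Mw_k$, $k=1,2$. Then $\Xi(M)$ is the homomorphism $$M_1\otimes_S\Lambda\to M_2\otimes_S\Lambda,\quad m\otimes\lambda\mapsto\sum_i m\,w_{12}\gamma_i\otimes p_i\lambda,$$ and for a morphism $f$ of $\mathrm{Mod}\,\mathcal D$, $\Xi(f)$ is the pair of homomorphisms $m\otimes\lambda\mapsto f^0(m)\otimes\lambda+\sum_i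 f^1(w_k\gamma_i)(m)\otimes p_i\lambda$, $k=1,2$. **Theorem.** (1) Let $\Lambda=S\oplus J$ be a $K$-algebra, where $S$ is a semisimple subalgebra, $J$ is the Jacobson radical of $\Lambda$, and $J$ is finitely generated as a left $S$-module (for example, $\Lambda$ is finite-dimensional); let $\{p_i,\gamma_i\}$ be any dual basis of ${}_SJ$. Then $\mathrm{Mod}\,\mathcal D$ is equivalent to $\mathcal M^1_\Lambda(\mathcal A)$, and $\Xi$ is an equivalence $\mathrm{Mod}\,\mathcal D\to\mathcal M^1(\Lambda)$. (2) Let $\mathscr P$ be a finite poset with a minimum $0$, $A$ a $K$-algebra and $\mathcal R=\{\mathcal R_{ij}\}_{i\le j}$ a $\mathscr P$-multiplicative system: the $\mathcal R_{ij}\subseteq A$ are $K$-subspaces with $\mathcal R_{ij}\mathcal R_{jl}\subseteq\mathcal R_{il}$ for $i\le j\le l$, and there are $1_i\in\mathcal R_i:=\mathcal R_{ii}$ with $1_ir=r=r1_j$ for $r\in\mathcal R_{ij}$. Suppose that every $\mathcal R_i$ is a division ring. Let $\Lambda=\bigoplus_{i\le j}e_{ij}\mathcal R_{ij}$, with the product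 of matrices and the unit $\sum_i e_{ii}1_i$, $S=\bigoplus_ie_{ii}\mathcal R_i$, $J=\bigoplus_{i<j}e_{ij}\mathcal R_{ij}$, $e_i=e_{ii}1_i$, suppose that $J$ is finitely generated as a left $S$-module, and let $\{p_i,\gamma_i\}$ be any dual basis of ${}_SJ$. Let $e=\sum_{i\ne0}w_1e_i+w_2e_0\in R=S\times S$, a central idempotent of $R$, let $\eta:T_R(W)\to T_{eRe}(eWe)$ be the epimorphism induced by $R\to eRe$, $r\mapsto ere$, and $W\to eWe$, $w\mapsto ewe$, let $\mathcal D^e=(T_{eRe}(eWe),d_e)$ be the ditalgebra with $d_e\eta=\eta d$, and let $F_\eta:\mathrm{Mod}\,\mathcal D^e\to\mathrm{Mod}\,\mathcal D$ be the restriction along $\eta$. Let $\mathcal M$ be the full subcategory of $\mathcal M^1(\Lambda)$ of the objects isomorphic to some $P\to(e_0\Lambda)^{\nu}$, where $\nu$ is a set, $(e_0\Lambda)^\nu$ is the direct sum of copies of $e_0\Lambda$ indexed by $\nu$, and $P$ is a projective $\Lambda$-module with $Pe_0=0$. Then $\Xi:\mathrm{Mod}\,\mathcal D\to\mathcal M^1(\Lambda)$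 is an equivalence, and it induces an equivalence $\Xi_e=\Xi\circ F_\eta:\mathrm{Mod}\,\mathcal D^e\to\mathcal M$. -/

import Mathlib

open CategoryTheory MulOpposite TensorProduct

universe u

noncomputable section

namespace Dit

/-! ## Right modules and bimodules over a `K`-algebra -/

/-- A right module over a `K`-algebra `R`: a `K`-vector space `V` with a homomorphism of
`K`-algebras `R → End_K(V)ᵐᵒᵖ`. -/
structure RightMod (K : Type u) [Field K] (R : Type u) [Ring R] [Algebra K R] where
  carrier : Type u
  [addCommGroup : AddCommGroup carrier]
  [module : Module K carrier]
  ρ : R →ₐ[K] (Module.End K carrier)ᵐᵒᵖ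

attribute [instance] RightMod.addCommGroup RightMod.module

namespace RightMod

variable {K : Type u} [Field K] {R : Type u} [Ring R] [Algebra K R]

instance : CoeSort (RightMod K R) (Type u) := ⟨RightMod.carrier⟩

/-- `M.act a m` is the product `m a`. -/
def act (M : RightMod K R) : R →ₗ[K] Module.End K M :=
  (opLinearEquiv K).symm.toLinearMap ∘ₗ M.ρ.toLinearMap

@[simp] lemma act_one (M : RightMod K R) (m : M) : M.act 1 m = m := by
  simp [act]

@[simp] lemma act_mul (M : RightMod K R) (a b : R) (m : M) :
    M.act (a * b) m = M.act b (M.act a m) := by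
  simp [act]

@[simp] lemma act_algebraMap (M : RightMod K R) (k : K) (m : M) :
    M.act (algebraMap K R k) m = k • m := by
  simp [Algebra.algebraMap_eq_smul_one]

/-- A right module given by the linear maps `m ↦ m a`. -/
def ofAct (V : Type u) [AddCommGroup V] [Module K V] (φ : R →ₗ[K] Module.End K V)
    (h1 : φ 1 = LinearMap.id) (hmul : ∀ a b, φ (a * b) = φ b ∘ₗ φ a) : RightMod K R where
  carrier := V
  ρ := AlgHom.ofLinearMap ((opLinearEquiv K).toLinearMap ∘ₗ φ) (by simp [h1]; rfl)
    (fun a b => by simp [hmul]; rfl)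

@[simp] lemma ofAct_act (V : Type u) [AddCommGroup V] [Module K V]
    (φ : R →ₗ[K] Module.End K V) (h1 hmul) (a : R) : (ofAct V φ h1 hmul).act a = φ a := rfl

end RightMod

/-- An `R`-`R`-bimodule over a `K`-algebra `R` (with `K` acting centrally). -/
structure Bimod (K : Type u) [Field K] (R : Type u) [Ring R] [Algebra K R] where
  carrier : Type u
  [addCommGroup : AddCommGroup carrier]
  [module : Module K carrier]
  [left : Module R carrier]
  [right : Module Rᵐᵒᵖ carrier]
  [comm : SMulCommClass R Rᵐᵒᵖ carrier]
  [tower : IsScalarTower K R carrier]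
  [towerOp : IsScalarTower K Rᵐᵒᵖ carrier]

attribute [instance] Bimod.addCommGroup Bimod.module Bimod.left Bimod.right Bimod.comm
  Bimod.tower Bimod.towerOp

instance (K : Type u) [Field K] (R : Type u) [Ring R] [Algebra K R] :
    CoeSort (Bimod K R) (Type u) := ⟨Bimod.carrier⟩

/-! ## The graded tensor algebra `T_R(W₀ ⊕ W₁)` -/

section TensorAlgebra

variable {K : Type u} [Field K] {R : Type u} [Ring R] [Algebra K R] (W₀ W₁ : Bimod K R)

/-- Defining relations of the tensor algebra of the `R`-bimodule `W₀ ⊕ W₁`: the generators coming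
from `R` multiply as in `R`, and the `R`-bimodule structure of `W₀ ⊕ W₁` is the multiplication by
elements of `R`. -/
inductive TRel : FreeAlgebra K (R ⊕ (W₀ × W₁)) → FreeAlgebra K (R ⊕ (W₀ × W₁)) → Prop
  | addR (r s : R) : TRel (FreeAlgebra.ι K (Sum.inl (r + s)))
      (FreeAlgebra.ι K (Sum.inl r) + FreeAlgebra.ι K (Sum.inl s))
  | mulR (r s : R) : TRel (FreeAlgebra.ι K (Sum.inl (r * s)))
      (FreeAlgebra.ι K (Sum.inl r) * FreeAlgebra.ι K (Sum.inl s))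
  | algR (k : K) : TRel (FreeAlgebra.ι K (Sum.inl (algebraMap K R k))) (algebraMap K _ k)
  | addW (v w : W₀ × W₁) : TRel (FreeAlgebra.ι K (Sum.inr (v + w)))
      (FreeAlgebra.ι K (Sum.inr v) + FreeAlgebra.ι K (Sum.inr w))
  | left (r : R) (w : W₀ × W₁) : TRel (FreeAlgebra.ι K (Sum.inr (r • w)))
      (FreeAlgebra.ι K (Sum.inl r) * FreeAlgebra.ι K (Sum.inr w))
  | right (w : W₀ × W₁) (r : R) : TRel (FreeAlgebra.ι K (Sum.inr (op r • w)))
      (FreeAlgebra.ι K (Sum.inr w) * FreeAlgebra.ι K (Sum.inl r))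

/-- The tensor algebra `T_R(W)` of the `R`-bimodule `W = W₀ ⊕ W₁`. -/
def T : Type u := RingQuot (TRel W₀ W₁)

instance : Ring (T W₀ W₁) := inferInstanceAs (Ring (RingQuot (TRel W₀ W₁)))

instance : Algebra K (T W₀ W₁) :=
  inferInstanceAs (Algebra K (RingQuot (TRel W₀ W₁)))

namespace T

/-- The quotient map from the free algebra. -/
def mk : FreeAlgebra K (R ⊕ (W₀ × W₁)) →ₐ[K] T W₀ W₁ := RingQuot.mkAlgHom K (TRel W₀ W₁)

lemma mk_rel {x y : FreeAlgebra K (R ⊕ (W₀ × W₁))} (h : TRel W₀ W₁ x y) :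
    mk W₀ W₁ x = mk W₀ W₁ y := RingQuot.mkAlgHom_rel K h

/-- The inclusion `R → T_R(W)`. -/
def ιR : R →ₐ[K] T W₀ W₁ where
  toFun r := mk W₀ W₁ (FreeAlgebra.ι K (Sum.inl r))
  map_one' := by
    have h := mk_rel W₀ W₁ (TRel.algR (W₀ := W₀) (W₁ := W₁) (1 : K))
    rw [map_one, map_one, map_one] at h
    exact h
  map_zero' := by
    have h := mk_rel W₀ W₁ (TRel.algR (W₀ := W₀) (W₁ := W₁) (0 : K))
    rw [map_zero, map_zero, map_zero] at h
    exact h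
  map_mul' r s := (mk_rel W₀ W₁ (TRel.mulR r s)).trans (map_mul _ _ _)
  map_add' r s := (mk_rel W₀ W₁ (TRel.addR r s)).trans (map_add _ _ _)
  commutes' k := (mk_rel W₀ W₁ (TRel.algR k)).trans (AlgHom.commutes _ _)

lemma mk_inr_left (r : R) (w : W₀ × W₁) :
    mk W₀ W₁ (FreeAlgebra.ι K (Sum.inr (r • w))) =
      ιR W₀ W₁ r * mk W₀ W₁ (FreeAlgebra.ι K (Sum.inr w)) :=
  (mk_rel W₀ W₁ (TRel.left r w)).trans (map_mul _ _ _)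

/-- The inclusion `W → T_R(W)`. -/
def ιW : (W₀ × W₁) →ₗ[K] T W₀ W₁ where
  toFun w := mk W₀ W₁ (FreeAlgebra.ι K (Sum.inr w))
  map_add' v w := (mk_rel W₀ W₁ (TRel.addW v w)).trans (map_add _ _ _)
  map_smul' k w := by
    have h := mk_inr_left W₀ W₁ (algebraMap K R k) w
    rw [AlgHom.commutes, algebraMap_smul] at h
    rw [h, RingHom.id_apply, Algebra.smul_def]

lemma ιW_left (r : R) (w : W₀ × W₁) : ιW W₀ W₁ (r • w) = ιR W₀ W₁ r * ιW W₀ W₁ w :=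
  mk_inr_left W₀ W₁ r w

lemma ιW_right (r : R) (w : W₀ × W₁) : ιW W₀ W₁ (op r • w) = ιW W₀ W₁ w * ιR W₀ W₁ r :=
  (mk_rel W₀ W₁ (TRel.right w r)).trans (map_mul _ _ _)

variable {W₀ W₁}

section lift

variable {B : Type u} [Ring B] [Algebra K B]

/-- The universal property of the tensor algebra. -/
def lift (f : R →ₐ[K] B) (g : (W₀ × W₁) →ₗ[K] B)
    (hl : ∀ r w, g (r • w) = f r * g w) (hr : ∀ r w, g (op r • w) = g w * f r) :
    T W₀ W₁ →ₐ[K] B :=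
  RingQuot.liftAlgHom K ⟨FreeAlgebra.lift K (Sum.elim f g), by
    intro x y h
    cases h <;> simp [hl, hr]⟩

@[simp] lemma lift_ιR (f : R →ₐ[K] B) (g : (W₀ × W₁) →ₗ[K] B) (hl hr) (r : R) :
    lift f g hl hr (ιR W₀ W₁ r) = f r := by
  change RingQuot.liftAlgHom K _ (RingQuot.mkAlgHom K (TRel W₀ W₁) _) = _
  rw [RingQuot.liftAlgHom_mkAlgHom_apply]
  simp

@[simp] lemma lift_ιW (f : R →ₐ[K] B) (g : (W₀ × W₁) →ₗ[K] B) (hl hr) (w : W₀ × W₁) :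
    lift f g hl hr (ιW W₀ W₁ w) = g w := by
  change RingQuot.liftAlgHom K _ (RingQuot.mkAlgHom K (TRel W₀ W₁) _) = _
  rw [RingQuot.liftAlgHom_mkAlgHom_apply]
  simp

end lift

lemma induction {p : T W₀ W₁ → Prop} (hR : ∀ r, p (ιR W₀ W₁ r)) (hW : ∀ w, p (ιW W₀ W₁ w))
    (hadd : ∀ a b, p a → p b → p (a + b)) (hmul : ∀ a b, p a → p b → p (a * b)) (a : T W₀ W₁) :
    p a := by
  obtain ⟨x, rfl⟩ : ∃ x, mk W₀ W₁ x = a := RingQuot.mkAlgHom_surjective K (TRel W₀ W₁) a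
  induction x using FreeAlgebra.induction with
  | grade0 k =>
    have := hR (algebraMap K R k)
    rw [AlgHom.commutes] at this
    rwa [AlgHom.commutes]
  | grade1 x =>
    rcases x with r | w
    · exact hR r
    · exact hW w
  | mul a b ha hb => rw [map_mul]; exact hmul _ _ ha hb
  | add a b ha hb => rw [map_add]; exact hadd _ _ ha hb

variable (W₀ W₁) in
/-- Products of homogeneous generators; the elements of `R` and `W₀` have degree `0` and the
elements of `W₁` have degree `1`. -/
inductive Mono : ℕ → T W₀ W₁ → Prop
  | ofR (r : R) : Mono 0 (ιR W₀ W₁ r)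
  | ofW₀ (w : W₀) : Mono 0 (ιW W₀ W₁ (w, 0))
  | ofW₁ (w : W₁) : Mono 1 (ιW W₀ W₁ (0, w))
  | mul {m n : ℕ} {a b : T W₀ W₁} (ha : Mono m a) (hb : Mono n b) : Mono (m + n) (a * b)

variable (W₀ W₁) in
/-- The homogeneous component `T_R(W)_n`. -/
def gr (n : ℕ) : Submodule K (T W₀ W₁) := Submodule.span K {a | Mono W₀ W₁ n a}

lemma Mono.mem {n : ℕ} {a : T W₀ W₁} (h : Mono W₀ W₁ n a) : a ∈ gr W₀ W₁ n :=
  Submodule.subset_span h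

lemma mul_mem_gr {m n : ℕ} {a b : T W₀ W₁} (ha : a ∈ gr W₀ W₁ m) (hb : b ∈ gr W₀ W₁ n) :
    a * b ∈ gr W₀ W₁ (m + n) := by
  have h : gr W₀ W₁ m * gr W₀ W₁ n ≤ gr W₀ W₁ (m + n) := by
    rw [gr, gr, Submodule.span_mul_span]
    refine Submodule.span_mono ?_
    rintro _ ⟨a, ha, b, hb, rfl⟩
    exact Mono.mul ha hb
  exact h (Submodule.mul_mem_mul ha hb)

lemma mul_mem_gr' {m n k : ℕ} {a b : T W₀ W₁} (ha : a ∈ gr W₀ W₁ m) (hb : b ∈ gr W₀ W₁ n)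
    (h : m + n = k) : a * b ∈ gr W₀ W₁ k := h ▸ mul_mem_gr ha hb

lemma one_mem_gr : (1 : T W₀ W₁) ∈ gr W₀ W₁ 0 := by
  have := (Mono.ofR (W₀ := W₀) (W₁ := W₁) 1).mem
  rwa [map_one] at this

variable (W₀ W₁) in
/-- The subalgebra `T_R(W)_0`. -/
def zero : Subalgebra K (T W₀ W₁) where
  carrier := gr W₀ W₁ 0
  mul_mem' ha hb := mul_mem_gr' ha hb (add_zero 0)
  add_mem' ha hb := add_mem ha hb
  algebraMap_mem' k := by
    have := (Mono.ofR (W₀ := W₀) (W₁ := W₁) (algebraMap K R k)).mem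
    rwa [AlgHom.commutes] at this

/-- Every element of degree `2` is a sum of products of two elements of degree `1`. -/
lemma gr_two_le : gr W₀ W₁ 2 ≤ gr W₀ W₁ 1 * gr W₀ W₁ 1 := by
  refine Submodule.span_le.2 ?_
  have key : ∀ n a, Mono W₀ W₁ n a → n = 2 → a ∈ gr W₀ W₁ 1 * gr W₀ W₁ 1 := by
    intro n a h
    induction h with
    | ofR r => intro h; omega
    | ofW₀ w => intro h; omega
    | ofW₁ w => intro h; omega
    | @mul m n a b ha hb iha ihb =>
      intro h
      have h3 : (m = 0 ∧ n = 2) ∨ (m = 1 ∧ n = 1) ∨ (m = 2 ∧ n = 0) := by omega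
      rcases h3 with ⟨rfl, rfl⟩ | ⟨rfl, rfl⟩ | ⟨rfl, rfl⟩
      · refine Submodule.mul_induction_on (ihb rfl) ?_ ?_
        · intro x hx y hy
          rw [← mul_assoc]
          exact Submodule.mul_mem_mul (mul_mem_gr' ha.mem hx rfl) hy
        · intro x y hx hy
          rw [mul_add]
          exact add_mem hx hy
      · exact Submodule.mul_mem_mul ha.mem hb.mem
      · refine Submodule.mul_induction_on (iha rfl) ?_ ?_
        · intro x hx y hy
          rw [mul_assoc]
          exact Submodule.mul_mem_mul hx (mul_mem_gr' hy hb.mem rfl)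
        · intro x y hx hy
          rw [add_mul]
          exact add_mem hx hy
  exact fun a ha => key 2 a ha rfl

end T

namespace T

variable {W₀ W₁}

/-- The element `r ∈ R` as an element of `T_R(W)_0`. -/
def rZero (r : R) : zero W₀ W₁ := ⟨ιR W₀ W₁ r, (Mono.ofR r).mem⟩

/-- The element `w ∈ W₀` as an element of `T_R(W)_0`. -/
def wZero (w : W₀) : zero W₀ W₁ := ⟨ιW W₀ W₁ (w, 0), (Mono.ofW₀ w).mem⟩

/-- The element `w ∈ W₁` as an element of `T_R(W)_1`. -/
def wOne : W₁ →ₗ[K] gr W₀ W₁ 1 :=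
  ((ιW W₀ W₁) ∘ₗ LinearMap.inr K W₀ W₁).codRestrict _ (fun w => (Mono.ofW₁ w).mem)

/-- The product `a v`, with `a` of degree `0` and `v` of degree `1`. -/
def lmul (a : zero W₀ W₁) (v : gr W₀ W₁ 1) : gr W₀ W₁ 1 :=
  ⟨a.1 * v.1, mul_mem_gr' a.2 v.2 (zero_add 1)⟩

/-- The product `v a`, with `a` of degree `0` and `v` of degree `1`. -/
def rmul (v : gr W₀ W₁ 1) (a : zero W₀ W₁) : gr W₀ W₁ 1 :=
  ⟨v.1 * a.1, mul_mem_gr' v.2 a.2 (add_zero 1)⟩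

end T

/-! ### Evaluating products of bimodule maps

If `M`, `N`, `L` are right modules over `T_0` and `f : T_1 → Hom_K(M, N)`, `g : T_1 → Hom_K(N, L)`
are morphisms of `T_0`-bimodules, then `v ⊗ w ↦ g w ∘ f v` is well defined on
`T_2 = T_1 ⊗_{T_0} T_1`.  It is obtained here from a right `T_R(W)`-module structure on
`M × N × L`. -/

variable {W₀ W₁} in
/-- A morphism of `T_0`-bimodules `T_1 → Hom_K(M, N)`, where `(a h)(m) = h (m a)` and
`(h a)(m) = h(m) a`. -/
@[ext] structure BMap (M N : RightMod K (T.zero W₀ W₁)) where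
  toFun : T.gr W₀ W₁ 1 →ₗ[K] (M →ₗ[K] N)
  left : ∀ a v m, toFun (T.lmul a v) m = toFun v (M.act a m)
  right : ∀ v a m, toFun (T.rmul v a) m = N.act a (toFun v m)

section Ext

variable {W₀ W₁} (X : RightMod K (T W₀ W₁)) (L : RightMod K (T.zero W₀ W₁))

/-- Extension of a right `T_R(W)`-module `X` by a right `T_0`-module `L` along a map
`g : T_1 → Hom_K(X, L)`. -/
structure ExtMap where
  toFun : T.gr W₀ W₁ 1 →ₗ[K] (X →ₗ[K] L)
  left : ∀ (a : T.zero W₀ W₁) v x, toFun (T.lmul a v) x = toFun v (X.act a.1 x)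
  right : ∀ v a x, toFun (T.rmul v a) x = L.act a (toFun v x)

variable {X L} (g : ExtMap X L)

namespace ExtMap

/-- The action of `R` on `X × L`. -/
def actR : R →ₗ[K] Module.End K (X × L) where
  toFun r := LinearMap.prodMap (X.act (T.ιR W₀ W₁ r)) (L.act (T.rZero r))
  map_add' r s := by
    have : (T.rZero (r + s) : T.zero W₀ W₁) = T.rZero r + T.rZero s :=
      Subtype.ext (map_add (T.ιR W₀ W₁) r s)
    rw [this, map_add, map_add, map_add]
    rfl
  map_smul' k r := by
    have : (T.rZero (k • r) : T.zero W₀ W₁) = k • T.rZero r :=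
      Subtype.ext (map_smul (T.ιR W₀ W₁) k r)
    rw [this, map_smul, map_smul, map_smul]
    rfl

/-- The action of `W` on `X × L`. -/
def actW : (W₀ × W₁) →ₗ[K] Module.End K (X × L) where
  toFun w := LinearMap.prod (X.act (T.ιW W₀ W₁ w) ∘ₗ LinearMap.fst K X L)
    (L.act (T.wZero w.1) ∘ₗ LinearMap.snd K X L + g.toFun (T.wOne w.2) ∘ₗ LinearMap.fst K X L)
  map_add' v w := by
    have : (T.wZero (v.1 + w.1) : T.zero W₀ W₁) = T.wZero v.1 + T.wZero w.1 :=
      Subtype.ext (by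
        change T.ιW W₀ W₁ _ = T.ιW W₀ W₁ _ + T.ιW W₀ W₁ _
        rw [← map_add]; simp)
    ext x <;> simp [this]
  map_smul' k w := by
    have : (T.wZero (k • w.1) : T.zero W₀ W₁) = k • T.wZero w.1 :=
      Subtype.ext (by
        change T.ιW W₀ W₁ _ = k • T.ιW W₀ W₁ _
        rw [← map_smul]; simp)
    ext x <;> simp [this]

/-- The algebra homomorphism defining the right `T_R(W)`-module structure of `X × L`. -/
def extρ : T W₀ W₁ →ₐ[K] (Module.End K (X × L))ᵐᵒᵖ :=
  T.lift
    (AlgHom.ofLinearMap ((opLinearEquiv K).toLinearMap ∘ₗ actR (X := X) (L := L))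
      (by
        have : (T.rZero 1 : T.zero W₀ W₁) = 1 := Subtype.ext (map_one _)
        apply unop_injective
        ext x <;> simp [actR, this])
      (fun r s => by
        have : (T.rZero (r * s) : T.zero W₀ W₁) = T.rZero r * T.rZero s :=
          Subtype.ext (map_mul (T.ιR W₀ W₁) r s)
        apply unop_injective
        ext x <;> simp [actR, this]))
    ((opLinearEquiv K).toLinearMap ∘ₗ g.actW)
    (fun r w => by
      have h1 : (T.wZero (r • w.1) : T.zero W₀ W₁) = T.rZero r * T.wZero w.1 :=
        Subtype.ext (by
          have := T.ιW_left W₀ W₁ r (w.1, 0)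
          simpa [T.wZero, T.rZero] using this)
      have h2 : (T.wOne (r • w.2) : T.gr W₀ W₁ 1) = T.lmul (T.rZero r) (T.wOne w.2) :=
        Subtype.ext (by
          have := T.ιW_left W₀ W₁ r (0, w.2)
          rw [Prod.smul_mk, smul_zero] at this
          exact this)
      apply unop_injective
      ext x <;> simp [actR, actW, h1, h2, T.ιW_left, g.left, T.rZero])
    (fun r w => by
      have h1 : (T.wZero (op r • w.1) : T.zero W₀ W₁) = T.wZero w.1 * T.rZero r :=
        Subtype.ext (by
          have := T.ιW_right W₀ W₁ r (w.1, 0)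
          simpa [T.wZero, T.rZero] using this)
      have h2 : (T.wOne (op r • w.2) : T.gr W₀ W₁ 1) = T.rmul (T.wOne w.2) (T.rZero r) :=
        Subtype.ext (by
          have := T.ιW_right W₀ W₁ r (0, w.2)
          rw [Prod.smul_mk, smul_zero] at this
          exact this)
      apply unop_injective
      ext x <;> simp [actR, actW, h1, h2, T.ιW_right, g.right])

/-- The right action of `T_R(W)` on `X × L`. -/
def extAct : T W₀ W₁ →ₗ[K] Module.End K (X × L) :=
  (opLinearEquiv K).symm.toLinearMap ∘ₗ g.extρ.toLinearMap

lemma extAct_mul (a b : T W₀ W₁) (p : X × L) :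
    g.extAct (a * b) p = g.extAct b (g.extAct a p) := by
  simp [extAct]

lemma extAct_ιR (r : R) (p : X × L) :
    g.extAct (T.ιR W₀ W₁ r) p = (X.act (T.ιR W₀ W₁ r) p.1, L.act (T.rZero r) p.2) := by
  simp [extAct, extρ, actR]

lemma extAct_ιW (w : W₀ × W₁) (p : X × L) :
    g.extAct (T.ιW W₀ W₁ w) p = (X.act (T.ιW W₀ W₁ w) p.1,
      L.act (T.wZero w.1) p.2 + g.toFun (T.wOne w.2) p.1) := by
  simp [extAct, extρ, actW]

lemma extAct_fst (y : T W₀ W₁) (p : X × L) : (g.extAct y p).1 = X.act y p.1 := by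
  induction y using T.induction generalizing p with
  | hR r => rw [extAct_ιR]
  | hW w => rw [extAct_ιW]
  | hadd a b ha hb => simp [ha, hb]
  | hmul a b ha hb => rw [extAct_mul, RightMod.act_mul, hb, ha]

lemma extAct_aux {n : ℕ} {a : T W₀ W₁} (h : T.Mono W₀ W₁ n a) :
    (n = 0 → ∀ (h : a ∈ T.zero W₀ W₁) (p : X × L),
      (g.extAct a p).2 = L.act ⟨a, h⟩ p.2) ∧
    (n = 1 → ∀ (h : a ∈ T.gr W₀ W₁ 1) (p : X × L),
      (g.extAct a p).2 = g.toFun ⟨a, h⟩ p.1) := by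
  induction h with
  | ofR r =>
    refine ⟨fun _ h p => ?_, fun h => by omega⟩
    rw [extAct_ιR]
    rfl
  | ofW₀ w =>
    refine ⟨fun _ h p => ?_, fun h => by omega⟩
    rw [extAct_ιW]
    simp [T.wZero]
  | ofW₁ w =>
    refine ⟨fun h => by omega, fun _ h p => ?_⟩
    have : (T.wZero 0 : T.zero W₀ W₁) = 0 := Subtype.ext (map_zero (T.ιW W₀ W₁))
    rw [extAct_ιW]
    simp only [this, map_zero, LinearMap.zero_apply, zero_add]
    rfl
  | @mul m n a b ha hb iha ihb =>
    refine ⟨fun h => ?_, fun h => ?_⟩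
    · obtain ⟨rfl, rfl⟩ : m = 0 ∧ n = 0 := by omega
      intro h p
      have e : (⟨a * b, h⟩ : T.zero W₀ W₁) = ⟨a, ha.mem⟩ * ⟨b, hb.mem⟩ := rfl
      rw [extAct_mul, ihb.1 rfl hb.mem, iha.1 rfl ha.mem, e, RightMod.act_mul]
    · have h3 : (m = 0 ∧ n = 1) ∨ (m = 1 ∧ n = 0) := by omega
      rcases h3 with ⟨rfl, rfl⟩ | ⟨rfl, rfl⟩ <;> intro h p
      · have e : (⟨a * b, h⟩ : T.gr W₀ W₁ 1) = T.lmul ⟨a, ha.mem⟩ ⟨b, hb.mem⟩ := rfl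
        rw [extAct_mul, ihb.2 rfl hb.mem, e, g.left, extAct_fst]
      · have e : (⟨a * b, h⟩ : T.gr W₀ W₁ 1) = T.rmul ⟨a, ha.mem⟩ ⟨b, hb.mem⟩ := rfl
        rw [extAct_mul, ihb.1 rfl hb.mem, e, g.right, iha.2 rfl ha.mem]

lemma extAct_zero (a : T.zero W₀ W₁) (p : X × L) : (g.extAct a.1 p).2 = L.act a p.2 := by
  obtain ⟨a, ha⟩ := a
  refine Submodule.span_induction (p := fun a ha => (g.extAct a p).2 = L.act ⟨a, ha⟩ p.2)
    (fun a ha => (g.extAct_aux ha).1 rfl ha.mem p) ?_ ?_ ?_ ha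
  · have : (⟨0, zero_mem _⟩ : T.zero W₀ W₁) = 0 := rfl
    exact (by simp : (g.extAct 0 p).2 = L.act (0 : T.zero W₀ W₁) p.2)
  · intro a b ha hb iha ihb
    exact (by simp [iha, ihb] : (g.extAct (a + b) p).2 =
      L.act ((⟨a, ha⟩ : T.zero W₀ W₁) + ⟨b, hb⟩) p.2)
  · intro k a ha iha
    exact (by simp [iha] : (g.extAct (k • a) p).2 =
      L.act (k • (⟨a, ha⟩ : T.zero W₀ W₁)) p.2)

lemma extAct_one (v : T.gr W₀ W₁ 1) (p : X × L) : (g.extAct v.1 p).2 = g.toFun v p.1 := by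
  obtain ⟨a, ha⟩ := v
  refine Submodule.span_induction (p := fun a ha => (g.extAct a p).2 = g.toFun ⟨a, ha⟩ p.1)
    (fun a ha => (g.extAct_aux ha).2 rfl ha.mem p) ?_ ?_ ?_ ha
  · exact (by simp : (g.extAct 0 p).2 = g.toFun (0 : T.gr W₀ W₁ 1) p.1)
  · intro a b ha hb iha ihb
    exact (by simp [iha, ihb] : (g.extAct (a + b) p).2 =
      g.toFun ((⟨a, ha⟩ : T.gr W₀ W₁ 1) + ⟨b, hb⟩) p.1)
  · intro k a ha iha
    exact (by simp [iha] : (g.extAct (k • a) p).2 =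
      g.toFun (k • (⟨a, ha⟩ : T.gr W₀ W₁ 1)) p.1)

/-- The right `T_R(W)`-module `X × L`. -/
def ext : RightMod K (T W₀ W₁) where
  carrier := X × L
  ρ := g.extρ

/-- The projection to the quotient module `X`. -/
def fst : g.ext →ₗ[K] X where
  toFun x := x.1
  map_add' _ _ := rfl
  map_smul' _ _ := rfl

/-- The projection to `L`. -/
def snd : g.ext →ₗ[K] L where
  toFun x := x.2
  map_add' _ _ := rfl
  map_smul' _ _ := rfl

/-- The pair `(x, l)`. -/
def pair (x : X) (l : L) : g.ext := (x, l)

/-- The inclusion of `X`. -/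
def inl : X →ₗ[K] g.ext where
  toFun x := g.pair x 0
  map_add' _ _ := Prod.ext rfl (add_zero 0).symm
  map_smul' _ _ := Prod.ext rfl (smul_zero _).symm

/-- The inclusion of `L`. -/
def inr : L →ₗ[K] g.ext where
  toFun l := g.pair 0 l
  map_add' _ _ := Prod.ext (add_zero 0).symm rfl
  map_smul' _ _ := Prod.ext (smul_zero _).symm rfl

@[simp] lemma fst_inl (x : X) : g.fst (g.inl x) = x := rfl
@[simp] lemma snd_inl (x : X) : g.snd (g.inl x) = 0 := rfl
@[simp] lemma fst_inr (l : L) : g.fst (g.inr l) = 0 := rfl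
@[simp] lemma snd_inr (l : L) : g.snd (g.inr l) = l := rfl

lemma ext_eq {x y : g.ext} (h1 : g.fst x = g.fst y) (h2 : g.snd x = g.snd y) : x = y :=
  Prod.ext h1 h2

lemma fst_act (y : T W₀ W₁) (x : g.ext) : g.fst (g.ext.act y x) = X.act y (g.fst x) :=
  g.extAct_fst y x

lemma snd_act_zero (a : T.zero W₀ W₁) (x : g.ext) :
    g.snd (g.ext.act a.1 x) = L.act a (g.snd x) :=
  g.extAct_zero a x

lemma snd_act_one (v : T.gr W₀ W₁ 1) (x : g.ext) :
    g.snd (g.ext.act v.1 x) = g.toFun v (g.fst x) :=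
  g.extAct_one v x

end ExtMap

end Ext

end TensorAlgebra

/-! ### The composition of bimodule maps -/

namespace BMap

variable {K : Type u} [Field K] {R : Type u} [Ring R] [Algebra K R] {W₀ W₁ : Bimod K R}
variable {M N L Q : RightMod K (T.zero W₀ W₁)}

/-- The zero module. -/
def chain₀ : RightMod K (T W₀ W₁) :=
  RightMod.ofAct PUnit 0 (Subsingleton.elim _ _) (fun _ _ => Subsingleton.elim _ _)

/-- The map of `T_1` used to extend `0` by `M`. -/
def map₁ (M : RightMod K (T.zero W₀ W₁)) : ExtMap (chain₀ (W₀ := W₀) (W₁ := W₁)) M :=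
  ⟨0, fun _ _ _ => rfl, fun _ _ _ => (map_zero _).symm⟩

/-- The map of `T_1` used to extend `M`, with `W₁` acting as zero, by `N`. -/
def map₂ (f : BMap M N) : ExtMap (map₁ M).ext N where
  toFun := LinearMap.lcomp K N (map₁ M).snd ∘ₗ f.toFun
  left a v x := by simp [f.left, ExtMap.snd_act_zero]
  right v a x := f.right v a _

/-- The map of `T_1` used to extend the `T_R(W)`-module `M × N` given by `f` by `L`. -/
def map₃ (f : BMap M N) (g : BMap N L) : ExtMap f.map₂.ext L where
  toFun := LinearMap.lcomp K L f.map₂.snd ∘ₗ g.toFun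
  left a v x := by simp [g.left, ExtMap.snd_act_zero]
  right v a x := g.right v a _

/-- The map of `T_1` used to extend the `T_R(W)`-module `M × N × L` given by `f` and `g`
by `Q`. -/
def map₄ (f : BMap M N) (g : BMap N L) (h : BMap L Q) : ExtMap (map₃ f g).ext Q where
  toFun := LinearMap.lcomp K Q (map₃ f g).snd ∘ₗ h.toFun
  left a v x := by simp [h.left, ExtMap.snd_act_zero]
  right v a x := h.right v a _

/-- The inclusion of `M` in `M × N × L`. -/
def in₃ (f : BMap M N) (g : BMap N L) : M →ₗ[K] (map₃ f g).ext :=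
  (map₃ f g).inl ∘ₗ f.map₂.inl ∘ₗ (map₁ M).inr

/-- The linear map sending a product `v * w` of elements of `T_1` to `g w ∘ f v`. -/
def comp (f : BMap M N) (g : BMap N L) : T W₀ W₁ →ₗ[K] (M →ₗ[K] L) :=
  LinearMap.lcomp K L (in₃ f g) ∘ₗ LinearMap.llcomp K _ _ _ (map₃ f g).snd ∘ₗ (map₃ f g).ext.act

/-- The linear map sending a product `v * w * z` of elements of `T_1` to `h z ∘ g w ∘ f v`. -/
def comp₃ (f : BMap M N) (g : BMap N L) (h : BMap L Q) : T W₀ W₁ →ₗ[K] (M →ₗ[K] Q) :=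
  LinearMap.lcomp K Q ((map₄ f g h).inl ∘ₗ in₃ f g) ∘ₗ
    LinearMap.llcomp K _ _ _ (map₄ f g h).snd ∘ₗ (map₄ f g h).ext.act

lemma comp_apply (f : BMap M N) (g : BMap N L) (y : T W₀ W₁) (m : M) :
    comp f g y m = (map₃ f g).snd ((map₃ f g).ext.act y (in₃ f g m)) := rfl

lemma comp₃_apply (f : BMap M N) (g : BMap N L) (h : BMap L Q) (y : T W₀ W₁) (m : M) :
    comp₃ f g h y m =
      (map₄ f g h).snd ((map₄ f g h).ext.act y ((map₄ f g h).inl (in₃ f g m))) := rfl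

lemma comp_mul (f : BMap M N) (g : BMap N L) (v w : T.gr W₀ W₁ 1) (m : M) :
    comp f g (v.1 * w.1) m = g.toFun w (f.toFun v m) := by
  rw [comp_apply, RightMod.act_mul, ExtMap.snd_act_one, ExtMap.fst_act]
  change g.toFun w (f.map₂.snd (f.map₂.ext.act v.1 _)) = _
  rw [ExtMap.snd_act_one]
  rfl

lemma comp₃_mul_right (f : BMap M N) (g : BMap N L) (h : BMap L Q) (y : T W₀ W₁)
    (w : T.gr W₀ W₁ 1) (m : M) :
    comp₃ f g h (y * w.1) m = h.toFun w (comp f g y m) := by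
  rw [comp₃_apply, RightMod.act_mul, ExtMap.snd_act_one, ExtMap.fst_act]
  rfl

lemma comp₃_mul_left (f : BMap M N) (g : BMap N L) (h : BMap L Q) (v : T.gr W₀ W₁ 1)
    {y : T W₀ W₁} (hy : y ∈ T.gr W₀ W₁ 2) (m : M) :
    comp₃ f g h (v.1 * y) m = comp g h y (f.toFun v m) := by
  refine Submodule.mul_induction_on (T.gr_two_le hy) ?_ ?_
  · intro a ha b hb
    have h1 := comp₃_mul_right f g h (v.1 * a) ⟨b, hb⟩ m
    have h2 := comp_mul f g v ⟨a, ha⟩ m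
    have h3 := comp_mul g h ⟨a, ha⟩ ⟨b, hb⟩ (f.toFun v m)
    simp only at h1 h2 h3
    rw [← mul_assoc, h1, h2, h3]
  · intro a b ha hb
    simp [mul_add, ha, hb]

lemma in₃_act (f : BMap M N) (g : BMap N L) (a : T.zero W₀ W₁) (m : M) :
    (map₃ f g).ext.act a.1 (in₃ f g m) = in₃ f g (M.act a m) := by
  refine ExtMap.ext_eq _ (ExtMap.ext_eq _ (ExtMap.ext_eq _ rfl ?_) ?_) ?_
  all_goals simp [in₃, ExtMap.fst_act, ExtMap.snd_act_zero]

lemma comp_left (f : BMap M N) (g : BMap N L) (a : T.zero W₀ W₁) (y : T W₀ W₁) (m : M) :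
    comp f g (a.1 * y) m = comp f g y (M.act a m) := by
  rw [comp_apply, RightMod.act_mul, in₃_act, comp_apply]

lemma comp_right (f : BMap M N) (g : BMap N L) (a : T.zero W₀ W₁) (y : T W₀ W₁) (m : M) :
    comp f g (y * a.1) m = L.act a (comp f g y m) := by
  rw [comp_apply, RightMod.act_mul, ExtMap.snd_act_zero, comp_apply]

lemma comp_zero_left {f : BMap M N} (g : BMap N L) (hf : f.toFun = 0) {y : T W₀ W₁}
    (hy : y ∈ T.gr W₀ W₁ 2) : comp f g y = 0 := by
  ext m
  refine Submodule.mul_induction_on (T.gr_two_le hy) (fun a ha b hb => ?_) (fun a b ha hb => ?_)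
  · exact (comp_mul f g ⟨a, ha⟩ ⟨b, hb⟩ m).trans (by simp [hf])
  · rw [map_add, LinearMap.add_apply, ha, hb]; simp

lemma comp_zero_right (f : BMap M N) {g : BMap N L} (hg : g.toFun = 0) {y : T W₀ W₁}
    (hy : y ∈ T.gr W₀ W₁ 2) : comp f g y = 0 := by
  ext m
  refine Submodule.mul_induction_on (T.gr_two_le hy) (fun a ha b hb => ?_) (fun a b ha hb => ?_)
  · exact (comp_mul f g ⟨a, ha⟩ ⟨b, hb⟩ m).trans (by simp [hg])
  · rw [map_add, LinearMap.add_apply, ha, hb]; simp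

end BMap

/-! ## Differential tensor algebras and their modules -/

/-- A differential tensor algebra (ditalgebra) `(T_R(W), d)` over the field `K`, where
`W = W₀ ⊕ W₁` is an `R`-bimodule graded in degrees `0` and `1`. -/
structure Ditalgebra (K : Type u) [Field K] where
  R : Type u
  [ring : Ring R]
  [algebra : Algebra K R]
  W₀ : Bimod K R
  W₁ : Bimod K R
  d : T W₀ W₁ →ₗ[K] T W₀ W₁
  d_gr : ∀ n a, a ∈ T.gr W₀ W₁ n → d a ∈ T.gr W₀ W₁ (n + 1)
  d_R : ∀ r, d (T.ιR W₀ W₁ r) = 0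
  d_mul : ∀ m n a b, a ∈ T.gr W₀ W₁ m → b ∈ T.gr W₀ W₁ n →
    d (a * b) = d a * b + (-1) ^ m * (a * d b)
  d_d : ∀ a, d (d a) = 0

attribute [instance] Ditalgebra.ring Ditalgebra.algebra

namespace Ditalgebra

variable {K : Type u} [Field K] (𝒜 : Ditalgebra K)

/-- The algebra `T_R(W)_0`. -/
abbrev T₀ : Subalgebra K (T 𝒜.W₀ 𝒜.W₁) := T.zero 𝒜.W₀ 𝒜.W₁

/-- The `T_R(W)_0`-bimodule `T_R(W)_1`. -/
abbrev T₁ : Submodule K (T 𝒜.W₀ 𝒜.W₁) := T.gr 𝒜.W₀ 𝒜.W₁ 1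

/-- The differential `T_R(W)_0 → T_R(W)_1`. -/
def d₀ : 𝒜.T₀ →ₗ[K] 𝒜.T₁ :=
  (𝒜.d ∘ₗ 𝒜.T₀.val.toLinearMap).codRestrict _ (fun a => 𝒜.d_gr 0 a.1 a.2)

lemma d_d₀ (a : 𝒜.T₀) : 𝒜.d (𝒜.d₀ a).1 = 0 := 𝒜.d_d _

lemma d_lmul (a : 𝒜.T₀) (v : 𝒜.T₁) :
    𝒜.d (T.lmul a v).1 = (𝒜.d₀ a).1 * v.1 + a.1 * 𝒜.d v.1 := by
  have := 𝒜.d_mul 0 1 a.1 v.1 a.2 v.2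
  rw [pow_zero, one_mul] at this
  exact this

lemma d_rmul (v : 𝒜.T₁) (a : 𝒜.T₀) :
    𝒜.d (T.rmul v a).1 = 𝒜.d v.1 * a.1 - v.1 * (𝒜.d₀ a).1 := by
  have := 𝒜.d_mul 1 0 v.1 a.1 v.2 a.2
  rw [pow_one, neg_one_mul, ← sub_eq_add_neg] at this
  exact this

lemma d_mul_one (v w : 𝒜.T₁) : 𝒜.d (v.1 * w.1) = 𝒜.d v.1 * w.1 - v.1 * 𝒜.d w.1 := by
  have := 𝒜.d_mul 1 1 v.1 w.1 v.2 w.2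
  rw [pow_one, neg_one_mul, ← sub_eq_add_neg] at this
  exact this

/-- The objects of `Mod 𝒜`: right modules over `T_R(W)_0`. -/
structure Mod where
  /-- The underlying right module. -/
  mod : RightMod K 𝒜.T₀

namespace Mod

variable {𝒜}

/-- A morphism `f = (f⁰, f¹)` of `Mod 𝒜`: `f⁰` is a morphism of right `R`-modules, `f¹` is a
morphism of `T_0`-bimodules `T_1 → Hom_K(M, N)`, and
`f⁰(m) a = f⁰(m a) + f¹(d a)(m)` for `a ∈ T_0` and `m ∈ M`. -/
@[ext] structure Hom (M N : 𝒜.Mod) where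
  f₀ : M.mod →ₗ[K] N.mod
  f₁ : BMap M.mod N.mod
  map_R : ∀ (r : 𝒜.R) m, f₀ (M.mod.act (T.rZero r) m) = N.mod.act (T.rZero r) (f₀ m)
  map_act : ∀ (a : 𝒜.T₀) m,
    N.mod.act a (f₀ m) = f₀ (M.mod.act a m) + f₁.toFun (𝒜.d₀ a) m

namespace Hom

variable {M N L Q : 𝒜.Mod}

/-- The identity `(id, 0)`. -/
def id (M : 𝒜.Mod) : Hom M M where
  f₀ := LinearMap.id
  f₁ := ⟨0, fun _ _ _ => rfl, fun _ _ _ => (map_zero _).symm⟩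
  map_R _ _ := rfl
  map_act a m := by simp

/-- The composition: `(g f)⁰ = g⁰ f⁰` and
`(g f)¹(v) = g¹(v) f⁰ + g⁰ f¹(v) - ∑ g¹(vᵢ²) f¹(vᵢ¹)` where `d v = ∑ vᵢ¹ vᵢ²`.
The sign is the Koszul sign of the interchange of `vᵢ¹` and `vᵢ²`; with it, `(g f)¹` is again a
morphism of bimodules. -/
def comp (f : Hom M N) (g : Hom N L) : Hom M L where
  f₀ := g.f₀ ∘ₗ f.f₀
  f₁ :=
    { toFun := LinearMap.lcomp K L.mod f.f₀ ∘ₗ g.f₁.toFun +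
        LinearMap.llcomp K M.mod N.mod L.mod g.f₀ ∘ₗ f.f₁.toFun -
        BMap.comp f.f₁ g.f₁ ∘ₗ 𝒜.d ∘ₗ 𝒜.T₁.subtype
      left := fun a v m => by
        have h1 : BMap.comp f.f₁ g.f₁ (𝒜.d (T.lmul a v).1) m =
            g.f₁.toFun v (f.f₁.toFun (𝒜.d₀ a) m) +
              BMap.comp f.f₁ g.f₁ (𝒜.d v.1) (M.mod.act a m) := by
          rw [d_lmul, map_add, LinearMap.add_apply, BMap.comp_mul, BMap.comp_left]
        simp only [LinearMap.sub_apply, LinearMap.add_apply, LinearMap.comp_apply,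
          LinearMap.lcomp_apply, LinearMap.llcomp_apply, Submodule.subtype_apply, h1,
          g.f₁.left, f.f₁.left, f.map_act, map_add]
        abel
      right := fun v a m => by
        have h1 : BMap.comp f.f₁ g.f₁ (𝒜.d (T.rmul v a).1) m =
            L.mod.act a (BMap.comp f.f₁ g.f₁ (𝒜.d v.1) m) -
              g.f₁.toFun (𝒜.d₀ a) (f.f₁.toFun v m) := by
          rw [d_rmul, map_sub, LinearMap.sub_apply, BMap.comp_mul, BMap.comp_right]
        simp only [LinearMap.sub_apply, LinearMap.add_apply, LinearMap.comp_apply,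
          LinearMap.lcomp_apply, LinearMap.llcomp_apply, Submodule.subtype_apply, h1,
          g.f₁.right, f.f₁.right, map_add, map_sub, g.map_act]
        abel }
  map_R r m := by simp [f.map_R, g.map_R]
  map_act a m := by
    have h1 : BMap.comp f.f₁ g.f₁ (𝒜.d (𝒜.d₀ a).1) m = 0 := by
      rw [d_d₀, map_zero, LinearMap.zero_apply]
    simp only [LinearMap.sub_apply, LinearMap.add_apply, LinearMap.comp_apply,
      LinearMap.lcomp_apply, LinearMap.llcomp_apply, Submodule.subtype_apply, h1,
      g.map_act, f.map_act, map_add]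
    abel

lemma comp_f₁ (f : Hom M N) (g : Hom N L) (v : 𝒜.T₁) (m : M.mod) :
    (comp f g).f₁.toFun v m = g.f₁.toFun v (f.f₀ m) + g.f₀ (f.f₁.toFun v m) -
      BMap.comp f.f₁ g.f₁ (𝒜.d v.1) m := rfl

lemma ext' {f g : Hom M N} (h₀ : ∀ m, f.f₀ m = g.f₀ m)
    (h₁ : ∀ v m, f.f₁.toFun v m = g.f₁.toFun v m) : f = g :=
  Hom.ext (LinearMap.ext h₀) (BMap.ext (LinearMap.ext fun v => LinearMap.ext (h₁ v)))

lemma assoc_aux (f : Hom M N) (g : Hom N L) (h : Hom L Q) {x : T 𝒜.W₀ 𝒜.W₁}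
    (hx : x ∈ T.gr 𝒜.W₀ 𝒜.W₁ 2) (m : M.mod) :
    h.f₀ (BMap.comp f.f₁ g.f₁ x m) + BMap.comp (comp f g).f₁ h.f₁ x m -
      (BMap.comp g.f₁ h.f₁ x (f.f₀ m) + BMap.comp f.f₁ (comp g h).f₁ x m) =
      -(BMap.comp₃ f.f₁ g.f₁ h.f₁ (𝒜.d x) m) := by
  refine Submodule.mul_induction_on (T.gr_two_le hx) ?_ ?_
  · intro a ha b hb
    have e1 := BMap.comp_mul f.f₁ g.f₁ ⟨a, ha⟩ ⟨b, hb⟩ m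
    have e2 := BMap.comp_mul (comp f g).f₁ h.f₁ ⟨a, ha⟩ ⟨b, hb⟩ m
    have e3 := BMap.comp_mul g.f₁ h.f₁ ⟨a, ha⟩ ⟨b, hb⟩ (f.f₀ m)
    have e4 := BMap.comp_mul f.f₁ (comp g h).f₁ ⟨a, ha⟩ ⟨b, hb⟩ m
    have e5 := 𝒜.d_mul_one ⟨a, ha⟩ ⟨b, hb⟩
    have e6 := BMap.comp₃_mul_right f.f₁ g.f₁ h.f₁ (𝒜.d a) ⟨b, hb⟩ m
    have e7 := BMap.comp₃_mul_left f.f₁ g.f₁ h.f₁ ⟨a, ha⟩ (𝒜.d_gr 1 b hb) m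
    simp only at e1 e2 e3 e4 e5 e6 e7
    rw [e1, e2, e3, e4, e5, map_sub, LinearMap.sub_apply, e6, e7, comp_f₁, comp_f₁]
    simp only [map_add, map_sub]
    abel
  · intro a b ha hb
    simp only [map_add, LinearMap.add_apply, neg_add] at ha hb ⊢
    rw [← ha, ← hb]
    abel

end Hom

instance : Category 𝒜.Mod where
  Hom := Hom
  id := Hom.id
  comp f g := Hom.comp f g
  id_comp {M N} f := by
    refine Hom.ext' (fun m => rfl) (fun v m => ?_)
    rw [Hom.comp_f₁, BMap.comp_zero_left _ rfl (𝒜.d_gr 1 _ v.2)]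
    simp [Hom.id]
  comp_id {M N} f := by
    refine Hom.ext' (fun m => rfl) (fun v m => ?_)
    rw [Hom.comp_f₁, BMap.comp_zero_right _ rfl (𝒜.d_gr 1 _ v.2)]
    simp [Hom.id]
  assoc {M N L Q} f g h := by
    refine Hom.ext' (fun m => rfl) (fun v m => ?_)
    have := Hom.assoc_aux f g h (𝒜.d_gr 1 _ v.2) m
    rw [𝒜.d_d, map_zero, LinearMap.zero_apply, neg_zero, sub_eq_zero] at this
    simp only [Hom.comp_f₁, map_sub, map_add]
    rw [← sub_eq_zero] at this ⊢
    rw [← neg_eq_zero, ← this]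
    simp only [Hom.comp, LinearMap.comp_apply]
    abel

end Mod

end Ditalgebra

/-! ## Differentials defined on generators -/

section Differential

variable {K : Type u} [Field K] {R : Type u} [Ring R] [Algebra K R]

namespace T

variable {W₀ W₁ : Bimod K R}

lemma mono_induction {p : T W₀ W₁ → Prop} (hM : ∀ n a, Mono W₀ W₁ n a → p a)
    (hadd : ∀ a b, p a → p b → p (a + b)) (hsmul : ∀ (k : K) a, p a → p (k • a))
    (a : T W₀ W₁) : p a := by
  have key : a ∈ Submodule.span K {a | ∃ n, Mono W₀ W₁ n a} := by
    induction a using T.induction with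
    | hR r => exact Submodule.subset_span ⟨0, Mono.ofR r⟩
    | hW w =>
      have : w = (w.1, 0) + (0, w.2) := by simp
      rw [this, map_add]
      exact add_mem (Submodule.subset_span ⟨0, Mono.ofW₀ _⟩)
        (Submodule.subset_span ⟨1, Mono.ofW₁ _⟩)
    | hadd a b ha hb => exact add_mem ha hb
    | hmul a b ha hb =>
      have h := Submodule.mul_mem_mul ha hb
      rw [Submodule.span_mul_span] at h
      refine Submodule.span_mono ?_ h
      rintro _ ⟨x, ⟨m, hx⟩, y, ⟨n, hy⟩, rfl⟩
      exact ⟨m + n, Mono.mul hx hy⟩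
  refine Submodule.span_induction (p := fun a _ => p a) ?_ ?_ (fun a b _ _ => hadd a b)
    (fun k a _ => hsmul k a) key
  · rintro a ⟨n, ha⟩
    exact hM n a ha
  · have := hM 0 _ (Mono.ofR 0)
    rwa [map_zero] at this

variable (W₀ W₁) in
/-- The automorphism of `T_R(W)` acting as `(-1)^n` in degree `n`. -/
def sgn : T W₀ W₁ →ₐ[K] T W₀ W₁ :=
  lift (ιR W₀ W₁) (ιW W₀ W₁ ∘ₗ LinearMap.prodMap LinearMap.id (-LinearMap.id))
    (fun r w => by
      rw [LinearMap.comp_apply, LinearMap.comp_apply, ← ιW_left]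
      congr 1
      ext <;> simp)
    (fun r w => by
      rw [LinearMap.comp_apply, LinearMap.comp_apply, ← ιW_right]
      congr 1
      ext <;> simp)

@[simp] lemma sgn_ιR (r : R) : sgn W₀ W₁ (ιR W₀ W₁ r) = ιR W₀ W₁ r := by simp [sgn]

@[simp] lemma sgn_ιW (w : W₀ × W₁) : sgn W₀ W₁ (ιW W₀ W₁ w) = ιW W₀ W₁ (w.1, -w.2) := by
  simp [sgn]

lemma sgn_mono {n : ℕ} {a : T W₀ W₁} (h : Mono W₀ W₁ n a) : sgn W₀ W₁ a = (-1) ^ n * a := by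
  induction h with
  | ofR r => simp
  | ofW₀ w => simp
  | ofW₁ w =>
    have : ((0, -w) : W₀ × W₁) = -(0, w) := by simp
    rw [sgn_ιW, this, map_neg]
    simp
  | @mul m n a b ha hb iha ihb =>
    rw [map_mul, iha, ihb, pow_add]
    have : Commute a ((-1) ^ n) := (Commute.neg_one_right a).pow_right n
    rw [mul_assoc, ← mul_assoc a, this.eq]
    simp only [mul_assoc]

lemma sgn_gr {n : ℕ} {a : T W₀ W₁} (h : a ∈ gr W₀ W₁ n) : sgn W₀ W₁ a = (-1) ^ n * a := by
  refine Submodule.span_induction (p := fun a _ => sgn W₀ W₁ a = (-1) ^ n * a)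
    (fun a ha => sgn_mono ha) (by simp) (fun a b _ _ ha hb => by rw [map_add, ha, hb, mul_add])
    (fun k a _ ha => by rw [map_smul, ha, mul_smul_comm]) h

end T

/-- Morphisms of `R`-bimodules `W₀ → T_R(W)_1` and `W₁ → T_R(W)_2`. -/
structure DiffData (W₀ W₁ : Bimod K R) where
  δ₀ : W₀ →ₗ[K] T W₀ W₁
  δ₁ : W₁ →ₗ[K] T W₀ W₁
  left₀ : ∀ (r : R) w, δ₀ (r • w) = T.ιR W₀ W₁ r * δ₀ w
  right₀ : ∀ (r : R) w, δ₀ (op r • w) = δ₀ w * T.ιR W₀ W₁ r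
  left₁ : ∀ (r : R) w, δ₁ (r • w) = T.ιR W₀ W₁ r * δ₁ w
  right₁ : ∀ (r : R) w, δ₁ (op r • w) = δ₁ w * T.ιR W₀ W₁ r
  mem₀ : ∀ w, δ₀ w ∈ T.gr W₀ W₁ 1
  mem₁ : ∀ w, δ₁ w ∈ T.gr W₀ W₁ 2

namespace DiffData

variable {W₀ W₁ : Bimod K R} (X : DiffData W₀ W₁)

/-- The map on `W = W₀ ⊕ W₁`. -/
def δ : (W₀ × W₁) →ₗ[K] T W₀ W₁ := LinearMap.coprod X.δ₀ X.δ₁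

lemma δ_left (r : R) (w : W₀ × W₁) : X.δ (r • w) = T.ιR W₀ W₁ r * X.δ w := by
  simp [δ, X.left₀, X.left₁, mul_add]

lemma δ_right (r : R) (w : W₀ × W₁) : X.δ (op r • w) = X.δ w * T.ιR W₀ W₁ r := by
  simp [δ, X.right₀, X.right₁, add_mul]

lemma sgn_δ (w : W₀ × W₁) : T.sgn W₀ W₁ (X.δ w) = -X.δ (w.1, -w.2) := by
  have h0 := T.sgn_gr (X.mem₀ w.1)
  have h1 := T.sgn_gr (X.mem₁ w.2)
  simp only [pow_one, neg_one_mul, neg_one_sq, one_mul] at h0 h1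
  simp [δ, h0, h1, add_comm]

/-- The endomorphism `(x, y) ↦ (a x + b y, c y)` of `T × T`, for a `K`-algebra `T`. -/
def tri {K : Type u} [Field K] {T : Type u} [Ring T] [Algebra K T] (a b c : T) :
    Module.End K (T × T) where
  toFun p := (a * p.1 + b * p.2, c * p.2)
  map_add' p q := by ext <;> simp only [Prod.fst_add, Prod.snd_add, mul_add] ; abel
  map_smul' k p := by ext <;> simp

lemma tri_mul {T : Type u} [Ring T] [Algebra K T] (a b c a' b' c' : T) :
    (tri a b c * tri a' b' c' : Module.End K (T × T)) =
      tri (a * a') (a * b' + b * c') (c * c') :=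
  LinearMap.ext fun p => Prod.ext
    (by
      change a * (a' * p.1 + b' * p.2) + b * (c' * p.2) =
        a * a' * p.1 + (a * b' + b * c') * p.2
      noncomm_ring)
    (mul_assoc c c' p.2).symm

lemma tri_add {T : Type u} [Ring T] [Algebra K T] (a b c a' b' c' : T) :
    (tri (a + a') (b + b') (c + c') : Module.End K (T × T)) = tri a b c + tri a' b' c' :=
  LinearMap.ext fun p => Prod.ext
    (by
      change (a + a') * p.1 + (b + b') * p.2 = a * p.1 + b * p.2 + (a' * p.1 + b' * p.2)
      noncomm_ring)
    (add_mul c c' p.2)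

lemma tri_smul {T : Type u} [Ring T] [Algebra K T] (k : K) (a b c : T) :
    (tri (k • a) (k • b) (k • c) : Module.End K (T × T)) = k • tri a b c :=
  LinearMap.ext fun p => Prod.ext
    (by
      change (k • a) * p.1 + (k • b) * p.2 = k • (a * p.1 + b * p.2)
      rw [smul_mul_assoc, smul_mul_assoc, smul_add])
    (smul_mul_assoc k c p.2)

lemma tri_one {T : Type u} [Ring T] [Algebra K T] :
    (tri 1 0 1 : Module.End K (T × T)) = 1 :=
  LinearMap.ext fun p => Prod.ext
    (by
      change 1 * p.1 + 0 * p.2 = p.1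
      rw [one_mul, zero_mul, add_zero])
    (one_mul p.2)

/-- The homomorphism sending `a` to the triangular matrix with rows `((-1)^{|a|} a, d a)` and
`(0, a)`; it encodes the Leibniz rule. -/
def φ : T W₀ W₁ →ₐ[K] Module.End K (T W₀ W₁ × T W₀ W₁) :=
  T.lift
    (AlgHom.ofLinearMap
      { toFun := fun r => tri (T.ιR W₀ W₁ r) 0 (T.ιR W₀ W₁ r)
        map_add' := fun r s => by rw [map_add, ← tri_add, add_zero]
        map_smul' := fun k r => by rw [map_smul, RingHom.id_apply, ← tri_smul, smul_zero] }
      (by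
        change tri (T.ιR W₀ W₁ 1) 0 (T.ιR W₀ W₁ 1) = 1
        rw [map_one, tri_one])
      (fun r s => by
        change tri (T.ιR W₀ W₁ (r * s)) 0 (T.ιR W₀ W₁ (r * s)) =
          tri (T.ιR W₀ W₁ r) 0 (T.ιR W₀ W₁ r) * tri (T.ιR W₀ W₁ s) 0 (T.ιR W₀ W₁ s)
        rw [map_mul, tri_mul, mul_zero, zero_mul, add_zero]))
    { toFun := fun w => tri (T.sgn W₀ W₁ (T.ιW W₀ W₁ w)) (X.δ w) (T.ιW W₀ W₁ w)
      map_add' := fun v w => by rw [map_add, map_add, map_add, tri_add]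
      map_smul' := fun k w => by
        rw [map_smul, map_smul, map_smul, RingHom.id_apply, ← tri_smul] }
    (fun r w => by
      change tri (T.sgn W₀ W₁ (T.ιW W₀ W₁ (r • w))) (X.δ (r • w)) (T.ιW W₀ W₁ (r • w)) =
        tri (T.ιR W₀ W₁ r) 0 (T.ιR W₀ W₁ r) *
          tri (T.sgn W₀ W₁ (T.ιW W₀ W₁ w)) (X.δ w) (T.ιW W₀ W₁ w)
      rw [tri_mul, T.ιW_left, X.δ_left, map_mul, T.sgn_ιR, zero_mul, add_zero])
    (fun r w => by
      change tri (T.sgn W₀ W₁ (T.ιW W₀ W₁ (op r • w))) (X.δ (op r • w)) (T.ιW W₀ W₁ (op r • w)) =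
        tri (T.sgn W₀ W₁ (T.ιW W₀ W₁ w)) (X.δ w) (T.ιW W₀ W₁ w) *
          tri (T.ιR W₀ W₁ r) 0 (T.ιR W₀ W₁ r)
      rw [tri_mul, T.ιW_right, X.δ_right, map_mul, T.sgn_ιR, mul_zero, zero_add])

lemma φ_ιR (r : R) : X.φ (T.ιR W₀ W₁ r) = tri (T.ιR W₀ W₁ r) 0 (T.ιR W₀ W₁ r) :=
  T.lift_ιR _ _ _ _ r

lemma φ_ιW (w : W₀ × W₁) :
    X.φ (T.ιW W₀ W₁ w) = tri (T.sgn W₀ W₁ (T.ιW W₀ W₁ w)) (X.δ w) (T.ιW W₀ W₁ w) :=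
  T.lift_ιW _ _ _ _ w

/-- The differential of `T_R(W)` extending `δ₀` and `δ₁` by the Leibniz rule. -/
def d : T W₀ W₁ →ₗ[K] T W₀ W₁ where
  toFun a := (X.φ a (0, 1)).1
  map_add' a b := by rw [map_add]; rfl
  map_smul' k a := by rw [map_smul]; rfl

lemma tri_d {T : Type u} [Ring T] [Algebra K T] (a b c : T) :
    ((tri a b c : Module.End K (T × T)) (0, 1)).1 = b := by
  change a * 0 + b * 1 = b
  rw [mul_zero, mul_one, zero_add]

lemma φ_eq (a : T W₀ W₁) : X.φ a = tri (T.sgn W₀ W₁ a) (X.d a) a := by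
  induction a using T.induction with
  | hR r =>
    have : X.d (T.ιR W₀ W₁ r) = 0 :=
      (congrArg (fun f => (f (0, 1)).1) (X.φ_ιR r)).trans (tri_d _ _ _)
    rw [φ_ιR, this, T.sgn_ιR]
  | hW w =>
    have : X.d (T.ιW W₀ W₁ w) = X.δ w :=
      (congrArg (fun f => (f (0, 1)).1) (X.φ_ιW w)).trans (tri_d _ _ _)
    rw [φ_ιW, this]
  | hadd a b ha hb => rw [map_add, map_add, map_add, tri_add, ha, hb]
  | hmul a b ha hb =>
    have h : X.φ (a * b) =
        tri (T.sgn W₀ W₁ (a * b)) (T.sgn W₀ W₁ a * X.d b + X.d a * b) (a * b) := by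
      rw [map_mul, map_mul, ha, hb, tri_mul]
    have h2 : X.d (a * b) = T.sgn W₀ W₁ a * X.d b + X.d a * b :=
      (congrArg (fun f => (f (0, 1)).1) h).trans (tri_d _ _ _)
    rw [h, h2]

lemma d_mul (a b : T W₀ W₁) : X.d (a * b) = T.sgn W₀ W₁ a * X.d b + X.d a * b := by
  have h : X.φ (a * b) =
      tri (T.sgn W₀ W₁ (a * b)) (T.sgn W₀ W₁ a * X.d b + X.d a * b) (a * b) := by
    rw [map_mul, map_mul, X.φ_eq a, X.φ_eq b, tri_mul]
  exact (congrArg (fun f => (f (0, 1)).1) h).trans (tri_d _ _ _)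

@[simp] lemma d_ιR (r : R) : X.d (T.ιR W₀ W₁ r) = 0 :=
  (congrArg (fun f => (f (0, 1)).1) (X.φ_ιR r)).trans (tri_d _ _ _)

@[simp] lemma d_ιW (w : W₀ × W₁) : X.d (T.ιW W₀ W₁ w) = X.δ w :=
  (congrArg (fun f => (f (0, 1)).1) (X.φ_ιW w)).trans (tri_d _ _ _)

lemma d_ιW₀ (w : W₀) : X.d (T.ιW W₀ W₁ (w, 0)) = X.δ₀ w := by simp [δ]

lemma d_ιW₁ (w : W₁) : X.d (T.ιW W₀ W₁ (0, w)) = X.δ₁ w := by simp [δ]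

lemma d_mono {n : ℕ} {a : T W₀ W₁} (h : T.Mono W₀ W₁ n a) : X.d a ∈ T.gr W₀ W₁ (n + 1) := by
  induction h with
  | ofR r => simp
  | ofW₀ w => rw [d_ιW₀]; exact X.mem₀ w
  | ofW₁ w => rw [d_ιW₁]; exact X.mem₁ w
  | @mul m n a b ha hb iha ihb =>
    rw [d_mul]
    have hs : T.sgn W₀ W₁ a ∈ T.gr W₀ W₁ m := by
      rw [T.sgn_gr ha.mem]
      rcases neg_one_pow_eq_or (T W₀ W₁) m with h | h <;> rw [h]
      · rw [one_mul]; exact ha.mem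
      · rw [neg_one_mul]; exact neg_mem ha.mem
    exact add_mem (T.mul_mem_gr' hs ihb (by omega)) (T.mul_mem_gr' iha hb.mem (by omega))

lemma d_gr (n : ℕ) (a : T W₀ W₁) (h : a ∈ T.gr W₀ W₁ n) : X.d a ∈ T.gr W₀ W₁ (n + 1) := by
  have : T.gr W₀ W₁ n ≤ (T.gr W₀ W₁ (n + 1)).comap X.d :=
    Submodule.span_le.2 fun a ha => X.d_mono ha
  exact this h

lemma d_sgn (a : T W₀ W₁) : X.d (T.sgn W₀ W₁ a) = -T.sgn W₀ W₁ (X.d a) := by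
  induction a using T.induction with
  | hR r => simp
  | hW w => rw [T.sgn_ιW, d_ιW, d_ιW, sgn_δ, neg_neg]
  | hadd a b ha hb => simp only [map_add, ha, hb]; abel
  | hmul a b ha hb => simp only [map_mul, d_mul, ha, hb, map_add]; noncomm_ring

lemma d_d (h₀ : ∀ w, X.d (X.δ₀ w) = 0) (h₁ : ∀ w, X.d (X.δ₁ w) = 0) (a : T W₀ W₁) :
    X.d (X.d a) = 0 := by
  induction a using T.induction with
  | hR r => simp
  | hW w => simp [δ, h₀, h₁]
  | hadd a b ha hb => simp [ha, hb]
  | hmul a b ha hb => simp [d_mul, ha, hb, d_sgn]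

/-- The ditalgebra `(T_R(W), d)` with the differential determined by `δ₀` and `δ₁`. -/
abbrev ditalgebra (h₀ : ∀ w, X.d (X.δ₀ w) = 0) (h₁ : ∀ w, X.d (X.δ₁ w) = 0) : Ditalgebra K where
  R := R
  W₀ := W₀
  W₁ := W₁
  d := X.d
  d_gr := X.d_gr
  d_R := X.d_ιR
  d_mul m n a b ha _ := by rw [d_mul, T.sgn_gr ha, mul_assoc, add_comm]
  d_d := X.d_d h₀ h₁

end DiffData

end Differential

namespace Ditalgebra

variable {K : Type u} [Field K] (𝒜 : Ditalgebra K)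

lemma d_mul_sgn (a b : T 𝒜.W₀ 𝒜.W₁) :
    𝒜.d (a * b) = T.sgn 𝒜.W₀ 𝒜.W₁ a * 𝒜.d b + 𝒜.d a * b := by
  induction a using T.mono_induction with
  | hM m a ha =>
    induction b using T.mono_induction with
    | hM n b hb => rw [𝒜.d_mul m n a b ha.mem hb.mem, T.sgn_gr ha.mem, mul_assoc, add_comm]
    | hadd b c hb hc => rw [mul_add, map_add, hb, hc, map_add]; noncomm_ring
    | hsmul k b hb => simp [hb]
  | hadd a c ha hc => rw [add_mul, map_add, ha, hc, map_add, map_add]; noncomm_ring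
  | hsmul k a ha => simp [ha]

end Ditalgebra

/-! ## Reduction by a central idempotent -/

namespace Bimod

variable {K : Type u} [Field K] {R : Type u} [Ring R] [Algebra K R] (W : Bimod K R)

instance : SMulCommClass Rᵐᵒᵖ R W := SMulCommClass.symm _ _ _

lemma lsmul_K (r : R) (k : K) (w : W) : r • k • w = k • r • w := by
  rw [← algebraMap_smul R k w, ← mul_smul, ← Algebra.commutes, mul_smul, algebraMap_smul]

lemma rsmul_K (r : R) (k : K) (w : W) : op r • k • w = k • op r • w := by
  rw [← algebraMap_smul Rᵐᵒᵖ k w, ← mul_smul, ← Algebra.commutes, mul_smul, algebraMap_smul]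

end Bimod

/-- A central idempotent of a ring. -/
structure CIdem (R : Type u) [Ring R] where
  e : R
  idem : IsIdempotentElem e
  comm : ∀ r, e * r = r * e

namespace CIdem

variable {K : Type u} [Field K] {R : Type u} [Ring R] [Algebra K R] (c : CIdem R)

/-- The ring `e R e`. -/
def Crn : Type u := c.idem.Corner

instance : Ring c.Crn := inferInstanceAs (Ring c.idem.Corner)

/-- The inclusion of `e R e` in `R`. -/
def val (x : c.Crn) : R := x.1

lemma val_injective : Function.Injective c.val := Subtype.val_injective

@[simp] lemma val_one : c.val 1 = c.e := rfl
@[simp] lemma val_zero : c.val 0 = 0 := rfl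
@[simp] lemma val_add (x y : c.Crn) : c.val (x + y) = c.val x + c.val y := rfl
@[simp] lemma val_mul (x y : c.Crn) : c.val (x * y) = c.val x * c.val y := rfl

lemma e_val (x : c.Crn) : c.e * c.val x = c.val x :=
  ((Subsemigroup.mem_corner_iff c.idem).mp x.2).1

/-- The projection `R → e R e`, `r ↦ e r e`. -/
def π : R →+* c.Crn where
  toFun r := ⟨c.e * r * c.e, r, rfl⟩
  map_one' := c.val_injective (by
    change c.e * 1 * c.e = c.e
    rw [mul_one, c.idem.eq])
  map_zero' := c.val_injective (by
    change c.e * 0 * c.e = 0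
    simp)
  map_add' r s := c.val_injective (by
    change c.e * (r + s) * c.e = c.e * r * c.e + c.e * s * c.e
    noncomm_ring)
  map_mul' r s := c.val_injective (by
    change c.e * (r * s) * c.e = c.e * r * c.e * (c.e * s * c.e)
    rw [← c.comm, ← c.comm, ← c.comm, ← mul_assoc c.e c.e, c.idem.eq, ← mul_assoc c.e c.e,
      c.idem.eq, ← mul_assoc c.e c.e, c.idem.eq, mul_assoc, ← mul_assoc r, ← c.comm r, mul_assoc,
      ← mul_assoc c.e c.e, c.idem.eq])

lemma val_π (r : R) : c.val (c.π r) = c.e * r := by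
  change c.e * r * c.e = _
  rw [mul_assoc, ← c.comm, ← mul_assoc, c.idem.eq]

@[simp] lemma π_val (x : c.Crn) : c.π (c.val x) = x :=
  c.val_injective (by rw [val_π, e_val])

instance : Algebra K c.Crn :=
  (c.π.comp (algebraMap K R)).toAlgebra' (fun k x => c.val_injective (by
    change c.val (c.π _) * _ = _ * c.val (c.π _)
    rw [val_π, Algebra.algebraMap_eq_smul_one]
    simp [← c.comm]))

variable (K) in
/-- The projection `R → e R e` as a homomorphism of algebras. -/
def πA : R →ₐ[K] c.Crn where
  toRingHom := c.π
  commutes' _ := rfl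

@[simp] lemma πA_apply (r : R) : c.πA K r = c.π r := rfl

@[simp] lemma val_algebraMap (k : K) : c.val (algebraMap K c.Crn k) = k • c.e := by
  change c.val (c.π (algebraMap K R k)) = _
  rw [val_π, Algebra.algebraMap_eq_smul_one, mul_smul_comm, mul_one]

section

variable (W : Bimod K R)

/-- The subspace `e W e` of an `R`-bimodule `W`. -/
def sub : Submodule K W where
  carrier := {w | ∃ w' : W, c.e • op c.e • w' = w}
  add_mem' := by
    rintro _ _ ⟨v, rfl⟩ ⟨w, rfl⟩
    exact ⟨v + w, by simp⟩
  zero_mem' := ⟨0, by simp⟩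
  smul_mem' := by
    rintro k _ ⟨v, rfl⟩
    exact ⟨k • v, by rw [W.rsmul_K, W.lsmul_K]⟩

variable {W} in
lemma e_smul {w : W} (hw : w ∈ c.sub W) : c.e • w = w := by
  obtain ⟨v, rfl⟩ := hw
  rw [← mul_smul, c.idem.eq]

variable {W} in
lemma smul_e {w : W} (hw : w ∈ c.sub W) : op c.e • w = w := by
  obtain ⟨v, rfl⟩ := hw
  rw [smul_comm, ← mul_smul (op c.e), ← op_mul, c.idem.eq]

variable {W} in
lemma mem_sub {w : W} (h1 : c.e • w = w) (h2 : op c.e • w = w) : w ∈ c.sub W :=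
  ⟨w, by rw [h2, h1]⟩

instance : Module c.Crn (c.sub W) where
  smul x w := ⟨c.val x • w.1, c.mem_sub (by rw [← mul_smul, e_val])
    (by rw [smul_comm, c.smul_e w.2])⟩
  one_smul w := Subtype.ext (c.e_smul w.2)
  mul_smul x y w := Subtype.ext (mul_smul (c.val x) (c.val y) w.1)
  smul_zero x := Subtype.ext (smul_zero (c.val x))
  smul_add x v w := Subtype.ext (smul_add (c.val x) v.1 w.1)
  add_smul x y w := Subtype.ext (add_smul (c.val x) (c.val y) w.1)
  zero_smul w := Subtype.ext (zero_smul R w.1)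

instance : Module c.Crnᵐᵒᵖ (c.sub W) where
  smul x w := ⟨op (c.val x.unop) • w.1, c.mem_sub (by rw [smul_comm, c.e_smul w.2])
    (by rw [← mul_smul, ← op_mul, ← c.comm, e_val])⟩
  one_smul w := Subtype.ext (c.smul_e w.2)
  mul_smul x y w := Subtype.ext (mul_smul (op (c.val x.unop)) (op (c.val y.unop)) w.1)
  smul_zero x := Subtype.ext (smul_zero (op (c.val x.unop)))
  smul_add x v w := Subtype.ext (smul_add (op (c.val x.unop)) v.1 w.1)
  add_smul x y w := Subtype.ext (add_smul (op (c.val x.unop)) (op (c.val y.unop)) w.1)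
  zero_smul w := Subtype.ext (zero_smul Rᵐᵒᵖ w.1)

variable {W} in
lemma coe_smul (x : c.Crn) (w : c.sub W) : ((x • w : c.sub W) : W) = c.val x • (w : W) := rfl

variable {W} in
lemma coe_op_smul (x : c.Crn) (w : c.sub W) :
    ((op x • w : c.sub W) : W) = op (c.val x) • (w : W) := rfl

/-- The `e R e`-bimodule `e W e`. -/
def bimod : Bimod K c.Crn where
  carrier := c.sub W
  comm := ⟨fun x y w => Subtype.ext (smul_comm (c.val x) (op (c.val y.unop)) w.1)⟩
  tower := IsScalarTower.of_algebraMap_smul fun k w => Subtype.ext (by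
    rw [coe_smul, val_algebraMap, smul_assoc, c.e_smul w.2]; rfl)
  towerOp := IsScalarTower.of_algebraMap_smul fun k w => Subtype.ext (by
    change op (c.val (algebraMap K c.Crn k)) • w.1 = k • w.1
    rw [val_algebraMap, op_smul, smul_assoc, c.smul_e w.2])

/-- The inclusion of `e W e` in `W`. -/
def incl : c.bimod W →ₗ[K] W := (c.sub W).subtype

/-- The projection `W → e W e`, `w ↦ e w e`. -/
def πW : W →ₗ[K] c.bimod W where
  toFun w := ⟨c.e • op c.e • w, w, rfl⟩
  map_add' v w := Subtype.ext (by
    change c.e • op c.e • (v + w) = c.e • op c.e • v + c.e • op c.e • w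
    rw [smul_add, smul_add])
  map_smul' k w := Subtype.ext (by
    change c.e • op c.e • k • w = k • (c.e • op c.e • w)
    rw [W.rsmul_K, W.lsmul_K])

variable {W}

lemma incl_smul (x : c.Crn) (w : c.bimod W) : c.incl W (x • w) = c.val x • c.incl W w := rfl

lemma incl_op_smul (x : c.Crn) (w : c.bimod W) :
    c.incl W (op x • w) = op (c.val x) • c.incl W w := rfl

lemma incl_injective : Function.Injective (c.incl W) := Subtype.val_injective

lemma incl_πW (w : W) : c.incl W (c.πW W w) = c.e • op c.e • w := rfl

@[simp] lemma πW_incl (w : c.bimod W) : c.πW W (c.incl W w) = w :=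
  c.incl_injective (by
    rw [incl_πW]
    exact (congrArg (c.e • ·) (c.smul_e w.2)).trans (c.e_smul w.2))

lemma πW_smul (r : R) (w : W) : c.πW W (r • w) = c.π r • c.πW W w :=
  c.incl_injective (by
    rw [incl_smul, incl_πW, incl_πW, val_π, smul_comm (op c.e), ← mul_smul, ← mul_smul,
      mul_assoc, ← c.comm, ← mul_assoc, c.idem.eq])

lemma πW_op_smul (r : R) (w : W) : c.πW W (op r • w) = op (c.π r) • c.πW W w :=
  c.incl_injective (by
    rw [incl_op_smul, incl_πW, incl_πW, val_π, smul_comm _ c.e, ← mul_smul (op c.e), ← op_mul,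
      ← mul_smul (op (c.e * r)), ← op_mul, ← mul_assoc, c.idem.eq, c.comm])

end

section

variable (W₀ W₁ : Bimod K R)

/-- The homomorphism `η : T_R(W) → T_{eRe}(eWe)` with `η(r) = e r e` and `η(w) = e w e`. -/
def η : T W₀ W₁ →ₐ[K] T (c.bimod W₀) (c.bimod W₁) :=
  T.lift ((T.ιR _ _).comp (c.πA K)) (T.ιW _ _ ∘ₗ LinearMap.prodMap (c.πW W₀) (c.πW W₁))
    (fun r w => by
      rw [LinearMap.comp_apply, AlgHom.comp_apply, LinearMap.comp_apply, ← T.ιW_left]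
      congr 1
      ext <;> simp [πW_smul])
    (fun r w => by
      rw [LinearMap.comp_apply, AlgHom.comp_apply, LinearMap.comp_apply, ← T.ιW_right]
      congr 1
      ext <;> simp [πW_op_smul])

variable {W₀ W₁}

@[simp] lemma η_ιR (r : R) : c.η W₀ W₁ (T.ιR _ _ r) = T.ιR _ _ (c.π r) := by simp [η]

@[simp] lemma η_ιW (w : W₀ × W₁) :
    c.η W₀ W₁ (T.ιW _ _ w) = T.ιW _ _ (c.πW W₀ w.1, c.πW W₁ w.2) := by
  simp [η]

lemma η_surjective : Function.Surjective (c.η W₀ W₁) := by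
  intro b
  induction b using T.induction with
  | hR r => exact ⟨T.ιR _ _ (c.val r), by simp⟩
  | hW w => exact ⟨T.ιW _ _ (c.incl W₀ w.1, c.incl W₁ w.2), by simp⟩
  | hadd a b ha hb =>
    obtain ⟨x, rfl⟩ := ha
    obtain ⟨y, rfl⟩ := hb
    exact ⟨x + y, map_add _ _ _⟩
  | hmul a b ha hb =>
    obtain ⟨x, rfl⟩ := ha
    obtain ⟨y, rfl⟩ := hb
    exact ⟨x * y, map_mul _ _ _⟩

lemma η_mono {n : ℕ} {a : T W₀ W₁} (h : T.Mono W₀ W₁ n a) :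
    T.Mono (c.bimod W₀) (c.bimod W₁) n (c.η W₀ W₁ a) := by
  induction h with
  | ofR r => rw [η_ιR]; exact T.Mono.ofR _
  | ofW₀ w => rw [η_ιW, map_zero]; exact T.Mono.ofW₀ _
  | ofW₁ w => rw [η_ιW, map_zero]; exact T.Mono.ofW₁ _
  | mul ha hb iha ihb => rw [map_mul]; exact T.Mono.mul iha ihb

lemma η_gr {n : ℕ} {a : T W₀ W₁} (h : a ∈ T.gr W₀ W₁ n) :
    c.η W₀ W₁ a ∈ T.gr (c.bimod W₀) (c.bimod W₁) n := by
  have : T.gr W₀ W₁ n ≤ (T.gr (c.bimod W₀) (c.bimod W₁) n).comap (c.η W₀ W₁).toLinearMap :=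
    Submodule.span_le.2 fun a ha => (c.η_mono ha).mem
  exact this h

lemma η_sgn (a : T W₀ W₁) : c.η W₀ W₁ (T.sgn _ _ a) = T.sgn _ _ (c.η W₀ W₁ a) := by
  induction a using T.induction with
  | hR r => simp
  | hW w => simp
  | hadd a b ha hb => simp [ha, hb]
  | hmul a b ha hb => simp [ha, hb]

end

end CIdem

namespace Ditalgebra

variable {K : Type u} [Field K] (𝒜 : Ditalgebra K) (c : CIdem 𝒜.R)

/-- The homomorphism `η : T_R(W) → T_{eRe}(eWe)`. -/
abbrev η : T 𝒜.W₀ 𝒜.W₁ →ₐ[K] T (c.bimod 𝒜.W₀) (c.bimod 𝒜.W₁) := c.η 𝒜.W₀ 𝒜.W₁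

lemma η_d_left (r : 𝒜.R) (a : T 𝒜.W₀ 𝒜.W₁) :
    𝒜.η c (𝒜.d (T.ιR _ _ r * a)) = T.ιR _ _ (c.π r) * 𝒜.η c (𝒜.d a) := by
  simp [d_mul_sgn, 𝒜.d_R]

lemma η_d_right (r : 𝒜.R) (a : T 𝒜.W₀ 𝒜.W₁) :
    𝒜.η c (𝒜.d (a * T.ιR _ _ r)) = 𝒜.η c (𝒜.d a) * T.ιR _ _ (c.π r) := by
  simp [d_mul_sgn, 𝒜.d_R]

/-- The differential of `𝒜^e` on generators: `d_e(w) = η(d(w))` for `w ∈ e W e`. -/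
def redData : DiffData (c.bimod 𝒜.W₀) (c.bimod 𝒜.W₁) where
  δ₀ := (𝒜.η c).toLinearMap ∘ₗ 𝒜.d ∘ₗ T.ιW _ _ ∘ₗ LinearMap.inl K _ _ ∘ₗ c.incl 𝒜.W₀
  δ₁ := (𝒜.η c).toLinearMap ∘ₗ 𝒜.d ∘ₗ T.ιW _ _ ∘ₗ LinearMap.inr K _ _ ∘ₗ c.incl 𝒜.W₁
  left₀ x w := by
    have : ((c.val x • c.incl 𝒜.W₀ w, 0) : 𝒜.W₀ × 𝒜.W₁) = c.val x • (c.incl 𝒜.W₀ w, 0) := by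
      simp
    change 𝒜.η c (𝒜.d (T.ιW _ _ (c.val x • c.incl 𝒜.W₀ w, 0))) =
      T.ιR _ _ x * 𝒜.η c (𝒜.d (T.ιW _ _ (c.incl 𝒜.W₀ w, 0)))
    rw [this, T.ιW_left, η_d_left, c.π_val]
  right₀ x w := by
    have : ((op (c.val x) • c.incl 𝒜.W₀ w, 0) : 𝒜.W₀ × 𝒜.W₁) =
        op (c.val x) • (c.incl 𝒜.W₀ w, 0) := by simp
    change 𝒜.η c (𝒜.d (T.ιW _ _ (op (c.val x) • c.incl 𝒜.W₀ w, 0))) =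
      𝒜.η c (𝒜.d (T.ιW _ _ (c.incl 𝒜.W₀ w, 0))) * T.ιR _ _ x
    rw [this, T.ιW_right, η_d_right, c.π_val]
  left₁ x w := by
    have : ((0, c.val x • c.incl 𝒜.W₁ w) : 𝒜.W₀ × 𝒜.W₁) = c.val x • (0, c.incl 𝒜.W₁ w) := by
      simp
    change 𝒜.η c (𝒜.d (T.ιW _ _ (0, c.val x • c.incl 𝒜.W₁ w))) =
      T.ιR _ _ x * 𝒜.η c (𝒜.d (T.ιW _ _ (0, c.incl 𝒜.W₁ w)))
    rw [this, T.ιW_left, η_d_left, c.π_val]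
  right₁ x w := by
    have : ((0, op (c.val x) • c.incl 𝒜.W₁ w) : 𝒜.W₀ × 𝒜.W₁) =
        op (c.val x) • (0, c.incl 𝒜.W₁ w) := by simp
    change 𝒜.η c (𝒜.d (T.ιW _ _ (0, op (c.val x) • c.incl 𝒜.W₁ w))) =
      𝒜.η c (𝒜.d (T.ιW _ _ (0, c.incl 𝒜.W₁ w))) * T.ιR _ _ x
    rw [this, T.ιW_right, η_d_right, c.π_val]
  mem₀ w := c.η_gr (𝒜.d_gr 0 _ (T.Mono.ofW₀ _).mem)
  mem₁ w := c.η_gr (𝒜.d_gr 1 _ (T.Mono.ofW₁ _).mem)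

lemma redData_δ (w : c.bimod 𝒜.W₀ × c.bimod 𝒜.W₁) :
    (𝒜.redData c).δ w = 𝒜.η c (𝒜.d (T.ιW _ _ (c.incl 𝒜.W₀ w.1, c.incl 𝒜.W₁ w.2))) := by
  have : (c.incl 𝒜.W₀ w.1, c.incl 𝒜.W₁ w.2) = ((c.incl 𝒜.W₀ w.1, 0) : 𝒜.W₀ × 𝒜.W₁) +
      (0, c.incl 𝒜.W₁ w.2) := by simp
  rw [this, map_add, map_add, map_add]
  rfl

/-- `d_e η = η d`. -/
lemma redData_d_η (a : T 𝒜.W₀ 𝒜.W₁) : (𝒜.redData c).d (𝒜.η c a) = 𝒜.η c (𝒜.d a) := by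
  induction a using T.induction with
  | hR r => simp [𝒜.d_R]
  | hW w =>
    rw [c.η_ιW, DiffData.d_ιW, redData_δ, c.incl_πW, c.incl_πW]
    have : (c.e • op c.e • w.1, c.e • op c.e • w.2) = c.e • op c.e • w := rfl
    have h1 : c.π c.e = 1 := c.π_val 1
    simp only [this, T.ιW_left, T.ιW_right, η_d_left, η_d_right, h1, map_one, one_mul, mul_one]
  | hadd a b ha hb => simp [ha, hb]
  | hmul a b ha hb => simp [d_mul_sgn, DiffData.d_mul, ha, hb, c.η_sgn]

lemma redData_d_d (b : T (c.bimod 𝒜.W₀) (c.bimod 𝒜.W₁)) :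
    (𝒜.redData c).d ((𝒜.redData c).d b) = 0 := by
  obtain ⟨a, rfl⟩ := c.η_surjective b
  rw [redData_d_η, redData_d_η, 𝒜.d_d, map_zero]

/-- The ditalgebra `𝒜^e = (T_{eRe}(eWe), d_e)`. -/
abbrev reduce : Ditalgebra K :=
  (𝒜.redData c).ditalgebra
    (fun w => by rw [← DiffData.d_ιW₀, redData_d_d])
    (fun w => by rw [← DiffData.d_ιW₁, redData_d_d])

/-- The homomorphism `η` from the tensor algebra of `𝒜` to that of `𝒜^e`. -/
def ηT : T 𝒜.W₀ 𝒜.W₁ →ₐ[K] T (𝒜.reduce c).W₀ (𝒜.reduce c).W₁ := 𝒜.η c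

lemma d_ηT (a : T 𝒜.W₀ 𝒜.W₁) : (𝒜.reduce c).d (𝒜.ηT c a) = 𝒜.ηT c (𝒜.d a) :=
  𝒜.redData_d_η c a

lemma ηT_gr {n : ℕ} {a : T 𝒜.W₀ 𝒜.W₁} (h : a ∈ T.gr 𝒜.W₀ 𝒜.W₁ n) :
    𝒜.ηT c a ∈ T.gr (𝒜.reduce c).W₀ (𝒜.reduce c).W₁ n := c.η_gr h

/-- The map `T_R(W)_0 → T_{eRe}(eWe)_0`. -/
def ηZero : 𝒜.T₀ →ₐ[K] (𝒜.reduce c).T₀ where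
  toFun a := ⟨𝒜.ηT c a.1, 𝒜.ηT_gr c a.2⟩
  map_one' := Subtype.ext (map_one _)
  map_zero' := Subtype.ext (map_zero _)
  map_mul' _ _ := Subtype.ext (map_mul _ _ _)
  map_add' _ _ := Subtype.ext (map_add _ _ _)
  commutes' k := Subtype.ext ((𝒜.ηT c).commutes k)

/-- The map `T_R(W)_1 → T_{eRe}(eWe)_1`. -/
def ηOne : 𝒜.T₁ →ₗ[K] (𝒜.reduce c).T₁ where
  toFun v := ⟨𝒜.ηT c v.1, 𝒜.ηT_gr c v.2⟩
  map_add' _ _ := Subtype.ext (map_add _ _ _)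
  map_smul' _ _ := Subtype.ext (map_smul _ _ _)

end Ditalgebra

/-- Restriction of right modules along a homomorphism of algebras. -/
abbrev RightMod.restrict {K : Type u} [Field K] {R R' : Type u} [Ring R] [Algebra K R] [Ring R']
    [Algebra K R'] (f : R →ₐ[K] R') (M : RightMod K R') : RightMod K R where
  carrier := M
  ρ := M.ρ.comp f

namespace Ditalgebra

variable {K : Type u} [Field K] {𝒜 : Ditalgebra K} (c : CIdem 𝒜.R)

namespace Mod

/-- Restriction of a morphism of bimodules along `η`. -/
def resBMap {M N : RightMod K (𝒜.reduce c).T₀} (f : BMap M N) :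
    BMap (M.restrict (𝒜.ηZero c)) (N.restrict (𝒜.ηZero c)) where
  toFun := f.toFun ∘ₗ 𝒜.ηOne c
  left a v m := by
    have : 𝒜.ηOne c (T.lmul a v) = T.lmul (𝒜.ηZero c a) (𝒜.ηOne c v) :=
      Subtype.ext (map_mul _ _ _)
    change f.toFun (𝒜.ηOne c (T.lmul a v)) m = _
    rw [this]
    exact f.left _ _ _
  right v a m := by
    have : 𝒜.ηOne c (T.rmul v a) = T.rmul (𝒜.ηOne c v) (𝒜.ηZero c a) :=
      Subtype.ext (map_mul _ _ _)
    change f.toFun (𝒜.ηOne c (T.rmul v a)) m = _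
    rw [this]
    exact f.right _ _ _

lemma comp_resBMap {M N L : RightMod K (𝒜.reduce c).T₀} (f : BMap M N) (g : BMap N L)
    {y : T 𝒜.W₀ 𝒜.W₁} (hy : y ∈ T.gr 𝒜.W₀ 𝒜.W₁ 2) :
    BMap.comp (resBMap c f) (resBMap c g) y = BMap.comp f g (𝒜.ηT c y) := by
  ext m
  refine Submodule.mul_induction_on (T.gr_two_le hy) ?_ ?_
  · intro a ha b hb
    have h1 := BMap.comp_mul (resBMap c f) (resBMap c g) ⟨a, ha⟩ ⟨b, hb⟩ m
    have h2 := BMap.comp_mul f g (𝒜.ηOne c ⟨a, ha⟩) (𝒜.ηOne c ⟨b, hb⟩) m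
    have h3 : 𝒜.ηT c (a * b) = (𝒜.ηOne c ⟨a, ha⟩).1 * (𝒜.ηOne c ⟨b, hb⟩).1 :=
      map_mul (𝒜.ηT c) a b
    rw [h3]
    exact h1.trans h2.symm
  · intro a b ha hb
    rw [map_add, map_add, map_add]
    exact congrArg₂ (· + ·) ha hb

end Mod

/-- The restriction of a morphism of `Mod 𝒜^e` along `η`. -/
def resHom {M N : (𝒜.reduce c).Mod} (f : Mod.Hom M N) :
    Mod.Hom (𝒜 := 𝒜) ⟨M.mod.restrict (𝒜.ηZero c)⟩ ⟨N.mod.restrict (𝒜.ηZero c)⟩ where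
  f₀ := f.f₀
  f₁ := Mod.resBMap c f.f₁
  map_R r m := by
    have : 𝒜.ηZero c (T.rZero r) = T.rZero (c.π r) := Subtype.ext (c.η_ιR r)
    change f.f₀ (M.mod.act (𝒜.ηZero c (T.rZero r)) m) =
      N.mod.act (𝒜.ηZero c (T.rZero r)) (f.f₀ m)
    rw [this]
    exact f.map_R _ _
  map_act a m := by
    have : 𝒜.ηOne c (𝒜.d₀ a) = (𝒜.reduce c).d₀ (𝒜.ηZero c a) :=
      Subtype.ext (𝒜.d_ηT c a.1).symm
    change N.mod.act (𝒜.ηZero c a) (f.f₀ m) = f.f₀ (M.mod.act (𝒜.ηZero c a) m) +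
      f.f₁.toFun (𝒜.ηOne c (𝒜.d₀ a)) m
    rw [this]
    exact f.map_act _ _

lemma resHom_comp {M N L : (𝒜.reduce c).Mod} (f : Mod.Hom M N) (g : Mod.Hom N L) :
    resHom c (Mod.Hom.comp f g) = Mod.Hom.comp (resHom c f) (resHom c g) := by
  refine Mod.Hom.ext' (fun m => rfl) (fun v m => ?_)
  have h := Mod.Hom.comp_f₁ f g (𝒜.ηOne c v) m
  have h2 : (𝒜.reduce c).d (𝒜.ηOne c v).1 = 𝒜.ηT c (𝒜.d v.1) := 𝒜.d_ηT c v.1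
  rw [h2, ← Mod.comp_resBMap c _ _ (𝒜.d_gr 1 _ v.2)] at h
  rw [Mod.Hom.comp_f₁]
  exact h

/-- The functor `F_η : Mod 𝒜^e ⥤ Mod 𝒜` of restriction along `η`. -/
def F : (𝒜.reduce c).Mod ⥤ 𝒜.Mod where
  obj M := ⟨M.mod.restrict (𝒜.ηZero c)⟩
  map f := resHom c f
  map_id M := rfl
  map_comp f g := resHom_comp c f g

end Ditalgebra

/-! ## The dual of the radical -/

section Dual

variable {K : Type u} [Field K] {Λ : Type u} [Ring Λ] [Algebra K Λ]
variable (S : Subalgebra K Λ) (J : Ideal Λ)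

/-- The left dual `*J = Hom_S(J, S)` of the left `S`-module `J`. -/
def Dual : Type u := J →ₗ[S] S

namespace Dual

instance : AddCommGroup (Dual S J) := inferInstanceAs (AddCommGroup (J →ₗ[S] S))
instance : Module K (Dual S J) := inferInstanceAs (Module K (J →ₗ[S] S))
instance : FunLike (Dual S J) J S := inferInstanceAs (FunLike (J →ₗ[S] S) J S)

variable {S J}

@[ext] lemma ext {γ γ' : Dual S J} (h : ∀ x, γ x = γ' x) : γ = γ' := LinearMap.ext h

lemma apply_add (γ : Dual S J) (x y : J) : γ (x + y) = γ x + γ y := LinearMap.map_add _ x y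
lemma apply_smul (γ : Dual S J) (s : S) (x : J) : γ (s • x) = s * γ x := LinearMap.map_smul _ s x
lemma apply_smul_K (γ : Dual S J) (k : K) (x : J) : γ (k • x) = k • γ x := by
  have := γ.apply_smul (algebraMap K S k) x
  rwa [algebraMap_smul, ← Algebra.smul_def] at this
lemma apply_sum (γ : Dual S J) {n : ℕ} (x : Fin n → J) : γ (∑ i, x i) = ∑ i, γ (x i) :=
  _root_.map_sum (show J →ₗ[S] S from γ) _ _
@[simp] lemma add_apply (γ γ' : Dual S J) (x : J) : (γ + γ') x = γ x + γ' x := rfl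
@[simp] lemma zero_apply (x : J) : (0 : Dual S J) x = 0 := rfl
@[simp] lemma smul_K_apply (k : K) (γ : Dual S J) (x : J) : (k • γ) x = k • γ x := rfl
lemma sum_apply {n : ℕ} (γ : Fin n → Dual S J) (x : J) : (∑ i, γ i) x = ∑ i, γ i x :=
  LinearMap.sum_apply (R := S) (R₂ := S) (M := J) (M₂ := S) Finset.univ γ x

/-- A left `S`-linear map `J → S`, as an element of the dual. -/
def mk (f : J → S) (hadd : ∀ x y, f (x + y) = f x + f y) (hsmul : ∀ (s : S) x, f (s • x) = s * f x) :
    Dual S J := ({ toFun := f, map_add' := hadd, map_smul' := hsmul } : J →ₗ[S] S)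

@[simp] lemma mk_apply (f : J → S) (hadd hsmul) (x : J) : mk f hadd hsmul x = f x := rfl

/-- The right action `(γ s)(x) = γ(x) s`. -/
instance : Module Sᵐᵒᵖ (Dual S J) where
  smul s γ := mk (fun x => γ x * s.unop) (fun x y => by rw [apply_add, add_mul])
    (fun t x => by rw [apply_smul, mul_assoc])
  one_smul γ := ext fun x => mul_one _
  mul_smul s t γ := ext fun x => (mul_assoc (γ x) t.unop s.unop).symm
  smul_zero s := ext fun x => zero_mul _
  smul_add s γ γ' := ext fun x => add_mul _ _ _
  add_smul s t γ := ext fun x => mul_add _ _ _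
  zero_smul γ := ext fun x => mul_zero _

@[simp] lemma op_smul_apply (s : S) (γ : Dual S J) (x : J) : (op s • γ) x = γ x * s := rfl

variable [J.IsTwoSided]

/-- The product `x a` of `x ∈ J` with `a ∈ Λ`. -/
def jmul (x : J) (a : Λ) : J := ⟨x.1 * a, J.mul_mem_right a x.2⟩

lemma jmul_add_left (x y : J) (a : Λ) : jmul (x + y) a = jmul x a + jmul y a :=
  Subtype.ext (add_mul x.1 y.1 a)
lemma jmul_add_right (x : J) (a b : Λ) : jmul x (a + b) = jmul x a + jmul x b :=
  Subtype.ext (mul_add x.1 a b)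
lemma jmul_zero (x : J) : jmul x 0 = 0 := Subtype.ext (mul_zero x.1)
lemma jmul_smul (s : S) (x : J) (a : Λ) : jmul (s • x) a = s • jmul x a :=
  Subtype.ext (mul_assoc s.1 x.1 a)
lemma jmul_mul (x : J) (a b : Λ) : jmul x (a * b) = jmul (jmul x a) b :=
  Subtype.ext (mul_assoc x.1 a b).symm
lemma jmul_one (x : J) : jmul x 1 = x := Subtype.ext (mul_one x.1)

/-- The element `x ↦ γ (x a)` of `*J`. -/
def shift (γ : Dual S J) (a : Λ) : Dual S J :=
  mk (fun x => γ (jmul x a)) (fun x y => by rw [jmul_add_left, apply_add])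
    (fun s x => by rw [jmul_smul, apply_smul])

@[simp] lemma shift_apply (γ : Dual S J) (a : Λ) (x : J) : γ.shift a x = γ (jmul x a) := rfl

/-- The left action `(s γ)(x) = γ (x s)`. -/
instance : Module S (Dual S J) where
  smul s γ := γ.shift s
  one_smul γ := ext fun x => congrArg γ (jmul_one x)
  mul_smul s t γ := ext fun x => congrArg γ (jmul_mul x s.1 t.1)
  smul_zero _ := rfl
  smul_add _ _ _ := rfl
  add_smul s t γ := ext fun x =>
    (congrArg γ (jmul_add_right x s.1 t.1)).trans (apply_add _ _ _)
  zero_smul γ := ext fun x => (congrArg γ (jmul_zero x)).trans (LinearMap.map_zero _)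

@[simp] lemma smul_apply (s : S) (γ : Dual S J) (x : J) : (s • γ) x = γ (jmul x s) := rfl

variable (S J) in
/-- The `S`-bimodule `*J`. -/
def bimod : Bimod K S where
  carrier := Dual S J
  comm := ⟨fun s t γ => rfl⟩
  tower := IsScalarTower.of_algebraMap_smul fun k γ => ext fun x => by
    rw [smul_apply, smul_K_apply, ← apply_smul_K]
    refine congrArg γ (Subtype.ext ?_)
    change x.1 * algebraMap K Λ k = k • x.1
    rw [← Algebra.commutes, ← Algebra.smul_def]
  towerOp := IsScalarTower.of_algebraMap_smul fun k γ => ext fun x => by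
    change γ x * algebraMap K S k = k • γ x
    rw [← Algebra.commutes, ← Algebra.smul_def]

end Dual

open Dit.Dual

/-- A dual basis `(p_i, γ_i)` of the left `S`-module `J`: `x = ∑ γ_i(x) p_i` for all `x ∈ J`. -/
structure DualBasis where
  n : ℕ
  p : Fin n → J
  γ : Fin n → Dual S J
  sum : ∀ x : J, ∑ i, γ i x • p i = x

namespace DualBasis

variable {S J} [J.IsTwoSided] (B : DualBasis S J)

lemma sum_op_smul (γ : Dual S J) (a : Λ) :
    ∑ j, op (γ (jmul (B.p j) a)) • B.γ j = γ.shift a := by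
  refine Dual.ext fun x => ?_
  rw [Dual.sum_apply]
  conv_rhs => rw [← B.sum x]
  rw [Dual.apply_sum]
  exact Finset.sum_congr rfl fun j _ => ((γ.shift a).apply_smul _ _).symm

/-- The maps `a, b : *J → Q` of bimodule type for which `∑ a(γ_i) b(γ_j γ(p_j p_i))` makes
sense. -/
structure Pair (S : Subalgebra K Λ) (J : Ideal Λ) [J.IsTwoSided] {Q : Type u} [Ring Q]
    [Algebra K Q] (a b : Dual S J →ₗ[K] Q) : Prop where
  exists_map : ∃ f : S → Q, (∀ s γ, a (op s • γ) = a γ * f s) ∧ ∀ (s : S) γ, b (s • γ) = f s * b γ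

section

variable {Q : Type u} [Ring Q] [Algebra K Q] (a b c : Dual S J →ₗ[K] Q)

/-- `∑ a(γ_i) b(γ_j γ(p_j p_i))`. -/
def mu : Dual S J →ₗ[K] Q where
  toFun γ := ∑ i, ∑ j, a (B.γ i) * b (op (γ (jmul (B.p j) (B.p i))) • B.γ j)
  map_add' γ γ' := by
    simp only [← Finset.sum_add_distrib]
    refine Finset.sum_congr rfl fun i _ => Finset.sum_congr rfl fun j _ => ?_
    rw [Dual.add_apply, ← mul_add, ← map_add]
    exact congrArg (fun z => a (B.γ i) * b z) (add_smul (op (γ _)) (op (γ' _)) (B.γ j))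
  map_smul' k γ := by
    simp only [RingHom.id_apply, Finset.smul_sum]
    refine Finset.sum_congr rfl fun i _ => Finset.sum_congr rfl fun j _ => ?_
    rw [Dual.smul_K_apply, ← mul_smul_comm, ← LinearMap.map_smul]
    exact congrArg (fun z => a (B.γ i) * b z)
      (Dual.ext fun x => mul_smul_comm k (B.γ j x) (γ _))

lemma mu_apply (γ : Dual S J) :
    B.mu a b γ = ∑ i, ∑ j, a (B.γ i) * b (op (γ (jmul (B.p j) (B.p i))) • B.γ j) := rfl

lemma mu_eq (γ : Dual S J) : B.mu a b γ = ∑ i, a (B.γ i) * b (γ.shift (B.p i)) := by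
  rw [mu_apply]
  refine Finset.sum_congr rfl fun i _ => ?_
  rw [← B.sum_op_smul γ, _root_.map_sum b, Finset.mul_sum]

lemma mu_mem (N : Submodule K Q) (h : ∀ γ γ', a γ * b γ' ∈ N) (γ : Dual S J) :
    B.mu a b γ ∈ N := by
  rw [mu_apply]
  exact sum_mem fun _ _ => sum_mem fun _ _ => h _ _

variable {a b c}

/-- `∑ a(γ_i) b(h(p_i y))` can be rewritten by moving `y` to the first factor. -/
lemma sum_shift (h : Pair S J a b) (γ : Dual S J) (y : Λ) :
    ∑ i, a ((B.γ i).shift y) * b (γ.shift (B.p i)) =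
      ∑ i, a (B.γ i) * b (γ.shift (jmul (B.p i) y).1) := by
  obtain ⟨f, hf, hb⟩ := h.exists_map
  have h1 : ∀ i, γ.shift (jmul (B.p i) y).1 =
      ∑ l, B.γ l (jmul (B.p i) y) • γ.shift (B.p l) := by
    intro i
    refine Dual.ext fun x => ?_
    rw [Dual.sum_apply, shift_apply]
    have h2 : jmul x (jmul (B.p i) y).1 =
        ∑ l, jmul (jmul x (B.γ l (jmul (B.p i) y)).1) (B.p l) := by
      refine Subtype.ext ?_
      rw [AddSubmonoidClass.coe_finsetSum]
      change x.1 * (jmul (B.p i) y).1 = _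
      conv_lhs => rw [← B.sum (jmul (B.p i) y)]
      rw [AddSubmonoidClass.coe_finsetSum, Finset.mul_sum]
      exact Finset.sum_congr rfl fun l _ => (mul_assoc _ _ _).symm
    rw [h2, Dual.apply_sum]
    rfl
  have h3 : ∀ i, a (B.γ i) * b (γ.shift (jmul (B.p i) y).1) =
      ∑ l, a (op (B.γ l (jmul (B.p i) y)) • B.γ i) * b (γ.shift (B.p l)) := by
    intro i
    rw [h1, map_sum, Finset.mul_sum]
    exact Finset.sum_congr rfl fun l _ => by rw [hf, hb, mul_assoc]
  simp only [h3]
  rw [Finset.sum_comm]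
  refine Finset.sum_congr rfl fun l _ => ?_
  rw [← Finset.sum_mul, ← map_sum, B.sum_op_smul]

lemma mu_smul (h : Pair S J a b) (s : S) (γ : Dual S J) :
    B.mu a b (s • γ) = ∑ i, a (s • B.γ i) * b (γ.shift (B.p i)) := by
  rw [mu_eq]
  refine Eq.trans (Finset.sum_congr rfl fun i _ => ?_) (B.sum_shift h γ s).symm
  refine congrArg (fun z => a (B.γ i) * b z) (Dual.ext fun x => ?_)
  exact congrArg γ (Subtype.ext (mul_assoc x.1 (B.p i).1 s.1))

lemma mu_op_smul (s : S) (γ : Dual S J) :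
    B.mu a b (op s • γ) = ∑ i, a (B.γ i) * b (op s • γ.shift (B.p i)) := mu_eq _ _ _ _

lemma coassoc (h : Pair S J b c) (γ : Dual S J) :
    ∑ i, B.mu a b (B.γ i) * c (γ.shift (B.p i)) =
      ∑ i, a (B.γ i) * B.mu b c (γ.shift (B.p i)) := by
  simp only [mu_eq, Finset.sum_mul, Finset.mul_sum]
  rw [Finset.sum_comm]
  refine Finset.sum_congr rfl fun i _ => ?_
  simp only [mul_assoc, ← Finset.mul_sum]
  rw [B.sum_shift h]
  refine congrArg (a (B.γ i) * ·) (Finset.sum_congr rfl fun k _ => ?_)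
  refine congrArg (fun z => b (B.γ k) * c z) (Dual.ext fun x => ?_)
  exact congrArg γ (Subtype.ext (mul_assoc x.1 (B.p k).1 (B.p i).1).symm)

end

end DualBasis

end Dual

/-- The zero bimodule. -/
def Bimod.zero (K : Type u) [Field K] (R : Type u) [Ring R] [Algebra K R] : Bimod K R where
  carrier := PUnit

/-! ## The ditalgebra of the radical and the ditalgebra of Drozd -/

section Drozd

variable {K : Type u} [Field K] {Λ : Type u} [Ring Λ] [Algebra K Λ]
variable {S : Subalgebra K Λ} {J : Ideal Λ} [J.IsTwoSided] (B : DualBasis S J)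

namespace Proj

variable (S J) in
/-- The inclusion of `*J` in `T_S(*J)`. -/
def w : Dual S J →ₗ[K] T (Bimod.zero K S) (Dual.bimod S J) :=
  T.ιW (Bimod.zero K S) (Dual.bimod S J) ∘ₗ
    LinearMap.inr K (Bimod.zero K S) (Dual.bimod S J)

lemma w_smul (s : S) (γ : Dual S J) : (w S J) (s • γ) = T.ιR _ _ s * (w S J) γ :=
  T.ιW_left (Bimod.zero K S) (Dual.bimod S J) s (PUnit.unit, γ)

lemma w_op_smul (s : S) (γ : Dual S J) : (w S J) (op s • γ) = (w S J) γ * T.ιR _ _ s :=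
  T.ιW_right (Bimod.zero K S) (Dual.bimod S J) s (PUnit.unit, γ)

lemma w_mem (γ : Dual S J) : (w S J) γ ∈ T.gr (Bimod.zero K S) (Dual.bimod S J) 1 :=
  (T.Mono.ofW₁ (W₀ := Bimod.zero K S) (W₁ := Dual.bimod S J) γ).mem

lemma pair : DualBasis.Pair S J (w S J) (w S J) := ⟨T.ιR _ _, w_op_smul, w_smul⟩

/-- The comultiplication `γ ↦ ∑ γ_i ⊗ γ_j γ(p_j p_i)`. -/
def δ₁ : Dual S J →ₗ[K] T (Bimod.zero K S) (Dual.bimod S J) := B.mu (w S J) (w S J)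

lemma δ₁_left (s : S) (γ : Dual S J) : δ₁ B (s • γ) = T.ιR _ _ s * δ₁ B γ := by
  rw [δ₁, B.mu_smul pair, B.mu_eq, Finset.mul_sum]
  exact Finset.sum_congr rfl fun i _ => by rw [w_smul, mul_assoc]

lemma δ₁_right (s : S) (γ : Dual S J) : δ₁ B (op s • γ) = δ₁ B γ * T.ιR _ _ s := by
  rw [δ₁, B.mu_op_smul, B.mu_eq, Finset.sum_mul]
  exact Finset.sum_congr rfl fun i _ => by rw [w_op_smul, mul_assoc]

lemma δ₁_mem (γ : Dual S J) : δ₁ B γ ∈ T.gr (Bimod.zero K S) (Dual.bimod S J) 2 :=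
  B.mu_mem _ _ _ (fun _ _ => T.mul_mem_gr (w_mem _) (w_mem _)) γ

/-- The comultiplication as a differential on generators. -/
def data : DiffData (Bimod.zero K S) (Dual.bimod S J) where
  δ₀ := 0
  δ₁ := δ₁ B
  left₀ _ _ := (mul_zero _).symm
  right₀ _ _ := (zero_mul _).symm
  left₁ := δ₁_left B
  right₁ := δ₁_right B
  mem₀ _ := zero_mem _
  mem₁ := δ₁_mem B

lemma d_w (γ : Dual S J) : (data B).d ((w S J) γ) = B.mu (w S J) (w S J) γ := (data B).d_ιW₁ γ

lemma sgn_w (γ : Dual S J) : T.sgn _ _ ((w S J) γ) = -(w S J) γ := by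
  rw [T.sgn_gr (w_mem γ), pow_one, neg_one_mul]

lemma d_mu (γ : Dual S J) : (data B).d (B.mu (w S J) (w S J) γ) = 0 := by
  have h : ∀ i, (data B).d ((w S J) (B.γ i) * (w S J) (γ.shift (B.p i))) =
      B.mu (w S J) (w S J) (B.γ i) * (w S J) (γ.shift (B.p i)) -
        (w S J) (B.γ i) * B.mu (w S J) (w S J) (γ.shift (B.p i)) := by
    intro i
    rw [DiffData.d_mul, d_w, d_w, sgn_w]
    noncomm_ring
  rw [B.mu_eq, map_sum]
  simp only [h, Finset.sum_sub_distrib]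
  rw [B.coassoc pair, sub_self]

end Proj

/-- The ditalgebra `(T_S(*J), d)` with `W₀ = 0`, `W₁ = *J` and
`d(γ) = ∑ γ_i ⊗ γ_j γ(p_j p_i)`. -/
abbrev projDit : Ditalgebra K :=
  (Proj.data B).ditalgebra (fun _ => map_zero _) (Proj.d_mu B)

namespace Drozd

variable (S J) in
/-- The bimodule `w₁₂ *J` over `S × S`: `(s₁, s₂) γ = s₁ γ` and `γ (s₁, s₂) = γ s₂`. -/
def W₀ : Bimod K (S × S) :=
  letI : Module (S × S) (Dual S J) := Module.compHom _ (RingHom.fst S S)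
  letI : Module (S × S)ᵐᵒᵖ (Dual S J) := Module.compHom _ (RingHom.snd S S).op
  { carrier := Dual S J
    comm := ⟨fun r t γ => smul_comm (M := S) (N := Sᵐᵒᵖ) (α := (Dual.bimod S J).carrier) r.1
      (op t.unop.2) γ⟩
    tower := ⟨fun k r γ => smul_assoc (M := K) (N := S) (α := (Dual.bimod S J).carrier) k r.1 γ⟩
    towerOp := ⟨fun k r γ => smul_assoc (M := K) (N := Sᵐᵒᵖ) (α := (Dual.bimod S J).carrier) k
      (op r.unop.2) γ⟩ }

/-- The action of `S × S` on `*J × *J` by components. -/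
@[reducible] def leftMod : Module (S × S) (Dual S J × Dual S J) where
  smul r γ := (r.1 • γ.1, r.2 • γ.2)
  one_smul γ := Prod.ext (one_smul S _) (one_smul S _)
  mul_smul r t γ := Prod.ext (mul_smul r.1 t.1 γ.1) (mul_smul r.2 t.2 γ.2)
  smul_zero r := Prod.ext (smul_zero r.1) (smul_zero r.2)
  smul_add r γ γ' := Prod.ext (smul_add r.1 γ.1 γ'.1) (smul_add r.2 γ.2 γ'.2)
  add_smul r t γ := Prod.ext (add_smul r.1 t.1 γ.1) (add_smul r.2 t.2 γ.2)
  zero_smul γ := Prod.ext (zero_smul S γ.1) (zero_smul S γ.2)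

/-- The right action of `S × S` on `*J × *J` by components. -/
@[reducible] def rightMod : Module (S × S)ᵐᵒᵖ (Dual S J × Dual S J) where
  smul r γ := (op r.unop.1 • γ.1, op r.unop.2 • γ.2)
  one_smul γ := Prod.ext (one_smul Sᵐᵒᵖ _) (one_smul Sᵐᵒᵖ _)
  mul_smul r t γ := Prod.ext (mul_smul (op r.unop.1) (op t.unop.1) γ.1)
    (mul_smul (op r.unop.2) (op t.unop.2) γ.2)
  smul_zero r := Prod.ext (smul_zero (op r.unop.1)) (smul_zero (op r.unop.2))
  smul_add r γ γ' := Prod.ext (smul_add (op r.unop.1) γ.1 γ'.1)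
    (smul_add (op r.unop.2) γ.2 γ'.2)
  add_smul r t γ := Prod.ext (add_smul (op r.unop.1) (op t.unop.1) γ.1)
    (add_smul (op r.unop.2) (op t.unop.2) γ.2)
  zero_smul γ := Prod.ext (zero_smul Sᵐᵒᵖ γ.1) (zero_smul Sᵐᵒᵖ γ.2)

variable (S J) in
/-- The bimodule `w₁ *J ⊕ w₂ *J` over `S × S`, with both actions by components. -/
def W₁ : Bimod K (S × S) :=
  letI : Module (S × S) (Dual S J × Dual S J) := leftMod
  letI : Module (S × S)ᵐᵒᵖ (Dual S J × Dual S J) := rightMod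
  { carrier := Dual S J × Dual S J
    comm := ⟨fun r t γ => rfl⟩
    tower := ⟨fun k r γ => Prod.ext
      (smul_assoc (M := K) (N := S) (α := (Dual.bimod S J).carrier) k r.1 γ.1)
      (smul_assoc (M := K) (N := S) (α := (Dual.bimod S J).carrier) k r.2 γ.2)⟩
    towerOp := ⟨fun k r γ => Prod.ext
      (smul_assoc (M := K) (N := Sᵐᵒᵖ) (α := (Dual.bimod S J).carrier) k (op r.unop.1) γ.1)
      (smul_assoc (M := K) (N := Sᵐᵒᵖ) (α := (Dual.bimod S J).carrier) k (op r.unop.2) γ.2)⟩ }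

variable (S J) in
/-- The tensor algebra of `W₀ ⊕ W₁`. -/
abbrev TD : Type u := T (W₀ S J) (W₁ S J)

variable (S J) in
/-- The element `w₁₂ γ` of degree `0`. -/
def w12 : Dual S J →ₗ[K] TD S J :=
  T.ιW (W₀ S J) (W₁ S J) ∘ₗ LinearMap.inl K (W₀ S J) (W₁ S J)

variable (S J) in
/-- The element `w₁ γ` of degree `1`. -/
def w1 : Dual S J →ₗ[K] TD S J :=
  T.ιW (W₀ S J) (W₁ S J) ∘ₗ LinearMap.inr K (W₀ S J) (W₁ S J) ∘ₗ
    LinearMap.inl K (Dual S J) (Dual S J)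

variable (S J) in
/-- The element `w₂ γ` of degree `1`. -/
def w2 : Dual S J →ₗ[K] TD S J :=
  T.ιW (W₀ S J) (W₁ S J) ∘ₗ LinearMap.inr K (W₀ S J) (W₁ S J) ∘ₗ
    LinearMap.inr K (Dual S J) (Dual S J)

lemma w12_left (r : S × S) (γ : Dual S J) : T.ιR _ _ r * (w12 S J) γ = (w12 S J) (r.1 • γ) := by
  refine (T.ιW_left (W₀ S J) (W₁ S J) r (γ, 0)).symm.trans (congrArg _ ?_)
  exact Prod.ext rfl (smul_zero r)

lemma w12_right (r : S × S) (γ : Dual S J) : (w12 S J) γ * T.ιR _ _ r = (w12 S J) (op r.2 • γ) := by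
  refine (T.ιW_right (W₀ S J) (W₁ S J) r (γ, 0)).symm.trans (congrArg _ ?_)
  exact Prod.ext rfl (smul_zero (op r))

lemma w1_left (r : S × S) (γ : Dual S J) : T.ιR _ _ r * (w1 S J) γ = (w1 S J) (r.1 • γ) := by
  refine (T.ιW_left (W₀ S J) (W₁ S J) r (0, (γ, 0))).symm.trans (congrArg _ ?_)
  exact Prod.ext (smul_zero r) (Prod.ext rfl (smul_zero r.2))

lemma w1_right (r : S × S) (γ : Dual S J) : (w1 S J) γ * T.ιR _ _ r = (w1 S J) (op r.1 • γ) := by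
  refine (T.ιW_right (W₀ S J) (W₁ S J) r (0, (γ, 0))).symm.trans (congrArg _ ?_)
  exact Prod.ext (smul_zero (op r)) (Prod.ext rfl (smul_zero (op r.2)))

lemma w2_left (r : S × S) (γ : Dual S J) : T.ιR _ _ r * (w2 S J) γ = (w2 S J) (r.2 • γ) := by
  refine (T.ιW_left (W₀ S J) (W₁ S J) r (0, (0, γ))).symm.trans (congrArg _ ?_)
  exact Prod.ext (smul_zero r) (Prod.ext (smul_zero r.1) rfl)

lemma w2_right (r : S × S) (γ : Dual S J) : (w2 S J) γ * T.ιR _ _ r = (w2 S J) (op r.2 • γ) := by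
  refine (T.ιW_right (W₀ S J) (W₁ S J) r (0, (0, γ))).symm.trans (congrArg _ ?_)
  exact Prod.ext (smul_zero (op r)) (Prod.ext (smul_zero (op r.1)) rfl)

lemma w12_mem (γ : Dual S J) : (w12 S J) γ ∈ T.gr (W₀ S J) (W₁ S J) 0 :=
  (T.Mono.ofW₀ (W₀ := W₀ S J) (W₁ := W₁ S J) γ).mem

lemma w1_mem (γ : Dual S J) : (w1 S J) γ ∈ T.gr (W₀ S J) (W₁ S J) 1 :=
  (T.Mono.ofW₁ (W₀ := W₀ S J) (W₁ := W₁ S J) (γ, 0)).mem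

lemma w2_mem (γ : Dual S J) : (w2 S J) γ ∈ T.gr (W₀ S J) (W₁ S J) 1 :=
  (T.Mono.ofW₁ (W₀ := W₀ S J) (W₁ := W₁ S J) (0, γ)).mem

lemma pair11 : DualBasis.Pair S J (w1 S J) (w1 S J) :=
  ⟨fun s => T.ιR _ _ (s, 0), fun s γ => (w1_right (s, 0) γ).symm,
    fun s γ => (w1_left (s, 0) γ).symm⟩

lemma pair22 : DualBasis.Pair S J (w2 S J) (w2 S J) :=
  ⟨fun s => T.ιR _ _ (0, s), fun s γ => (w2_right (0, s) γ).symm,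
    fun s γ => (w2_left (0, s) γ).symm⟩

lemma pair122 : DualBasis.Pair S J (w12 S J) (w2 S J) :=
  ⟨fun s => T.ιR _ _ (0, s), fun s γ => (w12_right (0, s) γ).symm,
    fun s γ => (w2_left (0, s) γ).symm⟩

lemma pair112 : DualBasis.Pair S J (w1 S J) (w12 S J) :=
  ⟨fun s => T.ιR _ _ (s, 0), fun s γ => (w1_right (s, 0) γ).symm,
    fun s γ => (w12_left (s, 0) γ).symm⟩

lemma mu_left {a b : Dual S J →ₗ[K] TD S J} (h : DualBasis.Pair S J a b) {r : S × S} {s : S}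
    (ha : ∀ γ, T.ιR _ _ r * a γ = a (s • γ)) (γ : Dual S J) :
    B.mu a b (s • γ) = T.ιR _ _ r * B.mu a b γ := by
  rw [B.mu_smul h, B.mu_eq]
  simp only [← ha, Finset.mul_sum, mul_assoc]

lemma mu_right {a b : Dual S J →ₗ[K] TD S J} {r : S × S} {s : S}
    (hb : ∀ γ, b γ * T.ιR _ _ r = b (op s • γ)) (γ : Dual S J) :
    B.mu a b (op s • γ) = B.mu a b γ * T.ιR _ _ r := by
  rw [B.mu_op_smul, B.mu_eq]
  simp only [← hb, Finset.sum_mul, mul_assoc]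

/-- The differential of Drozd's ditalgebra on `W₀`. -/
def δ₀ : Dual S J →ₗ[K] TD S J := B.mu (w12 S J) (w2 S J) - B.mu (w1 S J) (w12 S J)

/-- The differential of Drozd's ditalgebra on `W₁`. -/
def δ₁ : Dual S J × Dual S J →ₗ[K] TD S J :=
  -(B.mu (w1 S J) (w1 S J) ∘ₗ LinearMap.fst K (Dual S J) (Dual S J)) -
    B.mu (w2 S J) (w2 S J) ∘ₗ LinearMap.snd K (Dual S J) (Dual S J)

lemma δ₀_apply (γ : Dual S J) :
    δ₀ B γ = B.mu (w12 S J) (w2 S J) γ - B.mu (w1 S J) (w12 S J) γ := rfl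

lemma δ₁_apply (γ : Dual S J × Dual S J) :
    δ₁ B γ = -B.mu (w1 S J) (w1 S J) γ.1 - B.mu (w2 S J) (w2 S J) γ.2 := rfl

lemma δ₀_left (r : S × S) (γ : Dual S J) : δ₀ B (r.1 • γ) = T.ιR _ _ r * δ₀ B γ := by
  rw [δ₀_apply, δ₀_apply, mu_left B pair122 (w12_left r), mu_left B pair112 (w1_left r), mul_sub]

lemma δ₀_right (r : S × S) (γ : Dual S J) : δ₀ B (op r.2 • γ) = δ₀ B γ * T.ιR _ _ r := by
  rw [δ₀_apply, δ₀_apply, mu_right B (w2_right r), mu_right B (w12_right r), sub_mul]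

lemma δ₁_left (r : S × S) (γ : Dual S J × Dual S J) :
    δ₁ B (r.1 • γ.1, r.2 • γ.2) = T.ιR _ _ r * δ₁ B γ := by
  rw [δ₁_apply, δ₁_apply, mu_left B pair11 (w1_left r), mu_left B pair22 (w2_left r), mul_sub,
    mul_neg]

lemma δ₁_right (r : S × S) (γ : Dual S J × Dual S J) :
    δ₁ B (op r.1 • γ.1, op r.2 • γ.2) = δ₁ B γ * T.ιR _ _ r := by
  rw [δ₁_apply, δ₁_apply, mu_right B (w1_right r), mu_right B (w2_right r), sub_mul, neg_mul]

lemma δ₀_mem (γ : Dual S J) : δ₀ B γ ∈ T.gr (W₀ S J) (W₁ S J) 1 :=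
  sub_mem (B.mu_mem _ _ _ (fun _ _ => T.mul_mem_gr' (w12_mem _) (w2_mem _) rfl) γ)
    (B.mu_mem _ _ _ (fun _ _ => T.mul_mem_gr' (w1_mem _) (w12_mem _) rfl) γ)

lemma δ₁_mem (γ : Dual S J × Dual S J) : δ₁ B γ ∈ T.gr (W₀ S J) (W₁ S J) 2 :=
  sub_mem (neg_mem (B.mu_mem _ _ _ (fun _ _ => T.mul_mem_gr' (w1_mem _) (w1_mem _) rfl) γ.1))
    (B.mu_mem _ _ _ (fun _ _ => T.mul_mem_gr' (w2_mem _) (w2_mem _) rfl) γ.2)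

/-- The differential of Drozd's ditalgebra on generators. -/
def data : DiffData (W₀ S J) (W₁ S J) where
  δ₀ := δ₀ B
  δ₁ := δ₁ B
  left₀ := δ₀_left B
  right₀ := δ₀_right B
  left₁ := δ₁_left B
  right₁ := δ₁_right B
  mem₀ := δ₀_mem B
  mem₁ := δ₁_mem B

lemma d_w12 (γ : Dual S J) : (data B).d ((w12 S J) γ) = B.mu (w12 S J) (w2 S J) γ - B.mu (w1 S J) (w12 S J) γ :=
  (data B).d_ιW₀ γ

lemma d_w1 (γ : Dual S J) : (data B).d ((w1 S J) γ) = -B.mu (w1 S J) (w1 S J) γ := by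
  refine ((data B).d_ιW₁ (γ, 0)).trans ?_
  change -B.mu (w1 S J) (w1 S J) γ - B.mu (w2 S J) (w2 S J) 0 = _
  rw [map_zero, sub_zero]

lemma d_w2 (γ : Dual S J) : (data B).d ((w2 S J) γ) = -B.mu (w2 S J) (w2 S J) γ := by
  refine ((data B).d_ιW₁ (0, γ)).trans ?_
  change -B.mu (w1 S J) (w1 S J) 0 - B.mu (w2 S J) (w2 S J) γ = _
  rw [map_zero, neg_zero, zero_sub]

lemma d_mu_sum (a b : Dual S J →ₗ[K] TD S J) (γ : Dual S J) :
    (data B).d (B.mu a b γ) = ∑ i, T.sgn _ _ (a (B.γ i)) * (data B).d (b (γ.shift (B.p i))) +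
      ∑ i, (data B).d (a (B.γ i)) * b (γ.shift (B.p i)) := by
  rw [B.mu_eq, map_sum, ← Finset.sum_add_distrib]
  exact Finset.sum_congr rfl fun i _ => (data B).d_mul _ _

lemma sgn_w12 (γ : Dual S J) : T.sgn _ _ ((w12 S J) γ) = (w12 S J) γ := by
  rw [T.sgn_gr (w12_mem γ), pow_zero, one_mul]

lemma sgn_w1 (γ : Dual S J) : T.sgn _ _ ((w1 S J) γ) = -(w1 S J) γ := by
  rw [T.sgn_gr (w1_mem γ), pow_one, neg_one_mul]

lemma sgn_w2 (γ : Dual S J) : T.sgn _ _ ((w2 S J) γ) = -(w2 S J) γ := by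
  rw [T.sgn_gr (w2_mem γ), pow_one, neg_one_mul]

lemma d_mu11 (γ : Dual S J) : (data B).d (B.mu (w1 S J) (w1 S J) γ) = 0 := by
  rw [d_mu_sum]
  simp only [sgn_w1, d_w1, neg_mul, mul_neg, neg_neg, Finset.sum_neg_distrib]
  rw [B.coassoc pair11, add_neg_cancel]

lemma d_mu22 (γ : Dual S J) : (data B).d (B.mu (w2 S J) (w2 S J) γ) = 0 := by
  rw [d_mu_sum]
  simp only [sgn_w2, d_w2, neg_mul, mul_neg, neg_neg, Finset.sum_neg_distrib]
  rw [B.coassoc pair22, add_neg_cancel]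

lemma d_mu12 (γ : Dual S J) : (data B).d (B.mu (w12 S J) (w2 S J) γ - B.mu (w1 S J) (w12 S J) γ) = 0 := by
  rw [map_sub, d_mu_sum, d_mu_sum]
  simp only [sgn_w1, sgn_w12, d_w1, d_w2, d_w12, neg_mul, mul_neg, mul_sub, sub_mul,
    Finset.sum_neg_distrib, Finset.sum_sub_distrib]
  rw [B.coassoc pair22, B.coassoc pair122, B.coassoc pair112]
  abel

end Drozd

/-- Drozd's ditalgebra: `R = S × S`, `W₀ = w₁₂ *J`, `W₁ = w₁ *J ⊕ w₂ *J` and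
`d(w_k γ) = -∑ w_k γ_i ⊗ w_k γ_j γ(p_j p_i)` for `k = 1, 2`,
`d(w₁₂ γ) = ∑ (w₁₂ γ_i ⊗ w₂ γ_j γ(p_j p_i) - w₁ γ_i ⊗ w₁₂ γ_j γ(p_j p_i))`. -/
abbrev drozd : Ditalgebra K :=
  (Drozd.data B).ditalgebra (Drozd.d_mu12 B) (fun γ => by
    change (Drozd.data B).d (-B.mu (Drozd.w1 S J) (Drozd.w1 S J) γ.1 - B.mu (Drozd.w2 S J) (Drozd.w2 S J) γ.2) = 0
    rw [map_sub, map_neg, Drozd.d_mu11, Drozd.d_mu22, neg_zero, sub_zero])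

end Drozd

/-! ## Morphisms of projective modules with image in the radical -/

/-- The category of morphisms `(0, φ¹) : M → N` of `Mod 𝒜`. -/
def radicalMaps {K : Type u} [Field K] (𝒜 : Ditalgebra K) : ObjectProperty (Arrow 𝒜.Mod) :=
  fun φ => Ditalgebra.Mod.Hom.f₀ φ.hom = 0

/-- The morphisms `φ : P → Q` of projective right `Λ`-modules whose image is contained in the
radical of `Q`. -/
def isM1 (Λ : Type u) [Ring Λ] : ObjectProperty (Arrow (ModuleCat.{u} Λᵐᵒᵖ)) :=
  fun φ => Module.Projective Λᵐᵒᵖ φ.left ∧ Module.Projective Λᵐᵒᵖ φ.right ∧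
    LinearMap.range φ.hom.hom ≤ Module.jacobson Λᵐᵒᵖ φ.right

section Tens

variable {K : Type u} [Field K] {Λ : Type u} [Ring Λ] [Algebra K Λ]
variable {S : Subalgebra K Λ} {J : Ideal Λ} [J.IsTwoSided] (B : DualBasis S J)

/-- The relations `m s ⊗ a = m ⊗ s a`. -/
def tensRel (V : RightMod K S) : Submodule Λᵐᵒᵖ (Λ ⊗[K] V) :=
  Submodule.span Λᵐᵒᵖ {z | ∃ (s : S) (a : Λ) (m : V), z = ((s : Λ) * a) ⊗ₜ[K] m - a ⊗ₜ[K] V.act s m}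

/-- The right `Λ`-module `V ⊗_S Λ`. -/
def Tens (V : RightMod K S) : Type u := (Λ ⊗[K] V) ⧸ tensRel V

instance (V : RightMod K S) : AddCommGroup (Tens V) :=
  inferInstanceAs (AddCommGroup ((Λ ⊗[K] V) ⧸ tensRel V))

instance (V : RightMod K S) : Module Λᵐᵒᵖ (Tens V) :=
  inferInstanceAs (Module Λᵐᵒᵖ ((Λ ⊗[K] V) ⧸ tensRel V))

namespace Tens

variable {V V' V'' : RightMod K S}

/-- The element `m ⊗ a` of `V ⊗_S Λ`. -/
def mk (m : V) (a : Λ) : Tens V := (tensRel V).mkQ (a ⊗ₜ[K] m)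

lemma mk_act (m : V) (s : S) (a : Λ) : mk (V.act s m) a = mk m ((s : Λ) * a) := by
  refine ((Submodule.Quotient.eq _).2 ?_).symm
  exact Submodule.subset_span ⟨s, a, m, rfl⟩

lemma mk_add_left (m m' : V) (a : Λ) : mk (m + m') a = mk m a + mk m' a := by
  rw [mk, TensorProduct.tmul_add, map_add]; rfl

lemma mk_add_right (m : V) (a b : Λ) : mk m (a + b) = mk m a + mk m b := by
  rw [mk, TensorProduct.add_tmul, map_add]; rfl

lemma mk_zero_left (a : Λ) : mk (0 : V) a = 0 := by
  rw [mk, TensorProduct.tmul_zero, map_zero]; rfl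

lemma mk_zero_right (m : V) : mk m (0 : Λ) = 0 := by
  rw [mk, TensorProduct.zero_tmul, map_zero]; rfl

lemma mk_smul (m : V) (a b : Λ) : mk m (a * b) = op b • mk m a := rfl

lemma mk_sum_left {n : ℕ} (m : Fin n → V) (a : Λ) : mk (∑ i, m i) a = ∑ i, mk (m i) a :=
  map_sum ({ toFun := fun m => mk m a, map_zero' := mk_zero_left a,
             map_add' := fun x y => mk_add_left x y a } : V →+ Tens V) m Finset.univ

lemma mk_sum_right {n : ℕ} (m : V) (a : Fin n → Λ) : mk m (∑ i, a i) = ∑ i, mk m (a i) :=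
  map_sum ({ toFun := fun a => mk m a, map_zero' := mk_zero_right m,
             map_add' := fun x y => mk_add_right m x y } : Λ →+ Tens V) a Finset.univ

lemma hom_ext {X : Type u} [AddCommGroup X] [Module Λᵐᵒᵖ X] {f g : Tens V →ₗ[Λᵐᵒᵖ] X}
    (h : ∀ m a, f (mk m a) = g (mk m a)) : f = g := by
  refine LinearMap.ext fun x => ?_
  obtain ⟨z, rfl⟩ := (tensRel V).mkQ_surjective x
  induction z using TensorProduct.induction_on with
  | zero => rw [map_zero]; exact (map_zero f).trans (map_zero g).symm
  | tmul a m => exact h m a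
  | add x y hx hy =>
    rw [map_add]
    exact (map_add f _ _).trans ((congrArg₂ (· + ·) hx hy).trans (map_add g _ _).symm)

end Tens

/-- A pair `(f, c)` with `f : V → V'` a morphism of right `S`-modules and
`c : *J → Hom_K(V, V')` a morphism of `S`-bimodules. -/
structure CMap (S : Subalgebra K Λ) (J : Ideal Λ) [J.IsTwoSided] (V V' : RightMod K S) where
  f : V →ₗ[K] V'
  c : Dual S J →ₗ[K] (V →ₗ[K] V')
  map_act : ∀ s m, f (V.act s m) = V'.act s (f m)
  left : ∀ (s : S) γ m, c (s • γ) m = c γ (V.act s m)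
  right : ∀ (s : S) γ m, c (op s • γ) m = V'.act s (c γ m)

namespace CMap

variable {V V' V'' : RightMod K S}

/-- Left multiplication by an element of `Λ`, as a morphism of right modules. -/
def lmulHom (x : Λ) : Λ →ₗ[Λᵐᵒᵖ] Λ where
  toFun a := x * a
  map_add' a b := mul_add x a b
  map_smul' a b := (mul_assoc x b a.unop).symm

/-- The map `Λ ⊗ V → Λ ⊗ V'` sending `a ⊗ m` to `a ⊗ f m + ∑ p_i a ⊗ c(γ_i)(m)`. -/
def pre (φ : CMap S J V V') : Λ ⊗[K] V →ₗ[Λᵐᵒᵖ] Λ ⊗[K] V' :=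
  TensorProduct.AlgebraTensorModule.map LinearMap.id φ.f +
    ∑ i, TensorProduct.AlgebraTensorModule.map (lmulHom (B.p i : Λ)) (φ.c (B.γ i))

lemma mkQ_pre (φ : CMap S J V V') (m : V) (a : Λ) :
    (tensRel V').mkQ (φ.pre B (a ⊗ₜ m)) =
      (Tens.mk (φ.f m) a + ∑ i, Tens.mk (φ.c (B.γ i) m) (B.p i * a) : Tens V') := by
  rw [pre, LinearMap.add_apply, map_add, LinearMap.sum_apply, map_sum]
  rfl

lemma sum_mk (φ : CMap S J V V') (m : V) (y a : Λ) :
    ∑ i, Tens.mk (φ.c (B.γ i) m) (B.p i * (y * a)) =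
      ∑ k, Tens.mk (φ.c ((B.γ k).shift y) m) (B.p k * a) := by
  have h : ∀ i, Tens.mk (φ.c (B.γ i) m) (B.p i * (y * a)) =
      ∑ k, Tens.mk (φ.c (op (B.γ k (Dual.jmul (B.p i) y)) • B.γ i) m) (B.p k * a) := by
    intro i
    have h1 : (B.p i : Λ) * (y * a) =
        ∑ k, (B.γ k (Dual.jmul (B.p i) y) : Λ) * (B.p k * a) := by
      rw [← mul_assoc]
      change (Dual.jmul (B.p i) y : Λ) * a = _
      conv_lhs => rw [← B.sum (Dual.jmul (B.p i) y)]
      rw [AddSubmonoidClass.coe_finsetSum, Finset.sum_mul]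
      exact Finset.sum_congr rfl fun k _ => mul_assoc _ _ _
    rw [h1, Tens.mk_sum_right]
    refine Finset.sum_congr rfl fun k _ => ?_
    rw [φ.right, Tens.mk_act]
  simp only [h]
  rw [Finset.sum_comm]
  refine Finset.sum_congr rfl fun k _ => ?_
  rw [← Tens.mk_sum_left, ← LinearMap.sum_apply, ← map_sum, B.sum_op_smul]

/-- The morphism `V ⊗_S Λ → V' ⊗_S Λ` sending `m ⊗ a` to
`f(m) ⊗ a + ∑ c(γ_i)(m) ⊗ p_i a`. -/
def map (φ : CMap S J V V') : Tens V →ₗ[Λᵐᵒᵖ] Tens V' :=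
  (tensRel V).liftQ ((tensRel V').mkQ ∘ₗ φ.pre B) (by
    refine Submodule.span_le.2 ?_
    rintro _ ⟨s, a, m, rfl⟩
    change (tensRel V').mkQ (φ.pre B _) = 0
    rw [map_sub, map_sub]
    refine sub_eq_zero.2 ((φ.mkQ_pre B m _).trans (Eq.trans ?_ (φ.mkQ_pre B _ a).symm))
    rw [φ.sum_mk B m s a, φ.map_act, Tens.mk_act]
    refine congrArg (_ + ·) (Finset.sum_congr rfl fun k _ => ?_)
    rw [← φ.left]
    rfl)

lemma map_mk (φ : CMap S J V V') (m : V) (a : Λ) :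
    φ.map B (Tens.mk m a) =
      Tens.mk (φ.f m) a + ∑ i, Tens.mk (φ.c (B.γ i) m) (B.p i * a) := φ.mkQ_pre B m a

lemma map_map_mk (φ : CMap S J V V') (ψ : CMap S J V' V'') (m : V) (a : Λ) :
    ψ.map B (φ.map B (Tens.mk m a)) = Tens.mk (ψ.f (φ.f m)) a +
      ∑ k, Tens.mk (ψ.c (B.γ k) (φ.f m) + ψ.f (φ.c (B.γ k) m) +
        ∑ i, ψ.c ((B.γ k).shift (B.p i)) (φ.c (B.γ i) m)) (B.p k * a) := by
  rw [map_mk, map_add, map_sum]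
  simp only [map_mk, sum_mk]
  simp only [Tens.mk_add_left, Tens.mk_sum_left, Finset.sum_add_distrib]
  rw [Finset.sum_comm (s := Finset.univ) (t := Finset.univ), add_assoc, add_assoc]

end CMap

/-! ### The functor `Ξ` -/

/-- The right `S`-module `N j(1)`, for a multiplicative linear map `j : S → R'` and a right
`R'`-module `N`; the action of `s` is the one of `j(s)`. -/
def piece {R' : Type u} [Ring R'] [Algebra K R'] (N : RightMod K R') (j : S →ₗ[K] R')
    (hj : ∀ s t, j (s * t) = j s * j t) : RightMod K S :=
  RightMod.ofAct (LinearMap.range (N.act (j 1)))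
    { toFun := fun s => (N.act (j s)).restrict (by
        intro x _
        refine ⟨N.act (j s) x, ?_⟩
        rw [← RightMod.act_mul, ← hj, mul_one])
      map_add' := fun s t => LinearMap.ext fun x => Subtype.ext (by
        change N.act (j (s + t)) x.1 = N.act (j s) x.1 + N.act (j t) x.1
        rw [map_add, map_add, LinearMap.add_apply])
      map_smul' := fun k s => LinearMap.ext fun x => Subtype.ext (by
        change N.act (j (k • s)) x.1 = k • N.act (j s) x.1
        rw [map_smul, map_smul, LinearMap.smul_apply]) }
    (by
      ext ⟨_, x, rfl⟩
      change N.act (j 1) (N.act (j 1) x) = N.act (j 1) x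
      rw [← RightMod.act_mul, ← hj, mul_one])
    (fun s t => by
      ext x
      change N.act (j (s * t)) x.1 = N.act (j t) (N.act (j s) x.1)
      rw [hj, RightMod.act_mul])

namespace piece

variable {R' : Type u} [Ring R'] [Algebra K R'] {N N' : RightMod K R'} {j j' : S →ₗ[K] R'}
  {hj : ∀ s t, j (s * t) = j s * j t} {hj' : ∀ s t, j' (s * t) = j' s * j' t}

/-- The inclusion of `N j(1)` in `N`. -/
def val (x : piece N j hj) : N := x.1

lemma val_injective : Function.Injective (val (N := N) (j := j) (hj := hj)) :=
  Subtype.val_injective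

lemma val_zero : val (0 : piece N j hj) = 0 := rfl
lemma val_add (x y : piece N j hj) : val (x + y) = val x + val y := rfl
lemma val_smul (k : K) (x : piece N j hj) : val (k • x) = k • val x := rfl
lemma val_sum {n : ℕ} (x : Fin n → piece N j hj) : val (∑ i, x i) = ∑ i, val (x i) :=
  map_sum (LinearMap.range (N.act (j 1))).subtype x Finset.univ

lemma val_act (s : S) (x : piece N j hj) : val ((piece N j hj).act s x) = N.act (j s) (val x) := rfl

lemma act_val (x : piece N j hj) : N.act (j 1) (val x) = val x := by
  rw [← val_act, RightMod.act_one]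

/-- The restriction of a linear map `N → N'` to `N j(1) → N' j'(1)`. -/
def lift (g : N →ₗ[K] N') (h : ∀ x : piece N j hj, N'.act (j' 1) (g (val x)) = g (val x)) :
    piece N j hj →ₗ[K] piece N' j' hj' where
  toFun x := ⟨g (val x), g (val x), h x⟩
  map_add' x y := val_injective (map_add g (val x) (val y))
  map_smul' k x := val_injective (map_smul g k (val x))

/-- The restriction of a family of linear maps `N → N'` to `N j(1) → N' j'(1)`. -/
def lifts {D : Type u} [AddCommGroup D] [Module K D] (g : D →ₗ[K] (N →ₗ[K] N'))
    (h : ∀ γ (x : piece N j hj), N'.act (j' 1) (g γ (val x)) = g γ (val x)) :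
    D →ₗ[K] (piece N j hj →ₗ[K] piece N' j' hj') where
  toFun γ := lift (g γ) (h γ)
  map_add' γ γ' := LinearMap.ext fun x => val_injective (by
    change g (γ + γ') (val x) = g γ (val x) + g γ' (val x)
    rw [map_add, LinearMap.add_apply])
  map_smul' k γ := LinearMap.ext fun x => val_injective (by
    change g (k • γ) (val x) = k • g γ (val x)
    rw [map_smul, LinearMap.smul_apply])

end piece

namespace Drozd

variable (S J) in
/-- The element `(s, 0)` of `S × S`, in `T_0`. -/
def j1 : S →ₗ[K] T.zero (W₀ S J) (W₁ S J) where
  toFun s := T.rZero (s, 0)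
  map_add' s t := Subtype.ext (by
    refine Eq.trans ?_ (map_add (T.ιR (W₀ S J) (W₁ S J)) (s, 0) (t, 0))
    simp [T.rZero])
  map_smul' k s := Subtype.ext (by
    refine Eq.trans ?_ (map_smul (T.ιR (W₀ S J) (W₁ S J)) k (s, 0))
    simp [T.rZero])

variable (S J) in
/-- The element `(0, s)` of `S × S`, in `T_0`. -/
def j2 : S →ₗ[K] T.zero (W₀ S J) (W₁ S J) where
  toFun s := T.rZero (0, s)
  map_add' s t := Subtype.ext (by
    refine Eq.trans ?_ (map_add (T.ιR (W₀ S J) (W₁ S J)) (0, s) (0, t))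
    simp [T.rZero])
  map_smul' k s := Subtype.ext (by
    refine Eq.trans ?_ (map_smul (T.ιR (W₀ S J) (W₁ S J)) k (0, s))
    simp [T.rZero])

lemma j1_mul (s t : S) : j1 S J (s * t) = j1 S J s * j1 S J t := Subtype.ext (by
  refine Eq.trans ?_ (map_mul (T.ιR (W₀ S J) (W₁ S J)) (s, 0) (t, 0))
  simp [j1, T.rZero])

lemma j2_mul (s t : S) : j2 S J (s * t) = j2 S J s * j2 S J t := Subtype.ext (by
  refine Eq.trans ?_ (map_mul (T.ιR (W₀ S J) (W₁ S J)) (0, s) (0, t))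
  simp [j2, T.rZero])

variable (S J) in
/-- The element `w₁₂ γ` of `T_0`. -/
def u : Dual S J →ₗ[K] T.zero (W₀ S J) (W₁ S J) where
  toFun γ := ⟨w12 S J γ, w12_mem γ⟩
  map_add' γ γ' := Subtype.ext (map_add _ γ γ')
  map_smul' k γ := Subtype.ext (map_smul _ k γ)

variable (S J) in
/-- The element `w₁ γ` of `T_1`. -/
def v1 : Dual S J →ₗ[K] T.gr (W₀ S J) (W₁ S J) 1 := (w1 S J).codRestrict _ w1_mem

variable (S J) in
/-- The element `w₂ γ` of `T_1`. -/
def v2 : Dual S J →ₗ[K] T.gr (W₀ S J) (W₁ S J) 1 := (w2 S J).codRestrict _ w2_mem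

lemma u_smul (s : S) (γ : Dual S J) : u S J (s • γ) = j1 S J s * u S J γ :=
  Subtype.ext (w12_left (s, 0) γ).symm

lemma u_op_smul (s : S) (γ : Dual S J) : u S J (op s • γ) = u S J γ * j2 S J s :=
  Subtype.ext (w12_right (0, s) γ).symm

lemma v1_smul (s : S) (γ : Dual S J) : v1 S J (s • γ) = T.lmul (j1 S J s) (v1 S J γ) :=
  Subtype.ext (w1_left (s, 0) γ).symm

lemma v1_op_smul (s : S) (γ : Dual S J) : v1 S J (op s • γ) = T.rmul (v1 S J γ) (j1 S J s) :=
  Subtype.ext (w1_right (s, 0) γ).symm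

lemma v2_smul (s : S) (γ : Dual S J) : v2 S J (s • γ) = T.lmul (j2 S J s) (v2 S J γ) :=
  Subtype.ext (w2_left (0, s) γ).symm

lemma v2_op_smul (s : S) (γ : Dual S J) : v2 S J (op s • γ) = T.rmul (v2 S J γ) (j2 S J s) :=
  Subtype.ext (w2_right (0, s) γ).symm

/-- The right `S`-module `M₁ = M (1, 0)`. -/
abbrev M₁ (M : RightMod K (T.zero (W₀ S J) (W₁ S J))) : RightMod K S := piece M (j1 S J) j1_mul

/-- The right `S`-module `M₂ = M (0, 1)`. -/
abbrev M₂ (M : RightMod K (T.zero (W₀ S J) (W₁ S J))) : RightMod K S := piece M (j2 S J) j2_mul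

/-- The map `*J → Hom_K(M₁, M₂)` given by the action of `w₁₂ *J`. -/
def cAct (M : RightMod K (T.zero (W₀ S J) (W₁ S J))) : CMap S J (M₁ M) (M₂ M) where
  f := 0
  c := piece.lifts (M.act ∘ₗ u S J) (fun γ x => by
    rw [LinearMap.comp_apply, ← RightMod.act_mul, ← u_op_smul, op_one, one_smul])
  map_act s m := (map_zero _).symm
  left s γ m := piece.val_injective (by
    change M.act (u S J (s • γ)) (piece.val m) =
      M.act (u S J γ) (M.act (j1 S J s) (piece.val m))
    rw [u_smul, RightMod.act_mul])
  right s γ m := piece.val_injective (by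
    change M.act (u S J (op s • γ)) (piece.val m) =
      M.act (j2 S J s) (M.act (u S J γ) (piece.val m))
    rw [u_op_smul, RightMod.act_mul])

/-- The pair `(f⁰, f¹)` restricted to `M j(1)`. -/
def cHom (j : S →ₗ[K] T.zero (W₀ S J) (W₁ S J)) (hj : ∀ s t, j (s * t) = j s * j t)
    (v : Dual S J →ₗ[K] T.gr (W₀ S J) (W₁ S J) 1)
    (hl : ∀ (s : S) γ, v (s • γ) = T.lmul (j s) (v γ))
    (hr : ∀ (s : S) γ, v (op s • γ) = T.rmul (v γ) (j s))
    {M N : RightMod K (T.zero (W₀ S J) (W₁ S J))} (f₀ : M →ₗ[K] N) (f₁ : BMap M N)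
    (hf : ∀ s m, f₀ (M.act (j s) m) = N.act (j s) (f₀ m)) :
    CMap S J (piece M j hj) (piece N j hj) where
  f := piece.lift f₀ (fun x => by rw [← hf, piece.act_val])
  c := piece.lifts (f₁.toFun ∘ₗ v) (fun γ x => by
    rw [LinearMap.comp_apply, ← f₁.right, ← hr, op_one, one_smul])
  map_act s m := piece.val_injective (hf s (piece.val m))
  left s γ m := piece.val_injective (by
    change f₁.toFun (v (s • γ)) (piece.val m) = f₁.toFun (v γ) (M.act (j s) (piece.val m))
    rw [hl, f₁.left])
  right s γ m := piece.val_injective (by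
    change f₁.toFun (v (op s • γ)) (piece.val m) = N.act (j s) (f₁.toFun (v γ) (piece.val m))
    rw [hr, f₁.right])

variable {M N L : (drozd B).Mod}

/-- The first component of a morphism. -/
def c1 (f : Ditalgebra.Mod.Hom M N) : CMap S J (M₁ M.mod) (M₁ N.mod) :=
  cHom (j1 S J) j1_mul (v1 S J) v1_smul v1_op_smul f.f₀ f.f₁ (fun s m => f.map_R (s, 0) m)

/-- The second component of a morphism. -/
def c2 (f : Ditalgebra.Mod.Hom M N) : CMap S J (M₂ M.mod) (M₂ N.mod) :=
  cHom (j2 S J) j2_mul (v2 S J) v2_smul v2_op_smul f.f₀ f.f₁ (fun s m => f.map_R (0, s) m)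

lemma comp_d_v1 (f : Ditalgebra.Mod.Hom M N) (g : Ditalgebra.Mod.Hom N L) (γ : Dual S J)
    (m : M.mod) :
    BMap.comp f.f₁ g.f₁ ((drozd B).d (v1 S J γ).1) m =
      -∑ i, g.f₁.toFun (v1 S J (γ.shift (B.p i))) (f.f₁.toFun (v1 S J (B.γ i)) m) := by
  have h : (drozd B).d (v1 S J γ).1 =
      -∑ i, (v1 S J (B.γ i)).1 * (v1 S J (γ.shift (B.p i))).1 :=
    (d_w1 B γ).trans (congrArg Neg.neg (B.mu_eq _ _ γ))
  rw [h, map_neg, map_sum, LinearMap.neg_apply, LinearMap.sum_apply]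
  exact congrArg Neg.neg (Finset.sum_congr rfl fun i _ => BMap.comp_mul _ _ _ _ _)

lemma comp_d_v2 (f : Ditalgebra.Mod.Hom M N) (g : Ditalgebra.Mod.Hom N L) (γ : Dual S J)
    (m : M.mod) :
    BMap.comp f.f₁ g.f₁ ((drozd B).d (v2 S J γ).1) m =
      -∑ i, g.f₁.toFun (v2 S J (γ.shift (B.p i))) (f.f₁.toFun (v2 S J (B.γ i)) m) := by
  have h : (drozd B).d (v2 S J γ).1 =
      -∑ i, (v2 S J (B.γ i)).1 * (v2 S J (γ.shift (B.p i))).1 :=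
    (d_w2 B γ).trans (congrArg Neg.neg (B.mu_eq _ _ γ))
  rw [h, map_neg, map_sum, LinearMap.neg_apply, LinearMap.sum_apply]
  exact congrArg Neg.neg (Finset.sum_congr rfl fun i _ => BMap.comp_mul _ _ _ _ _)

lemma map_c1_comp (f : Ditalgebra.Mod.Hom M N) (g : Ditalgebra.Mod.Hom N L) :
    (c1 B (Ditalgebra.Mod.Hom.comp f g)).map B = (c1 B g).map B ∘ₗ (c1 B f).map B := by
  refine Tens.hom_ext fun m a => ?_
  rw [LinearMap.comp_apply, CMap.map_map_mk, CMap.map_mk]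
  refine congrArg₂ (· + ·) rfl (Finset.sum_congr rfl fun k _ => ?_)
  refine congrArg (fun x => Tens.mk x (B.p k * a)) (piece.val_injective ?_)
  rw [piece.val_add, piece.val_add, piece.val_sum]
  refine (Ditalgebra.Mod.Hom.comp_f₁ f g (v1 S J (B.γ k)) (piece.val m)).trans ?_
  rw [comp_d_v1, sub_neg_eq_add]
  rfl

lemma map_c2_comp (f : Ditalgebra.Mod.Hom M N) (g : Ditalgebra.Mod.Hom N L) :
    (c2 B (Ditalgebra.Mod.Hom.comp f g)).map B = (c2 B g).map B ∘ₗ (c2 B f).map B := by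
  refine Tens.hom_ext fun m a => ?_
  rw [LinearMap.comp_apply, CMap.map_map_mk, CMap.map_mk]
  refine congrArg₂ (· + ·) rfl (Finset.sum_congr rfl fun k _ => ?_)
  refine congrArg (fun x => Tens.mk x (B.p k * a)) (piece.val_injective ?_)
  rw [piece.val_add, piece.val_add, piece.val_sum]
  refine (Ditalgebra.Mod.Hom.comp_f₁ f g (v2 S J (B.γ k)) (piece.val m)).trans ?_
  rw [comp_d_v2, sub_neg_eq_add]
  rfl

lemma map_c1_id : (c1 B (Ditalgebra.Mod.Hom.id M)).map B = LinearMap.id := by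
  refine Tens.hom_ext fun m a => ?_
  rw [CMap.map_mk, Finset.sum_eq_zero, add_zero]
  · rfl
  · exact fun i _ => Tens.mk_zero_left _

lemma map_c2_id : (c2 B (Ditalgebra.Mod.Hom.id M)).map B = LinearMap.id := by
  refine Tens.hom_ext fun m a => ?_
  rw [CMap.map_mk, Finset.sum_eq_zero, add_zero]
  · rfl
  · exact fun i _ => Tens.mk_zero_left _

lemma d₀_u (γ : Dual S J) : (drozd B).d₀ (u S J γ) =
    ∑ i, T.lmul (u S J (B.γ i)) (v2 S J (γ.shift (B.p i))) -
      ∑ i, T.rmul (v1 S J (B.γ i)) (u S J (γ.shift (B.p i))) := by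
  refine Subtype.ext ?_
  rw [AddSubgroupClass.coe_sub, AddSubmonoidClass.coe_finsetSum, AddSubmonoidClass.coe_finsetSum]
  refine (d_w12 B γ).trans ?_
  rw [B.mu_eq, B.mu_eq]
  rfl

lemma square (f : Ditalgebra.Mod.Hom M N) :
    (cAct N.mod).map B ∘ₗ (c1 B f).map B = (c2 B f).map B ∘ₗ (cAct M.mod).map B := by
  refine Tens.hom_ext fun m a => ?_
  rw [LinearMap.comp_apply, LinearMap.comp_apply, CMap.map_map_mk, CMap.map_map_mk]
  refine congrArg₂ (· + ·) (congrArg (fun x => Tens.mk x a) (map_zero _).symm)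
    (Finset.sum_congr rfl fun k _ => ?_)
  refine congrArg (fun x => Tens.mk x (B.p k * a)) (piece.val_injective ?_)
  rw [piece.val_add, piece.val_add, piece.val_add, piece.val_add, piece.val_sum, piece.val_sum]
  have h := f.map_act (u S J (B.γ k)) (piece.val m)
  rw [d₀_u, map_sub, map_sum, map_sum, LinearMap.sub_apply, LinearMap.sum_apply,
    LinearMap.sum_apply] at h
  simp only [f.f₁.left, f.f₁.right] at h
  change N.mod.act (u S J (B.γ k)) (f.f₀ (piece.val m)) + 0 +
    ∑ i, N.mod.act (u S J ((B.γ k).shift (B.p i)))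
      (f.f₁.toFun (v1 S J (B.γ i)) (piece.val m)) =
    f.f₁.toFun (v2 S J (B.γ k)) 0 + f.f₀ (M.mod.act (u S J (B.γ k)) (piece.val m)) +
    ∑ i, f.f₁.toFun (v2 S J ((B.γ k).shift (B.p i)))
      (M.mod.act (u S J (B.γ i)) (piece.val m))
  rw [map_zero, zero_add, add_zero, h]
  abel

end Drozd

/-- The functor `Ξ`, with values in the category of all morphisms of right `Λ`-modules: `M` is
sent to `M₁ ⊗_S Λ → M₂ ⊗_S Λ`, `m ⊗ a ↦ ∑ m (w₁₂ γ_i) ⊗ p_i a`, and a morphism `f` to the pair of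
`m ⊗ a ↦ f⁰(m) ⊗ a + ∑ f¹(w_k γ_i)(m) ⊗ p_i a`, `k = 1, 2`. -/
def Ξ : (drozd B).Mod ⥤ Arrow (ModuleCat.{u} Λᵐᵒᵖ) where
  obj M := Arrow.mk (ModuleCat.ofHom ((Drozd.cAct M.mod).map B))
  map {M N} f := Arrow.homMk (ModuleCat.ofHom ((Drozd.c1 B f).map B))
    (ModuleCat.ofHom ((Drozd.c2 B f).map B))
    (congrArg ModuleCat.ofHom (Drozd.square B f))
  map_id M := by
    ext1
    · exact congrArg ModuleCat.ofHom (Drozd.map_c1_id B)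
    · exact congrArg ModuleCat.ofHom (Drozd.map_c2_id B)
  map_comp f g := by
    ext1
    · exact congrArg ModuleCat.ofHom (Drozd.map_c1_comp B f g)
    · exact congrArg ModuleCat.ofHom (Drozd.map_c2_comp B f g)

end Tens

/-! ## The algebra of an algebraically equipped poset -/

/-- A `P`-multiplicative system of subspaces of `A`.  The subspace `space i j` is only meaningful
for `i ≤ j`; it is set to zero otherwise. -/
structure MultiplicativeSystem (K P A : Type u) [Field K] [PartialOrder P] [Ring A]
    [Algebra K A] where
  space : P → P → Submodule K A
  space_eq_bot : ∀ i j, ¬ i ≤ j → space i j = ⊥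
  mul_mem : ∀ i j l, i ≤ j → j ≤ l → ∀ a ∈ space i j, ∀ b ∈ space j l, a * b ∈ space i l
  one : P → A
  one_mem : ∀ i, one i ∈ space i i
  one_mul : ∀ i j, ∀ a ∈ space i j, one i * a = a
  mul_one : ∀ i j, ∀ a ∈ space i j, a * one j = a

namespace MultiplicativeSystem

variable {K P A : Type u} [Field K] [PartialOrder P] [Ring A] [Algebra K A]

/-- Every `R_i = R_{i,i}` is a division ring. -/
def IsDivision (ℛ : MultiplicativeSystem K P A) : Prop :=
  ∀ i, ℛ.one i ≠ 0 ∧ ∀ a ∈ ℛ.space i i, a ≠ 0 →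
    ∃ b ∈ ℛ.space i i, a * b = ℛ.one i ∧ b * a = ℛ.one i

variable [Fintype P] [DecidableEq P] (ℛ : MultiplicativeSystem K P A)

/-- The matrices with entry `(i, j)` in `R_{i,j}`, for all `i` and `j`. -/
def mats : NonUnitalSubalgebra K (Matrix P P A) where
  carrier := {a | ∀ i j, a i j ∈ ℛ.space i j}
  add_mem' ha hb i j := add_mem (ha i j) (hb i j)
  zero_mem' i j := zero_mem _
  smul_mem' k _ ha i j := Submodule.smul_mem _ k (ha i j)
  mul_mem' := by
    intro a b ha hb i l
    rw [Matrix.mul_apply]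
    refine sum_mem fun j _ => ?_
    have h1 := ha i j
    have h2 := hb j l
    by_cases hij : i ≤ j
    · by_cases hjl : j ≤ l
      · exact ℛ.mul_mem i j l hij hjl _ h1 _ h2
      · rw [ℛ.space_eq_bot j l hjl, Submodule.mem_bot] at h2
        rw [h2, mul_zero]
        exact zero_mem _
    · rw [ℛ.space_eq_bot i j hij, Submodule.mem_bot] at h1
      rw [h1, zero_mul]
      exact zero_mem _

/-- The algebra `Λ(R) = ⊕_{i ≤ j} e_{i,j} R_{i,j}`, with the product of matrices and the unit
`∑ e_{i,i} 1_i`. -/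
def Alg : Type u := ℛ.mats

namespace Alg

variable {ℛ}

/-- The matrix of an element of `Λ(R)`. -/
def val (a : ℛ.Alg) : Matrix P P A := a.1

lemma val_injective : Function.Injective (val (ℛ := ℛ)) := Subtype.val_injective

lemma val_mem (a : ℛ.Alg) (i j : P) : a.val i j ∈ ℛ.space i j := a.2 i j

lemma val_eq_zero (a : ℛ.Alg) {i j : P} (h : ¬ i ≤ j) : a.val i j = 0 := by
  have := a.val_mem i j
  rwa [ℛ.space_eq_bot i j h, Submodule.mem_bot] at this

/-- The diagonal matrix with entries `1_i` for `i ∈ X`, and `0` for `i ∉ X`. -/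
def diagOne (X : P → Prop) [DecidablePred X] : ℛ.Alg :=
  ⟨Matrix.diagonal fun i => if X i then ℛ.one i else 0, fun i j => by
    rcases eq_or_ne i j with rfl | h
    · rw [Matrix.diagonal_apply_eq]
      split_ifs
      · exact ℛ.one_mem i
      · exact zero_mem _
    · rw [Matrix.diagonal_apply_ne _ h]
      exact zero_mem _⟩

lemma diagOne_val (X : P → Prop) [DecidablePred X] :
    (diagOne (ℛ := ℛ) X).val = Matrix.diagonal fun i => if X i then ℛ.one i else 0 := rfl

instance : NonUnitalRing ℛ.Alg := inferInstanceAs (NonUnitalRing ℛ.mats)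
instance : Module K ℛ.Alg := inferInstanceAs (Module K ℛ.mats)

lemma val_add (a b : ℛ.Alg) : (a + b).val = a.val + b.val := rfl
lemma val_mul (a b : ℛ.Alg) : (a * b).val = a.val * b.val := rfl
lemma val_zero : (0 : ℛ.Alg).val = 0 := rfl
lemma val_smul (k : K) (a : ℛ.Alg) : (k • a).val = k • a.val := rfl

lemma diagOne_mul (X : P → Prop) [DecidablePred X] (a : ℛ.Alg) (i j : P) :
    (diagOne X * a).val i j = if X i then a.val i j else 0 := by
  rw [val_mul, diagOne_val, Matrix.diagonal_mul]
  split_ifs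
  · exact ℛ.one_mul i j _ (a.val_mem i j)
  · rw [zero_mul]

lemma mul_diagOne (X : P → Prop) [DecidablePred X] (a : ℛ.Alg) (i j : P) :
    (a * diagOne X).val i j = if X j then a.val i j else 0 := by
  rw [val_mul, diagOne_val, Matrix.mul_diagonal]
  split_ifs
  · exact ℛ.mul_one i j _ (a.val_mem i j)
  · rw [mul_zero]

instance : Ring ℛ.Alg where
  __ := (inferInstance : NonUnitalRing ℛ.Alg)
  one := diagOne fun _ => True
  one_mul a := val_injective <| by
    ext i j
    exact (diagOne_mul (fun _ => True) a i j).trans (if_pos trivial)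
  mul_one a := val_injective <| by
    ext i j
    exact (mul_diagOne (fun _ => True) a i j).trans (if_pos trivial)

lemma one_eq : (1 : ℛ.Alg) = diagOne fun _ => True := rfl

instance : Algebra K ℛ.Alg :=
  Algebra.ofModule
    (fun k a b => val_injective (smul_mul_assoc k a.val b.val))
    (fun k a b => val_injective (mul_smul_comm k a.val b.val))

end Alg

open Alg

/-- The subalgebra `S = ⊕ e_{i,i} R_i` of diagonal matrices. -/
def S : Subalgebra K ℛ.Alg where
  carrier := {a | ∀ i j, i ≠ j → a.val i j = 0}
  add_mem' {a b} ha hb i j h := by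
    rw [val_add, Matrix.add_apply, ha i j h, hb i j h, add_zero]
  mul_mem' {a b} ha hb i j h := by
    rw [val_mul, Matrix.mul_apply]
    refine Finset.sum_eq_zero fun l _ => ?_
    rcases eq_or_ne i l with rfl | h'
    · rw [hb i j h, mul_zero]
    · rw [ha i l h', zero_mul]
  algebraMap_mem' k i j h := by
    rw [Algebra.algebraMap_eq_smul_one, val_smul, Matrix.smul_apply, one_eq, diagOne_val,
      Matrix.diagonal_apply_ne _ h, smul_zero]

lemma mul_val_diag (a b : ℛ.Alg) (i : P) : (a * b).val i i = a.val i i * b.val i i := by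
  rw [val_mul, Matrix.mul_apply]
  refine Finset.sum_eq_single i (fun j _ hj => ?_) (fun h => absurd (Finset.mem_univ i) h)
  by_cases h : i ≤ j
  · rw [val_eq_zero b (fun h' => hj (le_antisymm h' h)), mul_zero]
  · rw [val_eq_zero a h, zero_mul]

/-- The ideal `J = ⊕_{i < j} e_{i,j} R_{i,j}` of matrices with zero diagonal. -/
def J : Ideal ℛ.Alg where
  carrier := {a | ∀ i, a.val i i = 0}
  add_mem' {a b} ha hb i := by rw [val_add, Matrix.add_apply, ha i, hb i, add_zero]
  zero_mem' i := rfl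
  smul_mem' a b hb i := by rw [smul_eq_mul, mul_val_diag, hb i, mul_zero]

instance : ℛ.J.IsTwoSided := ⟨fun {a} b ha i => by rw [mul_val_diag, ha i, zero_mul]⟩

variable [OrderBot P]

/-- The idempotent `e_0 = e_{0,0} 1_0`, where `0` is the minimum of `P`. -/
def e₀ : ℛ.Alg := diagOne fun i => i = ⊥

/-- The idempotent `e_0` as an element of `S`. -/
def e₀S : ℛ.S := ⟨ℛ.e₀, fun _ _ h => Matrix.diagonal_apply_ne _ h⟩

lemma e₀S_mul_e₀S : ℛ.e₀S * ℛ.e₀S = ℛ.e₀S := by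
  refine Subtype.ext (val_injective ?_)
  ext i j
  refine (diagOne_mul _ ℛ.e₀ i j).trans ?_
  split_ifs with h
  · rfl
  · rcases eq_or_ne i j with rfl | h'
    · exact Eq.symm ((Matrix.diagonal_apply_eq (fun i => if i = ⊥ then ℛ.one i else 0) i).trans
        (if_neg h))
    · exact (Matrix.diagonal_apply_ne _ h').symm

lemma e₀S_comm (s : ℛ.S) : ℛ.e₀S * s = s * ℛ.e₀S := by
  refine Subtype.ext (val_injective ?_)
  ext i j
  refine (diagOne_mul _ s.1 i j).trans (Eq.trans ?_ (mul_diagOne _ s.1 i j).symm)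
  rcases eq_or_ne i j with rfl | h
  · rfl
  · rw [s.2 i j h, ite_self, ite_self]

/-- The idempotent `e = ∑_{i > 0} w₁ e_i + w₂ e_0` of `S × S`; here `∑_{i > 0} e_i = 1 - e_0`. -/
def idem : CIdem (ℛ.S × ℛ.S) where
  e := (1 - ℛ.e₀S, ℛ.e₀S)
  idem := by
    refine Prod.ext ?_ ℛ.e₀S_mul_e₀S
    change (1 - ℛ.e₀S) * (1 - ℛ.e₀S) = 1 - ℛ.e₀S
    rw [sub_mul, mul_sub, mul_sub, ℛ.e₀S_mul_e₀S]
    simp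
  comm r := Prod.ext
    (by
      change (1 - ℛ.e₀S) * r.1 = r.1 * (1 - ℛ.e₀S)
      rw [sub_mul, mul_sub, ℛ.e₀S_comm, _root_.one_mul, _root_.mul_one])
    (ℛ.e₀S_comm r.2)

/-- The right module `e_0 Λ`. -/
abbrev e₀Λ : Submodule ℛ.Algᵐᵒᵖ ℛ.Alg := Submodule.span ℛ.Algᵐᵒᵖ {ℛ.e₀}

/-- The morphisms `P → (e_0 Λ)^ν` in `M¹(Λ)` such that `P e_0 = 0`; here `(e_0 Λ)^ν` is the direct
sum of copies of `e_0 Λ` indexed by a set `ν`. -/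
def isM : ObjectProperty (Arrow (ModuleCat.{u} ℛ.Algᵐᵒᵖ)) :=
  fun φ => isM1 ℛ.Alg φ ∧ (∀ x : φ.left, op ℛ.e₀ • x = 0) ∧
    ∃ ν : Type u, Nonempty (φ.right ≃ₗ[ℛ.Algᵐᵒᵖ] (ν →₀ ℛ.e₀Λ))

end MultiplicativeSystem

end Dit

end

noncomputable section

namespace Dit

/-! ## Modules and bimodule maps given on generators -/

section Generators

variable {K : Type u} [Field K] {R : Type u} [Ring R] [Algebra K R] {W₀ W₁ : Bimod K R}

namespace T

/-! Everything rests on a dictionary for homomorphisms between induced modules. Since `Λ = S ⊕ J`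
and `J` is an ideal, `V' ⊗_S Λ` is `V'` plus `V' ⊗_S J`, and a homomorphism `g : V ⊗_S Λ → V' ⊗_S Λ`
is determined by `m ↦ g(m ⊗ 1)`. Its first component is an `S`-linear map `f : V → V'`. Its second
component, contracted with `γ ∈ *J`, gives a morphism of `S`-bimodules `c : *J → Hom_K(V, V')`, and
the dual basis recovers `g` as `g(m ⊗ 1) = f(m) ⊗ 1 + ∑ c(γ_i)(m) ⊗ p_i`. So homomorphisms are the
same as pairs `CMap`; this is `CMap.map_ofMap` and `CMap.map_injective`. In a composite the products
`p_j p_i` appear, so the composition of pairs is governed by `μ`, the transpose of the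
multiplication of `J` (`CMap.coef_map_map`).

A morphism of ditalgebra modules is a pair of the same kind. The map `f¹` may be prescribed freely
as an `R`-bimodule map on `W₁`, and the compatibility with the differential need only be checked on
`W₀`. For Drozd's ditalgebra, `M` splits as `M₁ ⊕ M₂`, the action of `w₁₂ *J` is a pair `(0, c)`,
and a morphism is a pair on each summand. The compatibility at `w₁₂ γ` is the coefficient at `γ` of
the commutative square (`Drozd.sum_map_u`). Hence `Ξ` is full and faithful. For the ditalgebra `𝒜`
the functor `M ↦ M ⊗_S Λ` is full and faithful for the same reason, after replacing `f¹` by `-f¹`.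

Density uses that `S` is semisimple and `J` nilpotent. Then `V ⊗_S Λ` is projective, its radical is
the kernel of `V ⊗_S Λ → V`, and every projective `P` has this form: take an `S`-complement of `P J`
and apply Nakayama's lemma twice (`Tens.exists_equiv`). The image of a homomorphism lies in the
radical exactly when `f = 0`. So `Mod 𝒟` and the category of morphisms `(0, ψ)` are both equivalent
to `M¹(Λ)`. In (1) `Λ` is artinian, being finite over `S`, so its radical is nilpotent; in (2) each
factor from `J` raises the height in the poset, and `S` is a sum of simple left ideals.

For the last claim, `F_η` is full and faithful, and its essential image contains all modules on
which `e` acts as the identity, that is, `M₁ e_0 = 0` and `M₂ e_0 = M₂`. Because `0` is the minimum,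
`Λ e_0 = e_0 Λ e_0`, so the first condition says `(M₁ ⊗ Λ) e_0 = 0`. The second makes `M₂` a vector
space over the division ring `R_0`, and a basis gives `M₂ ⊗ Λ ≅ (e_0 Λ)^ν`; conversely such an
isomorphism forces `e_0` to act as the identity on `M₂`. -/

lemma zero_induction {p : zero W₀ W₁ → Prop} (hR : ∀ r, p (rZero r)) (hW : ∀ w, p (wZero w))
    (hadd : ∀ a b, p a → p b → p (a + b)) (hmul : ∀ a b, p a → p b → p (a * b))
    (a : zero W₀ W₁) : p a := by
  -- Degrees are natural numbers, so both factors of a product of degree `0` have degree `0` and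
  -- `W₁` never occurs. The degree is kept as a variable with an equation so that induction on
  -- `Mono` applies.
  have key : ∀ n x, Mono W₀ W₁ n x → n = 0 → ∀ h : x ∈ zero W₀ W₁, p ⟨x, h⟩ := by
    intro n x hx
    induction hx with
    | ofR r => exact fun _ _ => hR r
    | ofW₀ w => exact fun _ _ => hW w
    | ofW₁ w => intro h; omega
    | @mul m n a b ha hb iha ihb =>
      intro h _
      obtain ⟨rfl, rfl⟩ : m = 0 ∧ n = 0 := by omega
      exact hmul ⟨a, ha.mem⟩ ⟨b, hb.mem⟩ (iha rfl ha.mem) (ihb rfl hb.mem)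
  obtain ⟨a, ha⟩ := a
  refine Submodule.span_induction (p := fun a ha => p ⟨a, ha⟩)
    (fun a ha => key 0 a ha rfl (Mono.mem ha)) ?_ ?_ ?_ ha
  · have h0 := hR 0
    have e : (rZero 0 : zero W₀ W₁) = ⟨0, zero_mem _⟩ := Subtype.ext (map_zero (ιR W₀ W₁))
    rwa [e] at h0
  · exact fun a b ha hb iha ihb => hadd ⟨a, ha⟩ ⟨b, hb⟩ iha ihb
  · intro k a ha iha
    -- Stability under scalars is not assumed: `k` acts as multiplication by its image in `R`.
    have h0 := hmul _ ⟨a, ha⟩ (hR (algebraMap K R k)) iha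
    have e : (rZero (algebraMap K R k) : zero W₀ W₁) * ⟨a, ha⟩ =
        ⟨k • a, Submodule.smul_mem _ k ha⟩ := Subtype.ext (by
      change ιR W₀ W₁ (algebraMap K R k) * a = k • a
      rw [AlgHom.commutes, Algebra.smul_def])
    rwa [e] at h0

/-- In a product of degree one, one factor has degree one and the other degree zero, so `W₁`
generates `T_1` as a `T_0`-bimodule. -/
lemma one_induction {p : gr W₀ W₁ 1 → Prop} (hW : ∀ w, p (wOne w))
    (hadd : ∀ v w, p v → p w → p (v + w)) (hl : ∀ a v, p v → p (lmul a v))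
    (hr : ∀ v a, p v → p (rmul v a)) (v : gr W₀ W₁ 1) : p v := by
  have key : ∀ n x, Mono W₀ W₁ n x → n = 1 → ∀ h : x ∈ gr W₀ W₁ 1, p ⟨x, h⟩ := by
    intro n x hx
    induction hx with
    | ofR r => intro h; omega
    | ofW₀ w => intro h; omega
    | ofW₁ w => exact fun _ _ => hW w
    | @mul m n a b ha hb iha ihb =>
      intro h _
      have h3 : (m = 0 ∧ n = 1) ∨ (m = 1 ∧ n = 0) := by omega
      rcases h3 with ⟨rfl, rfl⟩ | ⟨rfl, rfl⟩
      · exact hl ⟨a, ha.mem⟩ ⟨b, hb.mem⟩ (ihb rfl hb.mem)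
      · exact hr ⟨a, ha.mem⟩ ⟨b, hb.mem⟩ (iha rfl ha.mem)
  obtain ⟨v, hv⟩ := v
  refine Submodule.span_induction (p := fun a ha => p ⟨a, ha⟩)
    (fun a ha => key 1 a ha rfl (Mono.mem ha)) ?_ ?_ ?_ hv
  · have h0 := hW 0
    rwa [map_zero] at h0
  · exact fun a b ha hb iha ihb => hadd ⟨a, ha⟩ ⟨b, hb⟩ iha ihb
  · intro k a ha iha
    have h0 := hl (rZero (algebraMap K R k)) ⟨a, ha⟩ iha
    have e : lmul (rZero (algebraMap K R k)) ⟨a, ha⟩ =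
        (⟨k • a, Submodule.smul_mem _ k ha⟩ : gr W₀ W₁ 1) := Subtype.ext (by
      change ιR W₀ W₁ (algebraMap K R k) * a = k • a
      rw [AlgHom.commutes, Algebra.smul_def])
    rwa [e] at h0

variable (W₀ W₁) in
/-- The homomorphism `R → T_R(W)_0`. -/
def rZeroHom : R →ₐ[K] zero W₀ W₁ where
  toFun := rZero
  map_one' := Subtype.ext (map_one _)
  map_zero' := Subtype.ext (map_zero _)
  map_mul' _ _ := Subtype.ext (map_mul _ _ _)
  map_add' _ _ := Subtype.ext (map_add _ _ _)
  commutes' k := Subtype.ext ((ιR W₀ W₁).commutes k)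

variable (W₀ W₁) in
/-- The inclusion `W₀ → T_R(W)_0`. -/
def wZeroHom : W₀ →ₗ[K] zero W₀ W₁ where
  toFun := wZero
  map_add' v w := Subtype.ext (map_add (ιW W₀ W₁ ∘ₗ LinearMap.inl K W₀ W₁) v w)
  map_smul' k w := Subtype.ext (map_smul (ιW W₀ W₁ ∘ₗ LinearMap.inl K W₀ W₁) k w)

lemma wZero_smul (r : R) (w : W₀) : (wZero (r • w) : zero W₀ W₁) = rZero r * wZero w :=
  Subtype.ext (by
    have h : ((r • w, 0) : W₀ × W₁) = r • (w, 0) := Prod.ext rfl (smul_zero r).symm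
    exact (congrArg (ιW W₀ W₁) h).trans (ιW_left W₀ W₁ r (w, 0)))

lemma wZero_op_smul (r : R) (w : W₀) :
    (wZero (op r • w) : zero W₀ W₁) = wZero w * rZero r :=
  Subtype.ext (by
    have h : ((op r • w, 0) : W₀ × W₁) = op r • (w, 0) := Prod.ext rfl (smul_zero (op r)).symm
    exact (congrArg (ιW W₀ W₁) h).trans (ιW_right W₀ W₁ r (w, 0)))

lemma wOne_smul (r : R) (w : W₁) : (wOne (r • w) : gr W₀ W₁ 1) = lmul (rZero r) (wOne w) :=
  Subtype.ext (by
    have h : ((0, r • w) : W₀ × W₁) = r • (0, w) := Prod.ext (smul_zero r).symm rfl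
    exact (congrArg (ιW W₀ W₁) h).trans (ιW_left W₀ W₁ r (0, w)))

lemma wOne_op_smul (r : R) (w : W₁) :
    (wOne (op r • w) : gr W₀ W₁ 1) = rmul (wOne w) (rZero r) :=
  Subtype.ext (by
    have h : ((0, op r • w) : W₀ × W₁) = op r • (0, w) := Prod.ext (smul_zero (op r)).symm rfl
    exact (congrArg (ιW W₀ W₁) h).trans (ιW_right W₀ W₁ r (0, w)))

end T

namespace RightMod

section ofGen

variable (W₁) (X : RightMod K R) (g : W₀ →ₗ[K] Module.End K X)
  (hl : ∀ (r : R) w x, g (r • w) x = g w (X.act r x))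
  (hr : ∀ (r : R) w x, g (op r • w) x = X.act r (g w x))

/-- The right `T_R(W)_0`-module given by a right `R`-module and the action of `W₀`. -/
def ofGen : RightMod K (T.zero W₀ W₁) where
  carrier := X
  -- The universal property concerns the whole tensor algebra, so `W₁` is made to act as zero before
  -- restricting to degree zero.
  ρ := (T.lift X.ρ ((opLinearEquiv K).toLinearMap ∘ₗ g ∘ₗ LinearMap.fst K W₀ W₁)
    (fun r w => unop_injective (LinearMap.ext fun x => hl r w.1 x))
    (fun r w => unop_injective (LinearMap.ext fun x => hr r w.1 x))).comp (T.zero W₀ W₁).val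

lemma ofGen_rZero (r : R) (x : X) : (ofGen W₁ X g hl hr).act (T.rZero r) x = X.act r x :=
  congrArg (fun f : (Module.End K X)ᵐᵒᵖ => unop f x) (T.lift_ιR X.ρ
    ((opLinearEquiv K).toLinearMap ∘ₗ g ∘ₗ LinearMap.fst K W₀ W₁) _ _ r)

lemma ofGen_wZero (w : W₀) (x : X) : (ofGen W₁ X g hl hr).act (T.wZero w) x = g w x :=
  congrArg (fun f : (Module.End K X)ᵐᵒᵖ => unop f x) (T.lift_ιW X.ρ
    ((opLinearEquiv K).toLinearMap ∘ₗ g ∘ₗ LinearMap.fst K W₀ W₁) _ _ (w, 0))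

end ofGen

lemma act_comm_of_gen {M N : RightMod K (T.zero W₀ W₁)} (e : M →ₗ[K] N)
    (hR : ∀ r m, e (M.act (T.rZero r) m) = N.act (T.rZero r) (e m))
    (hW : ∀ w m, e (M.act (T.wZero w) m) = N.act (T.wZero w) (e m)) (a : T.zero W₀ W₁) (m : M) :
    e (M.act a m) = N.act a (e m) := by
  induction a using T.zero_induction generalizing m with
  | hR r => exact hR r m
  | hW w => exact hW w m
  | hadd a b ha hb => simp only [map_add, LinearMap.add_apply, ha, hb]
  | hmul a b ha hb => rw [act_mul, act_mul, hb, ha]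

end RightMod

namespace BMap

variable {M N : RightMod K (T.zero W₀ W₁)}

/-- `W₁` generates `T_1` as a bimodule, and both maps respect the two actions of `T_0`. -/
lemma ext_gen {f g : BMap M N} (h : ∀ w m, f.toFun (T.wOne w) m = g.toFun (T.wOne w) m) :
    f = g := by
  refine BMap.ext (LinearMap.ext fun v => LinearMap.ext ?_)
  induction v using T.one_induction with
  | hW w => exact h w
  | hadd v w hv hw => intro m; simp only [map_add, LinearMap.add_apply, hv, hw]
  | hl a v hv => intro m; rw [f.left, g.left, hv]
  | hr v a hv => intro m; rw [f.right, g.right, hv]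

section ofGen

variable (g : W₁ →ₗ[K] (M →ₗ[K] N))
  (hl : ∀ (r : R) w m, g (r • w) m = g w (M.act (T.rZero r) m))
  (hr : ∀ (r : R) w m, g (op r • w) m = N.act (T.rZero r) (g w m))

variable (M N) in
/-- The right `R`-module `M × N`. -/
def sumR : R →ₐ[K] (Module.End K (M × N))ᵐᵒᵖ :=
  AlgHom.ofLinearMap ((opLinearEquiv K).toLinearMap ∘ₗ
    { toFun := fun r => LinearMap.prodMap (M.act (T.rZeroHom W₀ W₁ r)) (N.act (T.rZeroHom W₀ W₁ r))
      map_add' := fun r s => by simp only [map_add]; rfl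
      map_smul' := fun k r => by simp only [map_smul]; rfl })
    (unop_injective (LinearMap.ext fun x => by
      change (M.act (T.rZeroHom W₀ W₁ 1) x.1, N.act (T.rZeroHom W₀ W₁ 1) x.2) = x
      rw [map_one, RightMod.act_one, RightMod.act_one]))
    (fun r s => unop_injective (LinearMap.ext fun x => by
      change (M.act (T.rZeroHom W₀ W₁ (r * s)) x.1, N.act (T.rZeroHom W₀ W₁ (r * s)) x.2) = _
      rw [map_mul, RightMod.act_mul, RightMod.act_mul]
      rfl))

/-- The action of `W` on `M × N`, with `W₁` acting by `g`. -/
def sumW : (W₀ × W₁) →ₗ[K] Module.End K (M × N) where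
  toFun w := LinearMap.prodMap (M.act (T.wZeroHom W₀ W₁ w.1)) (N.act (T.wZeroHom W₀ W₁ w.1)) +
    LinearMap.inr K M N ∘ₗ g w.2 ∘ₗ LinearMap.fst K M N
  map_add' v w := by
    refine LinearMap.ext fun x => Prod.ext ?_ ?_ <;> simp
    abel
  map_smul' k w := by
    refine LinearMap.ext fun x => Prod.ext ?_ ?_ <;> simp

/-- The right `T_R(W)`-module `M × N`, with `W₁` acting by `g`. -/
def sumρ : T W₀ W₁ →ₐ[K] (Module.End K (M × N))ᵐᵒᵖ :=
  T.lift (sumR M N) ((opLinearEquiv K).toLinearMap ∘ₗ sumW g)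
    (fun r w => unop_injective (LinearMap.ext fun x => by
      refine Prod.ext ?_ ?_
      · change M.act (T.wZero (r • w.1)) x.1 + 0 =
          M.act (T.wZero w.1) (M.act (T.rZero r) x.1) + 0
        rw [T.wZero_smul, RightMod.act_mul]
      · change N.act (T.wZero (r • w.1)) x.2 + g (r • w.2) x.1 =
          N.act (T.wZero w.1) (N.act (T.rZero r) x.2) + g w.2 (M.act (T.rZero r) x.1)
        rw [T.wZero_smul, RightMod.act_mul, hl]))
    (fun r w => unop_injective (LinearMap.ext fun x => by
      refine Prod.ext ?_ ?_
      · change M.act (T.wZero (op r • w.1)) x.1 + 0 =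
          M.act (T.rZero r) (M.act (T.wZero w.1) x.1 + 0)
        rw [T.wZero_op_smul, RightMod.act_mul, add_zero, add_zero]
      · change N.act (T.wZero (op r • w.1)) x.2 + g (op r • w.2) x.1 =
          N.act (T.rZero r) (N.act (T.wZero w.1) x.2 + g w.2 x.1)
        rw [T.wZero_op_smul, RightMod.act_mul, hr, map_add]))

/-- The map `g` enters only through `W₁`, so degree zero acts on `M × N` diagonally. This makes the
off-diagonal block of the action of `T_1` a bimodule map. -/
lemma sumρ_zero (a : T.zero W₀ W₁) (x : M × N) :
    unop (sumρ g hl hr a.1) x = (M.act a x.1, N.act a x.2) := by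
  induction a using T.zero_induction generalizing x with
  | hR r =>
    exact congrArg (fun f : (Module.End K (M × N))ᵐᵒᵖ => unop f x) (T.lift_ιR (sumR M N) _ _ _ r)
  | hW w =>
    refine (congrArg (fun f : (Module.End K (M × N))ᵐᵒᵖ => unop f x) (T.lift_ιW (sumR M N)
      ((opLinearEquiv K).toLinearMap ∘ₗ sumW g) _ _ (w, 0))).trans (Prod.ext ?_ ?_)
    · exact add_zero _
    · change N.act (T.wZero w) x.2 + g 0 x.1 = _
      rw [map_zero, LinearMap.zero_apply, add_zero]
  | hadd a b ha hb =>
    change unop (sumρ g hl hr (a.1 + b.1)) x = _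
    rw [map_add, MulOpposite.unop_add, LinearMap.add_apply, ha, hb, map_add, map_add]
    rfl
  | hmul a b ha hb =>
    change unop (sumρ g hl hr (a.1 * b.1)) x = _
    rw [map_mul, unop_mul, Module.End.mul_apply, ha, hb, RightMod.act_mul, RightMod.act_mul]

/-- The morphism of `T_0`-bimodules `T_1 → Hom_K(M, N)` given by its restriction to `W₁`. -/
def ofGen : BMap M N where
  toFun :=
    -- The value at `v` is the block `M → N` of the action of `v` on `M × N`.
    { toFun := fun v => LinearMap.snd K M N ∘ₗ unop (sumρ g hl hr v.1) ∘ₗ LinearMap.inl K M N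
      map_add' := fun v w => by
        rw [Submodule.coe_add, map_add]; rfl
      map_smul' := fun k v => by
        rw [Submodule.coe_smul, map_smul]; rfl }
  left a v m := by
    change (unop (sumρ g hl hr (a.1 * v.1)) (m, 0)).2 = (unop (sumρ g hl hr v.1) (M.act a m, 0)).2
    rw [map_mul, unop_mul, Module.End.mul_apply, sumρ_zero, map_zero]
  right v a m := by
    change (unop (sumρ g hl hr (v.1 * a.1)) (m, 0)).2 =
      N.act a (unop (sumρ g hl hr v.1) (m, 0)).2
    rw [map_mul, unop_mul, Module.End.mul_apply, sumρ_zero]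

lemma ofGen_wOne (w : W₁) (m : M) : (ofGen g hl hr).toFun (T.wOne w) m = g w m := by
  refine (congrArg (fun f : (Module.End K (M × N))ᵐᵒᵖ => (unop f (m, 0)).2) (T.lift_ιW (sumR M N)
      ((opLinearEquiv K).toLinearMap ∘ₗ sumW g) _ _ (0, w))).trans ?_
  change N.act (T.wZeroHom W₀ W₁ 0) 0 + g w m = _
  rw [map_zero, zero_add]

end ofGen

end BMap

end Generators

namespace Ditalgebra.Mod

variable {K : Type u} [Field K] {𝒜 : Ditalgebra K} {M N : 𝒜.Mod}

/-- By the Leibniz rule `d(ab) = d(a) b + a d(b)` in degree zero, the set of `a` satisfying the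
identity is closed under products. It contains `R` because `d` vanishes there, so only `W₀` has to
be checked. -/
lemma Hom.map_act_of_gen (f₀ : M.mod →ₗ[K] N.mod) (f₁ : BMap M.mod N.mod)
    (hR : ∀ (r : 𝒜.R) m, f₀ (M.mod.act (T.rZero r) m) = N.mod.act (T.rZero r) (f₀ m))
    (hW : ∀ (w : 𝒜.W₀) m, N.mod.act (T.wZero w) (f₀ m) =
      f₀ (M.mod.act (T.wZero w) m) + f₁.toFun (𝒜.d₀ (T.wZero w)) m)
    (a : 𝒜.T₀) (m : M.mod) :
    N.mod.act a (f₀ m) = f₀ (M.mod.act a m) + f₁.toFun (𝒜.d₀ a) m := by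
  induction a using T.zero_induction generalizing m with
  | hR r =>
    have h : 𝒜.d₀ (T.rZero r) = 0 := Subtype.ext (𝒜.d_R r)
    rw [h, hR, map_zero, LinearMap.zero_apply, add_zero]
  | hW w => exact hW w m
  | hadd a b ha hb =>
    simp only [map_add, LinearMap.add_apply, ha, hb]
    abel
  | hmul a b ha hb =>
    have h : 𝒜.d₀ (a * b) = T.rmul (𝒜.d₀ a) b + T.lmul a (𝒜.d₀ b) := Subtype.ext (by
      have := 𝒜.d_mul 0 0 a.1 b.1 a.2 b.2
      rw [pow_zero, one_mul] at this
      exact this)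
    rw [RightMod.act_mul, RightMod.act_mul, ha, map_add, hb, h, map_add, LinearMap.add_apply,
      f₁.left, f₁.right]
    abel

/-- A morphism of `Mod 𝒜` given on generators. -/
def Hom.ofGen (f₀ : M.mod →ₗ[K] N.mod) (f₁ : BMap M.mod N.mod)
    (hR : ∀ (r : 𝒜.R) m, f₀ (M.mod.act (T.rZero r) m) = N.mod.act (T.rZero r) (f₀ m))
    (hW : ∀ (w : 𝒜.W₀) m, N.mod.act (T.wZero w) (f₀ m) =
      f₀ (M.mod.act (T.wZero w) m) + f₁.toFun (𝒜.d₀ (T.wZero w)) m) : Hom M N :=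
  ⟨f₀, f₁, hR, Hom.map_act_of_gen f₀ f₁ hR hW⟩

/-- The morphism `(f, 0)` given by a homomorphism of right `T_0`-modules. -/
def Hom.strict (f : M.mod →ₗ[K] N.mod) (h : ∀ a m, f (M.mod.act a m) = N.mod.act a (f m)) :
    Hom M N where
  f₀ := f
  f₁ := ⟨0, fun _ _ _ => rfl, fun _ _ _ => (map_zero _).symm⟩
  map_R r m := h _ m
  map_act a m := by
    rw [h]
    exact (add_zero _).symm

lemma Hom.strict_comp {L : 𝒜.Mod} (f : M.mod →ₗ[K] N.mod) (hf) (g : N.mod →ₗ[K] L.mod) (hg) :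
    Hom.comp (Hom.strict f hf) (Hom.strict g hg) =
      Hom.strict (g ∘ₗ f) (fun a m => (congrArg g (hf a m)).trans (hg a _)) := by
  refine Hom.ext' (fun m => rfl) (fun v m => ?_)
  rw [Hom.comp_f₁, BMap.comp_zero_left _ rfl (𝒜.d_gr 1 _ v.2)]
  simp [Hom.strict]

/-- An isomorphism of right `T_0`-modules is an isomorphism in `Mod 𝒜`. -/
def isoOfEquiv (e : M.mod ≃ₗ[K] N.mod) (h : ∀ a m, e (M.mod.act a m) = N.mod.act a (e m)) :
    M ≅ N where
  hom := Hom.strict e.toLinearMap h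
  inv := Hom.strict e.symm.toLinearMap (fun a m => e.injective (by
    change e (e.symm _) = e (M.mod.act a (e.symm m))
    rw [h, e.apply_symm_apply, e.apply_symm_apply]))
  hom_inv_id := (Hom.strict_comp _ _ _ _).trans
    (Hom.ext' (fun m => e.symm_apply_apply m) (fun _ _ => rfl))
  inv_hom_id := (Hom.strict_comp _ _ _ _).trans
    (Hom.ext' (fun m => e.apply_symm_apply m) (fun _ _ => rfl))

end Ditalgebra.Mod

/-! ## Restriction along the reduction by a central idempotent -/

namespace Ditalgebra

variable {K : Type u} [Field K] (𝒜 : Ditalgebra K) (c : CIdem 𝒜.R)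

lemma ηZero_rZero (r : 𝒜.R) : 𝒜.ηZero c (T.rZero r) = T.rZero (c.π r) := Subtype.ext (c.η_ιR r)

lemma ηZero_wZero (w : 𝒜.W₀) : 𝒜.ηZero c (T.wZero w) = T.wZero (c.πW _ w) :=
  Subtype.ext ((c.η_ιW (w, 0)).trans (congrArg (T.ιW _ _) (Prod.ext rfl (map_zero _))))

lemma ηOne_wOne (w : 𝒜.W₁) : 𝒜.ηOne c (T.wOne w) = T.wOne (c.πW _ w) :=
  Subtype.ext ((c.η_ιW (0, w)).trans (congrArg (T.ιW _ _) (Prod.ext (map_zero _) rfl)))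

lemma resHom_wOne {M N : (𝒜.reduce c).Mod} (f : Mod.Hom M N) (w : 𝒜.W₁) (m : M.mod) :
    (resHom c f).f₁.toFun (T.wOne w) m = f.f₁.toFun (T.wOne (c.πW _ w)) m :=
  congrArg (fun v => f.f₁.toFun v m) (𝒜.ηOne_wOne c w)

/-- Restriction keeps `f⁰`, and every generator of degree one of the reduced ditalgebra is the image
of an element of `W₁`. -/
instance F_faithful : (𝒜.F c).Faithful where
  map_injective {M N} f g h := by
    have h : resHom c f = resHom c g := h
    refine Mod.Hom.ext (congrArg (fun f : Mod.Hom ((𝒜.F c).obj M) ((𝒜.F c).obj N) => f.f₀) h) (BMap.ext_gen fun w m => ?_)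
    have h1 := resHom_wOne 𝒜 c f (c.incl _ w) m
    have h2 := resHom_wOne 𝒜 c g (c.incl _ w) m
    rw [c.πW_incl] at h1 h2
    rw [← h1, ← h2]
    exact congrArg (fun f : Mod.Hom ((𝒜.F c).obj M) ((𝒜.F c).obj N) =>
      f.f₁.toFun (T.wOne (c.incl _ w)) m) h

/-- The image of `e` under `η` is the unit of `e R e`. -/
lemma F_act_e (M : (𝒜.reduce c).Mod) (m : M.mod) :
    ((𝒜.F c).obj M).mod.act (T.rZero c.e) m = m := by
  change M.mod.act (𝒜.ηZero c (T.rZero c.e)) m = m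
  have h : (T.rZero 1 : (𝒜.reduce c).T₀) = 1 := (T.rZeroHom _ _).map_one
  rw [ηZero_rZero, show c.π c.e = 1 from c.π_val 1]
  exact (congrArg (fun a => M.mod.act a m) h).trans (M.mod.act_one m)

-- When `e` is the identity on both modules, a bimodule map cannot distinguish `w` from `e w e`:
-- each `e` moves out to one of the modules.
variable {𝒜 c} in
lemma toFun_wOne_πW {M N : RightMod K 𝒜.T₀} (hM : ∀ m, M.act (T.rZero c.e) m = m)
    (hN : ∀ m, N.act (T.rZero c.e) m = m) (f : BMap M N) (w : 𝒜.W₁) (m : M) :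
    f.toFun (T.wOne (c.incl _ (c.πW _ w))) m = f.toFun (T.wOne w) m := by
  rw [c.incl_πW, T.wOne_smul, T.wOne_op_smul, f.left, f.right, hM, hN]

/-- A preimage of `f` has the same `f⁰`, and its `f¹` is the one generated by the restriction to `e
W₁ e`. Nothing is lost by `toFun_wOne_πW`. -/
instance F_full : (𝒜.F c).Full where
  map_surjective {M N} f := by
    let f' : Mod.Hom ((𝒜.F c).obj M) ((𝒜.F c).obj N) := f
    have hact : ∀ (L : (𝒜.reduce c).Mod) (x : c.Crn) (m : L.mod),
        L.mod.act (T.rZero x) m = ((𝒜.F c).obj L).mod.act (T.rZero (c.val x)) m := by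
      intro L x m
      refine congrArg (fun a => L.mod.act a m) ?_
      exact ((𝒜.ηZero_rZero c _).trans (congrArg T.rZero (c.π_val x))).symm
    let f₁ : BMap M.mod N.mod := BMap.ofGen
      (f'.f₁.toFun ∘ₗ T.wOne ∘ₗ c.incl 𝒜.W₁)
      (fun x w m => by
        rw [hact]
        change f'.f₁.toFun (T.wOne (c.incl _ (x • w))) m = _
        rw [c.incl_smul, T.wOne_smul]
        exact f'.f₁.left _ _ m)
      (fun x w m => by
        rw [hact]
        change f'.f₁.toFun (T.wOne (c.incl _ (op x • w))) m = _
        rw [c.incl_op_smul, T.wOne_op_smul]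
        exact f'.f₁.right _ _ m)
    have h₁ : Mod.resBMap c f₁ = f'.f₁ := BMap.ext_gen fun w m => by
      refine (congrArg (fun v => f₁.toFun v m) (𝒜.ηOne_wOne c w)).trans ?_
      refine (BMap.ofGen_wOne _ _ _ _ _).trans ?_
      exact toFun_wOne_πW (𝒜.F_act_e c M) (𝒜.F_act_e c N) f'.f₁ w m
    refine ⟨Mod.Hom.ofGen (M := M) (N := N) f'.f₀ f₁ (fun x m => ?_) (fun w m => ?_), ?_⟩
    · exact (congrArg f'.f₀ (hact M x m)).trans ((f'.map_R _ m).trans (hact N x _).symm)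
    -- The compatibility on `e W₀ e` is that of `f` at the same element of `W₀`, transported by `d_e
    -- η = η d`.
    · have h := f'.map_act (T.wZero (c.incl _ w)) m
      rw [← h₁] at h
      have h2 : 𝒜.ηOne c (𝒜.d₀ (T.wZero (c.incl _ w))) =
          (𝒜.reduce c).d₀ (𝒜.ηZero c (T.wZero (c.incl _ w))) :=
        Subtype.ext (𝒜.d_ηT c _).symm
      have h3 : 𝒜.ηZero c (T.wZero (c.incl _ w)) = T.wZero w := by
        rw [ηZero_wZero, c.πW_incl]
      rw [← h3, ← h2]
      exact h
    · exact Mod.Hom.ext rfl h₁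

section reduceMod

variable {𝒜 c} (M : RightMod K 𝒜.T₀) (hM : ∀ m, M.act (T.rZero c.e) m = m)

/-- A right `T_0`-module on which `e` acts as the identity, as a module over `e R e`. -/
def cornerMod : RightMod K c.Crn := RightMod.ofAct M
  { toFun := fun x => M.act (T.rZeroHom 𝒜.W₀ 𝒜.W₁ (c.val x))
    map_add' := fun x y => by rw [c.val_add, map_add, map_add]
    map_smul' := fun k x => LinearMap.ext fun m => by
      rw [Algebra.smul_def, c.val_mul, c.val_algebraMap, map_mul, map_smul, RightMod.act_mul,
        map_smul]
      change M.act (T.rZeroHom _ _ (c.val x)) (k • M.act (T.rZero c.e) m) = _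
      rw [hM, map_smul]
      rfl }
  (LinearMap.ext hM)
  (fun x y => LinearMap.ext fun m => by
    have h : T.rZeroHom 𝒜.W₀ 𝒜.W₁ (c.val (x * y)) =
        T.rZeroHom 𝒜.W₀ 𝒜.W₁ (c.val x) * T.rZeroHom 𝒜.W₀ 𝒜.W₁ (c.val y) :=
      map_mul (T.rZeroHom 𝒜.W₀ 𝒜.W₁) (c.val x) (c.val y)
    exact (congrArg (fun a => M.act a m) h).trans (M.act_mul _ _ m))

/-- A right `T_0`-module on which `e` acts as the identity, as a module over the reduction. -/
def reduceMod : RightMod K (𝒜.reduce c).T₀ :=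
  RightMod.ofGen (c.bimod 𝒜.W₁) (cornerMod M hM)
    (M.act ∘ₗ T.wZeroHom 𝒜.W₀ 𝒜.W₁ ∘ₗ c.incl 𝒜.W₀)
    (fun x w m => by
      change M.act (T.wZero (c.incl _ (x • w))) m = _
      rw [c.incl_smul, T.wZero_smul]
      exact M.act_mul _ _ m)
    (fun x w m => by
      change M.act (T.wZero (c.incl _ (op x • w))) m = _
      rw [c.incl_op_smul, T.wZero_op_smul]
      exact M.act_mul _ _ m)

/-- On generators, `r` acts as `e r e` and `w` as `e w e`, because `e` acts as the identity. -/
lemma reduceMod_act (a : 𝒜.T₀) (m : M) :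
    (reduceMod M hM).act (𝒜.ηZero c a) m = M.act a m := by
  refine RightMod.act_comm_of_gen (M := (reduceMod M hM).restrict (𝒜.ηZero c)) (N := M)
    (LinearMap.id : M →ₗ[K] M) (fun r m => ?_) (fun w m => ?_) a m
  · refine (congrArg (fun a => (reduceMod M hM).act a m) (𝒜.ηZero_rZero c r)).trans
      ((RightMod.ofGen_rZero _ _ _ _ _ _ _).trans ?_)
    have h (m : M) : M.act (T.rZeroHom _ _ (c.val (c.π r))) m = M.act (T.rZero r) m := by
      rw [c.val_π, map_mul, RightMod.act_mul]
      exact congrArg _ (hM m)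
    exact h m
  · refine (congrArg (fun a => (reduceMod M hM).act a m) (𝒜.ηZero_wZero c w)).trans
      ((RightMod.ofGen_wZero _ _ _ _ _ _ _).trans ?_)
    have h (m : M) : M.act (T.wZero (c.incl _ (c.πW _ w))) m = M.act (T.wZero w) m := by
      rw [c.incl_πW, T.wZero_smul, T.wZero_op_smul, RightMod.act_mul, RightMod.act_mul, hM, hM]
    exact h m

end reduceMod

-- This is the converse of `F_act_e` up to isomorphism. The underlying space is unchanged, so the
-- identity map provides the isomorphism.
variable {𝒜 c} in
lemma exists_F_iso (M : 𝒜.Mod) (hM : ∀ m, M.mod.act (T.rZero c.e) m = m) :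
    ∃ N, Nonempty ((𝒜.F c).obj N ≅ M) :=
  ⟨⟨reduceMod M.mod hM⟩, ⟨Mod.isoOfEquiv (M := (𝒜.F c).obj ⟨reduceMod M.mod hM⟩) (N := M)
    (LinearEquiv.refl K M.mod) (reduceMod_act M.mod hM)⟩⟩

end Ditalgebra

/-! ## The decomposition `Λ = S ⊕ J` -/

section Parts

variable {K : Type u} [Field K] {Λ : Type u} [Ring Λ] [Algebra K Λ]
variable {S : Subalgebra K Λ} {J : Ideal Λ}
  (hc : IsCompl (Subalgebra.toSubmodule S) (J.restrictScalars K))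

include hc in
lemma exists_parts (a : Λ) : ∃ p : S × J, (p.1 : Λ) + p.2 = a := by
  have h : a ∈ Subalgebra.toSubmodule S ⊔ J.restrictScalars K := by
    rw [hc.sup_eq_top]; exact Submodule.mem_top
  obtain ⟨s, hs, x, hx, rfl⟩ := Submodule.mem_sup.1 h
  exact ⟨(⟨s, hs⟩, ⟨x, hx⟩), rfl⟩

/-- The component of an element of `Λ = S ⊕ J` in `S`. -/
def sPart (a : Λ) : S := (exists_parts hc a).choose.1

/-- The component of an element of `Λ = S ⊕ J` in `J`. -/
def jPart (a : Λ) : J := (exists_parts hc a).choose.2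

lemma parts_add (a : Λ) : (sPart hc a : Λ) + jPart hc a = a := (exists_parts hc a).choose_spec

/-- The difference of two decompositions lies in `S ∩ J = 0`. -/
lemma parts_eq {a : Λ} {s : S} {x : J} (h : a = (s : Λ) + x) :
    sPart hc a = s ∧ jPart hc a = x := by
  have h1 : (sPart hc a : Λ) + jPart hc a = (s : Λ) + x := (parts_add hc a).trans h
  have h2 : ((sPart hc a - s : S) : Λ) = ((x - jPart hc a : J) : Λ) := by
    push_cast
    rw [sub_eq_sub_iff_add_eq_add, h1, add_comm]
  have h3 : ((sPart hc a - s : S) : Λ) = 0 :=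
    Submodule.disjoint_def.1 hc.disjoint _ (sPart hc a - s).2
      (by rw [h2]; exact (x - jPart hc a).2)
  refine ⟨sub_eq_zero.1 (Subtype.ext h3), (sub_eq_zero.1 (Subtype.ext ?_)).symm⟩
  rw [← h2, h3]
  rfl

lemma sPart_coe (s : S) : sPart hc s = s := (parts_eq hc (s := s) (x := 0) (by simp)).1
lemma jPart_coe (s : S) : jPart hc s = 0 := (parts_eq hc (s := s) (x := 0) (by simp)).2
lemma sPart_mem (x : J) : sPart hc (x : Λ) = 0 := (parts_eq hc (s := 0) (x := x) (by simp)).1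
lemma jPart_mem (x : J) : jPart hc (x : Λ) = x := (parts_eq hc (s := 0) (x := x) (by simp)).2

lemma parts_map_add (a b : Λ) : sPart hc (a + b) = sPart hc a + sPart hc b ∧
    jPart hc (a + b) = jPart hc a + jPart hc b := by
  refine parts_eq hc ?_
  conv_lhs => rw [← parts_add hc a, ← parts_add hc b]
  push_cast
  abel

lemma sPart_add (a b : Λ) : sPart hc (a + b) = sPart hc a + sPart hc b :=
  (parts_map_add hc a b).1
lemma jPart_add (a b : Λ) : jPart hc (a + b) = jPart hc a + jPart hc b :=
  (parts_map_add hc a b).2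

lemma sPart_one : sPart hc 1 = 1 := sPart_coe hc 1
lemma jPart_one : jPart hc 1 = 0 := jPart_coe hc 1

lemma jPart_smul (s : S) (a : Λ) : jPart hc (s * a) = s • jPart hc a := by
  refine (parts_eq hc (s := s * sPart hc a) ?_).2
  conv_lhs => rw [← parts_add hc a, mul_add]
  rfl

variable [J.IsTwoSided]

lemma jPart_mul (a : Λ) (s : S) : jPart hc (a * s) = Dual.jmul (jPart hc a) s := by
  refine (parts_eq hc (s := sPart hc a * s) ?_).2
  conv_lhs => rw [← parts_add hc a, add_mul]
  rfl

/-- All terms of the product with a factor in `J` stay in the two-sided ideal `J`; the projection is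
`Λ → Λ/J ≅ S`. -/
lemma sPart_mul (a b : Λ) : sPart hc (a * b) = sPart hc a * sPart hc b := by
  have h : (sPart hc a : Λ) * jPart hc b + jPart hc a * b ∈ J :=
    add_mem (J.mul_mem_left _ (jPart hc b).2) (J.mul_mem_right _ (jPart hc a).2)
  refine (parts_eq hc (x := ⟨_, h⟩) ?_).1
  change a * b = (sPart hc a : Λ) * sPart hc b + ((sPart hc a : Λ) * jPart hc b + jPart hc a * b)
  rw [← add_assoc, ← mul_add, parts_add, ← add_mul, parts_add]

/-- The projection `Λ → S` as a homomorphism of the opposite rings. -/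
def sPartOp : Λᵐᵒᵖ →+* Sᵐᵒᵖ where
  toFun a := op (sPart hc a.unop)
  map_one' := congrArg op (sPart_one hc)
  map_mul' a b := congrArg op (sPart_mul hc b.unop a.unop)
  map_zero' := congrArg op (sPart_coe hc 0)
  map_add' a b := congrArg op (sPart_add hc a.unop b.unop)

lemma sPartOp_surjective : Function.Surjective (sPartOp hc) :=
  fun s => ⟨op (s.unop : Λ), congrArg op (sPart_coe hc s.unop)⟩

end Parts

/-! ## Maps out of `V ⊗_S Λ` -/

section TensMaps

variable {K : Type u} [Field K] {Λ : Type u} [Ring Λ] [Algebra K Λ]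
variable {S : Subalgebra K Λ} {J : Ideal Λ} [J.IsTwoSided] (B : DualBasis S J)

namespace RightMod

variable {R : Type u} [Ring R] [Algebra K R]

/-- A right module as a module over the opposite ring. -/
@[reducible] def opModule (V : RightMod K R) : Module Rᵐᵒᵖ V where
  smul a m := V.act a.unop m
  one_smul m := V.act_one m
  mul_smul a b m := V.act_mul b.unop a.unop m
  smul_zero _ := map_zero _
  smul_add _ _ _ := map_add _ _ _
  add_smul a b m := by
    change V.act (a.unop + b.unop) m = _
    rw [map_add]; rfl
  zero_smul m := by
    change V.act 0 m = 0
    rw [map_zero]; rfl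

end RightMod

namespace Tens

variable {V V' : RightMod K S}

section lift

variable {Y : Type u} [AddCommGroup Y] (F : Λ →+ V →+ Y)
  (hF : ∀ (s : S) a m, F a (V.act s m) = F (s * a) m)

/-- The additive map on `V ⊗_S Λ` given by a balanced biadditive map. -/
def lift : Tens V →+ Y :=
  QuotientAddGroup.lift (tensRel V).toAddSubgroup
    (TensorProduct.liftAddHom F fun k a m => by
      -- Balancing over `K` is the case of scalars in `S`.
      have h := hF (algebraMap K S k) a m
      rw [RightMod.act_algebraMap] at h
      rw [h, Algebra.smul_def]
      rfl)
    (by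
      intro z hz
      rw [AddMonoidHom.mem_ker]
      generalize_proofs hK
      -- The map is only additive, so its kernel is not known to be a `Λᵐᵒᵖ`-submodule. The
      -- vanishing on all multiples of `z` is the condition that survives passing to the span.
      have key : ∀ b : Λᵐᵒᵖ, TensorProduct.liftAddHom F hK (b • z) = 0 := by
        refine Submodule.span_induction ?_ ?_ ?_ ?_ hz
        · rintro _ ⟨s, a, m, rfl⟩ b
          rw [smul_sub, map_sub, TensorProduct.smul_tmul', TensorProduct.smul_tmul']
          refine sub_eq_zero.2 (Eq.trans ?_ (hF s (a * b.unop) m).symm)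
          exact congrArg (fun x => F x m) (mul_assoc _ _ _)
        · intro b
          rw [smul_zero, map_zero]
        · intro x y _ _ hx hy b
          rw [smul_add, map_add, hx, hy, add_zero]
        · intro c x _ hx b
          rw [← mul_smul, hx]
      have := key 1
      rwa [one_smul] at this)

end lift

lemma induction {p : Tens V → Prop} (hmk : ∀ m a, p (mk m a)) (hadd : ∀ x y, p x → p y → p (x + y))
    (x : Tens V) : p x := by
  obtain ⟨z, rfl⟩ := (tensRel V).mkQ_surjective x
  induction z using TensorProduct.induction_on with
  | zero => rw [map_zero, ← map_zero (tensRel V).mkQ, ← TensorProduct.zero_tmul Λ (0 : V)]; exact hmk 0 0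
  | tmul a m => exact hmk m a
  | add x y hx hy => rw [map_add]; exact hadd _ _ hx hy

lemma mk_eq_smul (m : V) (a : Λ) : mk m a = op a • mk m 1 := by
  rw [← mk_smul, one_mul]

/-- The homomorphism `m ⊗ a ↦ l(m) a` of right `Λ`-modules. -/
def extend {X : Type u} [AddCommGroup X] [Module Λᵐᵒᵖ X] (l : V →+ X)
    (hl : ∀ (s : S) m, l (V.act s m) = op (s : Λ) • l m) : Tens V →ₗ[Λᵐᵒᵖ] X :=
  let F : Tens V →+ X := lift
    (AddMonoidHom.mk' (fun a : Λ => AddMonoidHom.mk' (fun m : V => op a • l m)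
      (fun m m' => by rw [map_add, smul_add]))
      (fun a b => AddMonoidHom.ext fun m => add_smul (op a) (op b) (l m)))
    (fun s a m => by
      change op a • l (V.act s m) = op (s * a) • l m
      rw [hl, op_mul, mul_smul])
  { toFun := F
    map_add' := map_add F
    map_smul' := fun b x => by
      change F (b • x) = b • F x
      induction x using induction with
      | hmk m a => exact mul_smul b (op a) (l m)
      | hadd x y hx hy => rw [smul_add, map_add, hx, hy, map_add, smul_add] }

lemma extend_mk {X : Type u} [AddCommGroup X] [Module Λᵐᵒᵖ X] (l : V →+ X) (hl) (m : V) (a : Λ) :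
    extend l hl (mk m a) = op a • l m := rfl

variable (hc : IsCompl (Subalgebra.toSubmodule S) (J.restrictScalars K))

/-- The map `V ⊗_S Λ → V`, `m ⊗ a ↦ m s`, where `s` is the component of `a` in `S`. -/
def π : Tens V →+ V :=
  lift (AddMonoidHom.mk' (fun a : Λ => (V.act (sPart hc a)).toAddMonoidHom)
      (fun a b => AddMonoidHom.ext fun m => by
        change V.act (sPart hc (a + b)) m = V.act (sPart hc a) m + V.act (sPart hc b) m
        rw [sPart_add, map_add, LinearMap.add_apply]))
    (fun s a m => by
      change V.act (sPart hc a) (V.act s m) = V.act (sPart hc (s * a)) m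
      rw [sPart_mul, sPart_coe, RightMod.act_mul])

lemma π_mk (m : V) (a : Λ) : π hc (mk m a) = V.act (sPart hc a) m := rfl

lemma π_mk_one (m : V) : π hc (mk m 1) = m := by
  rw [π_mk, sPart_one, RightMod.act_one]

/-- `π` is a left inverse of `m ↦ m ⊗ 1`. -/
lemma mk_one_injective (hc : IsCompl (Subalgebra.toSubmodule S) (J.restrictScalars K)) {m : V}
    (h : mk m (1 : Λ) = 0) : m = 0 := by
  rw [← π_mk_one hc m, h, map_zero]

lemma π_smul (a : Λ) (x : Tens V) : π hc (op a • x) = V.act (sPart hc a) (π hc x) := by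
  induction x using induction with
  | hmk m b => rw [← mk_smul, π_mk, π_mk, sPart_mul, RightMod.act_mul]
  | hadd x y hx hy => rw [smul_add, map_add, hx, hy, map_add, map_add]

/-- The map `V ⊗_S Λ → V`, `m ⊗ a ↦ m γ(x)`, where `x` is the component of `a` in `J`. -/
def coef (γ : Dual S J) : Tens V →+ V :=
  lift (AddMonoidHom.mk' (fun a : Λ => (V.act (γ (jPart hc a))).toAddMonoidHom)
      (fun a b => AddMonoidHom.ext fun m => by
        change V.act (γ (jPart hc (a + b))) m =
          V.act (γ (jPart hc a)) m + V.act (γ (jPart hc b)) m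
        rw [jPart_add, Dual.apply_add, map_add, LinearMap.add_apply]))
    (fun s a m => by
      change V.act (γ (jPart hc a)) (V.act s m) = V.act (γ (jPart hc (s * a))) m
      rw [jPart_smul, Dual.apply_smul, RightMod.act_mul])

lemma coef_mk (γ : Dual S J) (m : V) (a : Λ) :
    coef hc γ (mk m a) = V.act (γ (jPart hc a)) m := rfl

lemma coef_mk_one (γ : Dual S J) (m : V) : coef hc γ (mk m 1) = 0 := by
  have h : γ (0 : J) = 0 := LinearMap.map_zero _
  rw [coef_mk, jPart_one, h, map_zero, LinearMap.zero_apply]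

lemma coef_left (s : S) (γ : Dual S J) (x : Tens V) :
    coef hc (s • γ) x = coef hc γ (op (s : Λ) • x) := by
  induction x using induction with
  | hmk m a => rw [← mk_smul, coef_mk, coef_mk, jPart_mul, Dual.smul_apply]
  | hadd x y hx hy => rw [map_add, smul_add, map_add, hx, hy]

lemma coef_right (s : S) (γ : Dual S J) (x : Tens V) :
    coef hc (op s • γ) x = V.act s (coef hc γ x) := by
  induction x using induction with
  | hmk m a => rw [coef_mk, coef_mk, Dual.op_smul_apply, RightMod.act_mul]
  | hadd x y hx hy => rw [map_add, map_add, hx, hy, map_add]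

lemma coef_add (γ γ' : Dual S J) (x : Tens V) :
    coef hc (γ + γ') x = coef hc γ x + coef hc γ' x := by
  induction x using induction with
  | hmk m a => rw [coef_mk, coef_mk, coef_mk, Dual.add_apply, map_add, LinearMap.add_apply]
  | hadd x y hx hy => rw [map_add, map_add, map_add, hx, hy]; abel

lemma coef_smul (k : K) (γ : Dual S J) (x : Tens V) : coef hc (k • γ) x = k • coef hc γ x := by
  induction x using induction with
  | hmk m a => rw [coef_mk, coef_mk, Dual.smul_K_apply, map_smul, LinearMap.smul_apply]
  | hadd x y hx hy => rw [map_add, map_add, hx, hy, smul_add]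

/-- For `x = m ⊗ a`, expand `a` as its part in `S` plus `∑ γ_i(y) p_i`, where `y` is its part in
`J`, and move the coefficients across the tensor sign. This is the decomposition of `V ⊗_S Λ` into
`V` and `V ⊗_S J` on which the description of homomorphisms rests. -/
lemma eq_sum (x : Tens V) :
    x = mk (π hc x) 1 + ∑ i, mk (coef hc (B.γ i) x) (B.p i : Λ) := by
  induction x using induction with
  | hmk m a =>
    simp only [π_mk, coef_mk, mk_act, mul_one]
    rw [← mk_sum_right, ← mk_add_right]
    congr 1
    conv_lhs => rw [← parts_add hc a, ← B.sum (jPart hc a)]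
    rw [AddSubmonoidClass.coe_finsetSum]
    rfl
  | hadd x y hx hy =>
    simp only [map_add, mk_add_left, Finset.sum_add_distrib]
    conv_lhs => rw [hx, hy]
    abel

end Tens

/-! ### Homomorphisms `V ⊗_S Λ → V' ⊗_S Λ` as pairs `(f, c)` -/

namespace CMap

variable {V V' V'' : RightMod K S}

lemma ext' {φ ψ : CMap S J V V'} (h : φ.f = ψ.f) (h' : φ.c = ψ.c) : φ = ψ := by
  cases φ; cases ψ; cases h; cases h'; rfl

variable (hc : IsCompl (Subalgebra.toSubmodule S) (J.restrictScalars K))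

/-- Apply `g` to `γ = ∑ γ_i γ(p_i)`. The `p_i` need not be independent, so coefficients cannot
simply be read off; this identity replaces comparison of coefficients. -/
lemma sum_act (g : Dual S J →ₗ[K] (V →ₗ[K] V'))
    (hg : ∀ (s : S) γ m, g (op s • γ) m = V'.act s (g γ m)) (γ : Dual S J) (m : V) :
    ∑ i, V'.act (γ (B.p i)) (g (B.γ i) m) = g γ m := by
  have h := B.sum_op_smul γ 1
  have h1 : γ.shift 1 = γ := Dual.ext fun x => congrArg γ (Dual.jmul_one x)
  simp only [Dual.jmul_one, h1] at h
  conv_rhs => rw [← h, map_sum, LinearMap.sum_apply]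
  exact Finset.sum_congr rfl fun i _ => (hg _ _ _).symm

lemma π_map (φ : CMap S J V V') (m : V) : Tens.π hc (φ.map B (Tens.mk m 1)) = φ.f m := by
  rw [map_mk, map_add, Tens.π_mk_one, map_sum, Finset.sum_eq_zero, add_zero]
  intro i _
  rw [mul_one, Tens.π_mk, sPart_mem, map_zero, LinearMap.zero_apply]

/-- Contraction with `γ` kills the term in `V' ⊗ 1` and turns `p_i` into `γ(p_i)`, after which
`sum_act` applies. Only right linearity of `g` is required, so that the lemma also covers
composites. -/
lemma coef_sum (g : Dual S J →ₗ[K] (V →ₗ[K] V'))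
    (hg : ∀ (s : S) γ m, g (op s • γ) m = V'.act s (g γ m)) (γ : Dual S J) (m : V) (y : V') :
    Tens.coef hc γ (Tens.mk y 1 + ∑ i, Tens.mk (g (B.γ i) m) (B.p i * 1)) = g γ m := by
  rw [map_add, Tens.coef_mk_one, zero_add, map_sum]
  refine Eq.trans (Finset.sum_congr rfl fun i _ => ?_) (sum_act B g hg γ m)
  rw [mul_one, Tens.coef_mk, jPart_mem]

lemma coef_map (φ : CMap S J V V') (γ : Dual S J) (m : V) :
    Tens.coef hc γ (φ.map B (Tens.mk m 1)) = φ.c γ m := by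
  rw [map_mk, coef_sum B hc φ.c φ.right]

/-- The map `*J → Hom_K(V, V'')` of the composition of two pairs. -/
def compC (φ : CMap S J V V') (ψ : CMap S J V' V'') : Dual S J →ₗ[K] (V →ₗ[K] V'') where
  toFun γ := ψ.c γ ∘ₗ φ.f + ψ.f ∘ₗ φ.c γ + ∑ i, ψ.c (γ.shift (B.p i)) ∘ₗ φ.c (B.γ i)
  map_add' γ γ' := by
    have h (i) : (γ + γ').shift (B.p i) = γ.shift (B.p i) + γ'.shift (B.p i) := rfl
    simp only [h, map_add, LinearMap.add_comp, LinearMap.comp_add, Finset.sum_add_distrib]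
    abel
  map_smul' k γ := by
    have h (i) : (k • γ).shift (B.p i) = k • γ.shift (B.p i) := rfl
    simp only [h, map_smul, LinearMap.smul_comp, LinearMap.comp_smul, RingHom.id_apply, smul_add,
      Finset.smul_sum]

lemma compC_apply (φ : CMap S J V V') (ψ : CMap S J V' V'') (γ : Dual S J) (m : V) :
    compC B φ ψ γ m = ψ.c γ (φ.f m) + ψ.f (φ.c γ m) +
      ∑ i, ψ.c (γ.shift (B.p i)) (φ.c (B.γ i) m) := by
  change ψ.c γ (φ.f m) + ψ.f (φ.c γ m) + (∑ i, ψ.c (γ.shift (B.p i)) ∘ₗ φ.c (B.γ i)) m = _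
  rw [LinearMap.sum_apply]
  rfl

/-- The composite has the shape of a single pair with second component `compC`. The last sum comes
from the products `p_k p_i`: contracting them with `γ` on the left factor is contraction with
`γ.shift (p_i)`. -/
lemma coef_map_map (φ : CMap S J V V') (ψ : CMap S J V' V'') (γ : Dual S J) (m : V) :
    Tens.coef hc γ (ψ.map B (φ.map B (Tens.mk m 1))) = ψ.c γ (φ.f m) + ψ.f (φ.c γ m) +
      ∑ i, ψ.c (γ.shift (B.p i)) (φ.c (B.γ i) m) := by
  rw [map_map_mk, ← compC_apply]
  simp only [← compC_apply]
  refine coef_sum B hc (compC B φ ψ) (fun s γ m => ?_) γ m _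
  have h (i) : (op s • γ).shift (B.p i) = op s • γ.shift (B.p i) := rfl
  simp only [compC_apply, h, right, ψ.map_act, map_add, map_sum]

/-- The pair defined by a homomorphism `V ⊗_S Λ → V' ⊗_S Λ`. -/
def ofMap (g : Tens V →ₗ[Λᵐᵒᵖ] Tens V') : CMap S J V V' :=
  have hact : ∀ (s : S) (m : V), Tens.π hc (g (Tens.mk (V.act s m) 1)) =
      V'.act s (Tens.π hc (g (Tens.mk m 1))) := fun s m => by
    rw [Tens.mk_act, mul_one, Tens.mk_eq_smul, map_smul, Tens.π_smul, sPart_coe]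
  have hadd : ∀ m m' : V, g (Tens.mk (m + m') 1) = g (Tens.mk m 1) + g (Tens.mk m' 1) :=
    fun m m' => by rw [Tens.mk_add_left, map_add]
  have hleft : ∀ (s : S) (γ : Dual S J) (m : V), Tens.coef hc (s • γ) (g (Tens.mk m 1)) =
      Tens.coef hc γ (g (Tens.mk (V.act s m) 1)) := fun s γ m => by
    rw [Tens.mk_act, mul_one, Tens.mk_eq_smul m (s : Λ), map_smul, Tens.coef_left]
  { f :=
      { toFun := fun m => Tens.π hc (g (Tens.mk m 1))
        map_add' := fun m m' => by rw [hadd, map_add]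
        -- `g` is linear over `Λᵐᵒᵖ` only, so `K`-linearity is deduced from the compatibility with
        -- the scalars in `S`.
        map_smul' := fun k m => by
          rw [← RightMod.act_algebraMap (R := S) V, hact, RightMod.act_algebraMap]
          rfl }
    c :=
      { toFun := fun γ =>
          { toFun := fun m => Tens.coef hc γ (g (Tens.mk m 1))
            map_add' := fun m m' => by rw [hadd, map_add]
            map_smul' := fun k m => by
              have h : algebraMap K S k • γ = k • γ :=
                algebraMap_smul (R := K) (M := Dual.bimod S J) S k γ
              rw [← RightMod.act_algebraMap (R := S) V, ← hleft, h]
              exact Tens.coef_smul hc k γ _ }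
        map_add' := fun γ γ' => LinearMap.ext fun m => Tens.coef_add hc γ γ' _
        map_smul' := fun k γ => LinearMap.ext fun m => Tens.coef_smul hc k γ _ }
    map_act := hact
    left := hleft
    right := fun s γ m => Tens.coef_right hc s γ _ }

/-- This is `Tens.eq_sum` applied to `g(m ⊗ 1)`: the pair records exactly the components appearing
there. -/
lemma map_ofMap (g : Tens V →ₗ[Λᵐᵒᵖ] Tens V') : (ofMap hc g : CMap S J V V').map B = g := by
  refine Tens.hom_ext fun m a => ?_
  rw [Tens.mk_eq_smul m a, map_smul, map_smul, map_mk]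
  congr 1
  simp only [mul_one]
  exact (Tens.eq_sum B hc _).symm

/-- Both components are recovered from the homomorphism, by `π` and by contraction with `γ`,
evaluated at `m ⊗ 1`. -/
lemma map_injective (hc : IsCompl (Subalgebra.toSubmodule S) (J.restrictScalars K))
    {φ ψ : CMap S J V V'} (h : φ.map B = ψ.map B) : φ = ψ := by
  refine ext' (LinearMap.ext fun m => ?_) (LinearMap.ext fun γ => LinearMap.ext fun m => ?_)
  · rw [← π_map B hc, h, π_map]
  · rw [← coef_map B hc, h, coef_map]

end CMap

namespace Tens

variable {V V' : RightMod K S}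

/-- An isomorphism `V ≅ V'` of right `S`-modules induces `V ⊗_S Λ ≅ V' ⊗_S Λ`. -/
def congr (e : V ≃ₗ[K] V') (he : ∀ (s : S) m, e (V.act s m) = V'.act s (e m)) :
    Tens V ≃ₗ[Λᵐᵒᵖ] Tens V' :=
  LinearEquiv.ofLinearMap
    (extend (AddMonoidHom.mk' (fun m => mk (e m) 1) fun m m' => by rw [map_add, mk_add_left])
      (fun s m => by
        change mk (e (V.act s m)) 1 = op (s : Λ) • mk (e m) 1
        rw [he, mk_act, mul_one, mk_eq_smul]))
    (extend (AddMonoidHom.mk' (fun m => mk (e.symm m) 1)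
        fun m m' => by rw [map_add, mk_add_left])
      (fun s m => by
        change mk (e.symm (V'.act s m)) 1 = op (s : Λ) • mk (e.symm m) 1
        have h : e.symm (V'.act s m) = V.act s (e.symm m) :=
          e.injective (by rw [he, e.apply_symm_apply, e.apply_symm_apply])
        rw [h, mk_act, mul_one, mk_eq_smul]))
    (hom_ext fun m a => by
      rw [LinearMap.comp_apply, extend_mk, map_smul]
      change op a • (op (1 : Λ) • mk (e (e.symm m)) 1) = mk m a
      rw [e.apply_symm_apply, op_one, one_smul, ← mk_eq_smul])
    (hom_ext fun m a => by
      rw [LinearMap.comp_apply, extend_mk, map_smul]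
      change op a • (op (1 : Λ) • mk (e.symm (e m)) 1) = mk m a
      rw [e.symm_apply_apply, op_one, one_smul, ← mk_eq_smul])

lemma congr_mk (e : V ≃ₗ[K] V') (he) (m : V) (a : Λ) : congr e he (mk m a) = mk (e m) a :=
  (mk_eq_smul (e m) a).symm

end Tens

end TensMaps

/-! ## Projective modules and radicals -/

section Nakayama

variable {R M : Type u} [Ring R] [AddCommGroup M] [Module R M] {I : Ideal R}

/-- Nakayama's lemma for a nilpotent ideal, where the module need not be finitely generated:
substituting the equation into itself gives `N + I^k M = M` for every `k`. -/
lemma eq_top_of_sup_smul_top (hI : IsNilpotent I) {N : Submodule R M}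
    (h : N ⊔ I • (⊤ : Submodule R M) = ⊤) : N = ⊤ := by
  obtain ⟨n, hn⟩ := hI
  have key : ∀ k, N ⊔ I ^ k • (⊤ : Submodule R M) = ⊤ := by
    intro k
    induction k with
    | zero => rw [Submodule.pow_zero, Ideal.one_eq_top, Submodule.top_smul, sup_top_eq]
    | succ k ih =>
      have h1 : I ^ k • (⊤ : Submodule R M) = I ^ k • N ⊔ I ^ (k + 1) • (⊤ : Submodule R M) := by
        rw [Submodule.pow_succ, Submodule.mul_smul, ← Submodule.smul_sup, h]
      rw [h1, ← sup_assoc, sup_eq_left.2 (Submodule.smul_le_right (I := I ^ k) (N := N))] at ih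
      exact ih
  have := key n
  rwa [hn, Ideal.zero_eq_bot, Submodule.bot_smul, sup_bot_eq] at this

/-- A maximal submodule `N` not containing `I M` would satisfy `N + I M = M`, hence `N = M` by
Nakayama's lemma. -/
lemma smul_top_le_jacobson (hI : IsNilpotent I) :
    I • (⊤ : Submodule R M) ≤ Module.jacobson R M := by
  refine le_sInf fun N hN => ?_
  by_contra h
  exact hN.1 (eq_top_of_sup_smul_top hI (hN.2 _ (left_lt_sup.2 h)))

end Nakayama

section Opposite

variable {Λ : Type u} [Ring Λ] (J : Ideal Λ) [J.IsTwoSided]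

/-- A two-sided ideal as an ideal of the opposite ring. -/
def opIdeal : Ideal Λᵐᵒᵖ where
  carrier := {x | x.unop ∈ J}
  add_mem' ha hb := add_mem (S := Ideal Λ) ha hb
  zero_mem' := J.zero_mem
  smul_mem' a _ hx := J.mul_mem_right a.unop hx

/-- A product in the opposite ring is the product of `Λ` in reverse order, so powers of the ideal
correspond. -/
lemma opIdeal_isNilpotent (h : IsNilpotent J) : IsNilpotent (opIdeal J) := by
  obtain ⟨n, hn⟩ := h
  have key : ∀ k, ∀ x ∈ opIdeal J ^ k, x.unop ∈ J ^ k := by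
    intro k
    induction k with
    | zero =>
      intro x _
      rw [Submodule.pow_zero, Ideal.one_eq_top]
      exact Submodule.mem_top
    | succ k ih =>
      intro x hx
      rw [Submodule.pow_succ] at hx
      refine Submodule.smul_induction_on hx (fun a ha b hb => ?_) (fun a b ha hb => add_mem ha hb)
      -- The power has to be expanded with the single factor on the left, because the order of the
      -- factors is reversed.
      rw [Ideal.IsTwoSided.pow_succ]
      exact Ideal.mul_mem_mul hb (ih a ha)
  refine ⟨n, le_bot_iff.1 fun x hx => ?_⟩
  have := key n x hx
  rw [hn] at this
  exact unop_injective this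

/-- The submodule `P J` of a right module `P`. -/
abbrev radJ (P : Type u) [AddCommGroup P] [Module Λᵐᵒᵖ P] : Submodule Λᵐᵒᵖ P :=
  opIdeal J • (⊤ : Submodule Λᵐᵒᵖ P)

end Opposite

/-! ### Projective right `Λ`-modules as induced modules -/

section Projective

variable {K : Type u} [Field K] {Λ : Type u} [Ring Λ] [Algebra K Λ]
variable {S : Subalgebra K Λ} {J : Ideal Λ} [J.IsTwoSided] (B : DualBasis S J)

section sub

variable {P : Type u} [AddCommGroup P] [Module Λᵐᵒᵖ P] (V : AddSubgroup P)
  (hV : ∀ (s : S), ∀ m ∈ V, op (s : Λ) • m ∈ V)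

/-- The action of an element of `S` on an additive subgroup closed under `S`. -/
def subSmul (s : S) : V →+ V :=
  AddMonoidHom.mk' (fun m => ⟨op (s : Λ) • m.1, hV s m.1 m.2⟩)
    (fun m m' => Subtype.ext (smul_add (op (s : Λ)) m.1 m'.1))

/-- The `K`-vector space structure of an additive subgroup closed under `S`. -/
@[reducible] def subModule : Module K V where
  smul k m := subSmul V hV (algebraMap K S k) m
  one_smul m := Subtype.ext (by
    change op (algebraMap K Λ 1) • m.1 = m.1
    rw [map_one, op_one, one_smul])
  mul_smul k l m := Subtype.ext (by
    change op (algebraMap K Λ (k * l)) • m.1 =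
      op (algebraMap K Λ k) • op (algebraMap K Λ l) • m.1
    rw [← mul_smul, ← op_mul, ← map_mul, mul_comm])
  smul_zero k := map_zero _
  smul_add k := map_add _
  add_smul k l m := Subtype.ext (by
    change op (algebraMap K Λ (k + l)) • m.1 =
      op (algebraMap K Λ k) • m.1 + op (algebraMap K Λ l) • m.1
    rw [map_add, MulOpposite.op_add, add_smul])
  zero_smul m := Subtype.ext (by
    change op (algebraMap K Λ 0) • m.1 = 0
    rw [map_zero, MulOpposite.op_zero, zero_smul])

/-- An additive subgroup closed under `S` as a right `S`-module. -/
def subMod : RightMod K S :=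
  letI := subModule V hV
  RightMod.ofAct V
    { toFun := fun s =>
        { toFun := subSmul V hV s
          map_add' := map_add _
          map_smul' := fun k m => Subtype.ext (by
            change op (s : Λ) • op (algebraMap K Λ k) • m.1 =
              op (algebraMap K Λ k) • op (s : Λ) • m.1
            rw [← mul_smul, ← op_mul, ← mul_smul, ← op_mul, Algebra.commutes]) }
      map_add' := fun s t => LinearMap.ext fun m => Subtype.ext (add_smul (op (s : Λ)) (op (t : Λ)) m.1)
      map_smul' := fun k s => LinearMap.ext fun m => Subtype.ext (by
        change op (k • (s : Λ)) • m.1 = op (algebraMap K Λ k) • op (s : Λ) • m.1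
        rw [← mul_smul, ← op_mul, Algebra.smul_def, Algebra.commutes]) }
    (LinearMap.ext fun m => Subtype.ext (one_smul Λᵐᵒᵖ m.1))
    (fun s t => LinearMap.ext fun m => Subtype.ext (mul_smul (op (t : Λ)) (op (s : Λ)) m.1))

/-- The homomorphism `V ⊗_S Λ → P`, `m ⊗ a ↦ m a`. -/
def subMap : Tens (subMod V hV) →ₗ[Λᵐᵒᵖ] P :=
  Tens.extend (V := subMod V hV) V.subtype (fun _ _ => rfl)

lemma subMap_mk (m : V) (a : Λ) :
    subMap V hV (Tens.mk (V := subMod V hV) m a) = op a • m.1 := rfl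

end sub

/-- Every right `S`-module is semisimple, so `P J` has a complement in `P` as an `S`-module. It will
be the `V` with `P ≅ V ⊗_S Λ`. -/
lemma exists_complement [IsSemisimpleRing S] (P : Type u) [AddCommGroup P] [Module Λᵐᵒᵖ P] :
    ∃ V : AddSubgroup P, (∀ (s : S), ∀ m ∈ V, op (s : Λ) • m ∈ V) ∧
      (∀ p : P, ∃ v ∈ V, ∃ w ∈ radJ J P, v + w = p) ∧ ∀ v ∈ V, v ∈ radJ J P → v = 0 := by
  let _ : Module Sᵐᵒᵖ P := Module.compHom P (RingHom.op (S.val : S →+* Λ))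
  let N : Submodule Sᵐᵒᵖ P :=
    { (radJ J P).toAddSubgroup with
      smul_mem' := fun s m hm => (radJ J P).smul_mem (op (s.unop : Λ)) hm }
  obtain ⟨V, hV⟩ := ComplementedLattice.exists_isCompl N
  refine ⟨V.toAddSubgroup, fun s m hm => V.smul_mem (op s) hm, fun p => ?_, fun v hv hv' => ?_⟩
  · have h : p ∈ N ⊔ V := by rw [hV.sup_eq_top]; exact Submodule.mem_top
    obtain ⟨w, hw, v, hv, rfl⟩ := Submodule.mem_sup.1 h
    exact ⟨v, hv, w, hw, add_comm _ _⟩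
  · exact Submodule.disjoint_def.1 hV.disjoint v hv' hv

namespace Tens

variable {V V' : RightMod K S}
  (hc : IsCompl (Subalgebra.toSubmodule S) (J.restrictScalars K))

-- An element of `J` has zero part in `S`, so `π` kills `(V ⊗_S Λ) J`. Conversely, an element with
-- `π x = 0` is a sum of terms `m ⊗ p_i = (m ⊗ 1) p_i` by `eq_sum`.
include B in
lemma mem_radJ_iff (x : Tens V) : x ∈ radJ J (Tens V) ↔ π hc x = 0 := by
  constructor
  · intro h
    refine Submodule.smul_induction_on h (fun a ha y _ => ?_) (fun x y hx hy => ?_)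
    · have h1 : sPart hc a.unop = 0 := sPart_mem hc ⟨a.unop, ha⟩
      rw [← op_unop a, π_smul, h1, map_zero, LinearMap.zero_apply]
    · rw [map_add, hx, hy, add_zero]
  · intro h
    rw [eq_sum B hc x, h, mk_zero_left, zero_add]
    refine sum_mem fun i _ => ?_
    rw [mk_eq_smul]
    exact Submodule.smul_mem_smul (show op (B.p i : Λ) ∈ opIdeal J from (B.p i).2)
      Submodule.mem_top

-- One inclusion is Nakayama's lemma. For the other, `π` is semilinear along the surjection `Λ → S`
-- with values in the semisimple module `V`, whose radical is zero, so the radical lies in the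
-- kernel of `π`.
include B in
lemma jacobson_eq [IsSemisimpleRing S] (hJ : IsNilpotent J)
    (hc : IsCompl (Subalgebra.toSubmodule S) (J.restrictScalars K)) :
    Module.jacobson Λᵐᵒᵖ (Tens V) = radJ J (Tens V) := by
  refine le_antisymm (fun x hx => ?_) (smul_top_le_jacobson (opIdeal_isNilpotent J hJ))
  let _ : Module Sᵐᵒᵖ V := V.opModule
  have : RingHomSurjective (sPartOp hc) := ⟨sPartOp_surjective hc⟩
  let f : Tens V →ₛₗ[sPartOp hc] V :=
    { toFun := π hc
      map_add' := map_add _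
      map_smul' := fun a x => π_smul hc a.unop x }
  exact (mem_radJ_iff B hc x).2 (IsSemisimpleModule.jacobson_le_ker _ _ _ _ f hx)

/-- Induction preserves projectivity. The module `V` is projective over the semisimple ring `S`, so
`m ↦ m ⊗ 1` lifts `S`-linearly through the surjection `q` from a free `Λ`-module; extending the lift
`Λ`-linearly splits `q`. -/
instance projective [IsSemisimpleRing S] : Module.Projective Λᵐᵒᵖ (Tens V) := by
  refine Module.Projective.of_lifting_property'' fun q hq => ?_
  let _ : Module Sᵐᵒᵖ V := V.opModule
  let _ : Module Sᵐᵒᵖ (Tens V) := Module.compHom _ (RingHom.op (S.val : S →+* Λ))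
  let _ : Module Sᵐᵒᵖ (Tens V →₀ Λᵐᵒᵖ) := Module.compHom _ (RingHom.op (S.val : S →+* Λ))
  have : Module.Projective Sᵐᵒᵖ V := Module.projective_of_isSemisimpleRing _ _
  let q' : (Tens V →₀ Λᵐᵒᵖ) →ₗ[Sᵐᵒᵖ] Tens V :=
    { toFun := q
      map_add' := map_add q
      map_smul' := fun s x => map_smul q (op (s.unop : Λ)) x }
  let i : V →ₗ[Sᵐᵒᵖ] Tens V :=
    { toFun := fun m => mk m 1
      map_add' := fun m m' => mk_add_left m m' 1
      map_smul' := fun s m => by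
        change mk (V.act s.unop m) 1 = op (s.unop : Λ) • mk m 1
        rw [mk_act, mul_one, mk_eq_smul] }
  obtain ⟨l, hl⟩ := Module.projective_lifting_property q' i hq
  have hl' : ∀ (s : S) (m : V), l.toAddMonoidHom (V.act s m) = op (s : Λ) • l.toAddMonoidHom m :=
    fun s m => l.map_smul (op s) m
  refine ⟨extend l.toAddMonoidHom hl', hom_ext fun m a => ?_⟩
  rw [LinearMap.comp_apply, extend_mk, map_smul, LinearMap.id_apply, mk_eq_smul]
  exact congrArg (op a • ·) (LinearMap.congr_fun hl m)

-- Let `V` be an `S`-complement of `P J`. The map `V ⊗_S Λ → P` is onto by Nakayama's lemma and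
-- splits because `P` is projective. Its kernel lies in the radical, so by Nakayama's lemma again
-- the section is onto, and the map is bijective.
include B in
lemma exists_equiv [IsSemisimpleRing S] (hJ : IsNilpotent J)
    (hc : IsCompl (Subalgebra.toSubmodule S) (J.restrictScalars K))
    (P : Type u) [AddCommGroup P] [Module Λᵐᵒᵖ P] [Module.Projective Λᵐᵒᵖ P] :
    ∃ V : RightMod K S, Nonempty (Tens V ≃ₗ[Λᵐᵒᵖ] P) := by
  have hI := opIdeal_isNilpotent J hJ
  obtain ⟨V, hV, hsup, hinf⟩ := exists_complement (S := S) (J := J) P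
  have hsurj : Function.Surjective (subMap V hV) := by
    rw [← LinearMap.range_eq_top]
    refine eq_top_of_sup_smul_top hI (eq_top_iff.2 fun p _ => ?_)
    obtain ⟨v, hv, w, hw, rfl⟩ := hsup p
    refine Submodule.add_mem_sup ⟨mk (V := subMod V hV) ⟨v, hv⟩ 1, ?_⟩ hw
    rw [subMap_mk, op_one, one_smul]
  obtain ⟨s, hs⟩ := Module.projective_lifting_property (subMap V hV) LinearMap.id hsurj
  -- Modulo `P J`, the map sends `x` to `π x ∈ V`. If `x` is in the kernel, then `π x ∈ V ∩ P J =
  -- 0`.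
  have hker : LinearMap.ker (subMap V hV) ≤ radJ J (Tens (subMod V hV)) := by
    intro x hx
    rw [mem_radJ_iff B hc]
    have h1 : x = mk (π hc x) 1 + (x - mk (π hc x) 1) := (add_sub_cancel _ _).symm
    have h2 : x - mk (π hc x) 1 ∈ radJ J (Tens (subMod V hV)) := by
      rw [mem_radJ_iff B hc, map_sub, π_mk_one, sub_self]
    have h3 : subMap V hV (x - mk (π hc x) 1) ∈ radJ J P := by
      refine Submodule.smul_induction_on h2 (fun a ha y _ => ?_) (fun x y hx hy => ?_)
      · rw [map_smul]
        exact Submodule.smul_mem_smul ha Submodule.mem_top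
      · rw [map_add]
        exact add_mem hx hy
    let v : V := π hc x
    have h4 : subMap V hV (mk (π hc x) 1) = v.1 := by
      refine (subMap_mk V hV v 1).trans ?_
      rw [op_one, one_smul]
    rw [map_sub, LinearMap.mem_ker.1 hx, h4, zero_sub] at h3
    exact Subtype.ext (hinf v.1 v.2 (by simpa using neg_mem h3))
  -- The range of the section and the kernel together span, and the kernel lies in the radical part.
  have hrange : LinearMap.range s = ⊤ := by
    refine eq_top_of_sup_smul_top hI (eq_top_iff.2 fun x _ => ?_)
    have h1 : x - s (subMap V hV x) ∈ LinearMap.ker (subMap V hV) := by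
      rw [LinearMap.mem_ker, map_sub, ← LinearMap.comp_apply (subMap V hV), hs,
        LinearMap.id_apply, sub_self]
    rw [← add_sub_cancel (s (subMap V hV x)) x]
    exact Submodule.add_mem_sup ⟨_, rfl⟩ (hker h1)
  have hinj : Function.Injective (subMap V hV) := by
    intro x y hxy
    obtain ⟨x, rfl⟩ := LinearMap.range_eq_top.1 hrange x
    obtain ⟨y, rfl⟩ := LinearMap.range_eq_top.1 hrange y
    rw [← LinearMap.comp_apply, ← LinearMap.comp_apply, hs] at hxy
    exact congrArg s hxy
  exact ⟨subMod V hV, ⟨LinearEquiv.ofBijective _ ⟨hinj, hsurj⟩⟩⟩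

end Tens

/-- The radical is the kernel of `π`, and `π` of the image of `m ⊗ 1` is `f(m)`. -/
lemma CMap.range_le_jacobson_iff [IsSemisimpleRing S] (hJ : IsNilpotent J)
    (hc : IsCompl (Subalgebra.toSubmodule S) (J.restrictScalars K)) {V V' : RightMod K S}
    (φ : CMap S J V V') :
    LinearMap.range (φ.map B) ≤ Module.jacobson Λᵐᵒᵖ (Tens V') ↔ φ.f = 0 := by
  rw [Tens.jacobson_eq B hJ hc]
  constructor
  · intro h
    refine LinearMap.ext fun m => ?_
    rw [← φ.π_map B hc]
    exact (Tens.mem_radJ_iff B hc _).1 (h ⟨_, rfl⟩)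
  · rintro h _ ⟨x, rfl⟩
    induction x using Tens.induction with
    | hmk m a =>
      rw [Tens.mk_eq_smul, map_smul]
      refine Submodule.smul_mem _ _ ((Tens.mem_radJ_iff B hc _).2 ?_)
      rw [φ.π_map B hc, h]
      rfl
    | hadd x y hx hy => rw [map_add]; exact add_mem hx hy

end Projective

/-! ## The functor `Ξ` is an equivalence -/

section XiEquivalence

variable {K : Type u} [Field K] {Λ : Type u} [Ring Λ] [Algebra K Λ]
variable {S : Subalgebra K Λ} {J : Ideal Λ} [J.IsTwoSided] (B : DualBasis S J)

namespace piece

variable {R' : Type u} [Ring R'] [Algebra K R'] {N : RightMod K R'} {j : S →ₗ[K] R'}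
  {hj : ∀ s t, j (s * t) = j s * j t}

variable (N j hj) in
/-- The projection of `N` to `N j(1)`. -/
def proj : N →ₗ[K] piece N j hj := (N.act (j 1)).rangeRestrict

variable (N j hj) in
/-- The inclusion of `N j(1)` in `N` as a linear map. -/
def valL : piece N j hj →ₗ[K] N := (LinearMap.range (N.act (j 1))).subtype

lemma val_proj (x : N) : val (proj N j hj x) = N.act (j 1) x := rfl

lemma proj_val (x : piece N j hj) : proj N j hj (val x) = x := val_injective (act_val x)

end piece

namespace Drozd

open piece

variable (M N : RightMod K (T.zero (W₀ S J) (W₁ S J)))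

/-- The projection `M → M₁`. -/
abbrev proj₁ : M →ₗ[K] M₁ M := proj M (j1 S J) j1_mul

/-- The projection `M → M₂`. -/
abbrev proj₂ : M →ₗ[K] M₂ M := proj M (j2 S J) j2_mul

variable {M N}

lemma act_rZero_mul (r t : S × S) (m : M) :
    M.act (T.rZero t) (M.act (T.rZero r) m) = M.act (T.rZero (r * t)) m := by
  have h := map_mul (T.rZeroHom (W₀ S J) (W₁ S J)) r t
  exact (M.act_mul _ _ m).symm.trans (congrArg (fun a => M.act a m) h.symm)

/-- The idempotents `w₁` and `w₂` have sum `1`, so `M` is the sum of `M₁` and `M₂`. -/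
lemma val_add_val (m : M) : val (proj₁ M m) + val (proj₂ M m) = m := by
  have h : j1 S J 1 + j2 S J 1 = 1 := by
    have h1 := map_add (T.rZeroHom (W₀ S J) (W₁ S J)) (1, 0) (0, 1)
    rw [Prod.mk_add_mk, add_zero, zero_add, ← Prod.one_eq_mk, map_one] at h1
    exact h1.symm
  rw [val_proj, val_proj, ← LinearMap.add_apply, ← map_add, h, RightMod.act_one]

lemma proj₁_rZero (r : S × S) (m : M) :
    proj₁ M (M.act (T.rZero r) m) = (M₁ M).act r.1 (proj₁ M m) := val_injective <| by
  have h : r * (1, 0) = (1, 0) * (r.1, 0) := Prod.ext (by simp) (by simp)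
  refine (act_rZero_mul r (1, 0) m).trans (Eq.trans ?_ (act_rZero_mul (1, 0) (r.1, 0) m).symm)
  rw [h]

lemma proj₂_rZero (r : S × S) (m : M) :
    proj₂ M (M.act (T.rZero r) m) = (M₂ M).act r.2 (proj₂ M m) := val_injective <| by
  have h : r * (0, 1) = (0, 1) * (0, r.2) := Prod.ext (by simp) (by simp)
  refine (act_rZero_mul r (0, 1) m).trans (Eq.trans ?_ (act_rZero_mul (0, 1) (0, r.2) m).symm)
  rw [h]

lemma rZero_val₁ (r : S × S) (x : M₁ M) : M.act (T.rZero r) (val x) = val ((M₁ M).act r.1 x) := by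
  have h : (1, 0) * r = (1, 0) * (r.1, 0) := Prod.ext (by simp) (by simp)
  refine (congrArg (M.act (T.rZero r)) (act_val x).symm).trans
    (Eq.trans ?_ (congrArg (M.act (T.rZero (r.1, 0))) (act_val x)))
  refine (act_rZero_mul (1, 0) r _).trans (Eq.trans ?_ (act_rZero_mul (1, 0) (r.1, 0) _).symm)
  rw [h]

lemma rZero_val₂ (r : S × S) (x : M₂ M) : M.act (T.rZero r) (val x) = val ((M₂ M).act r.2 x) := by
  have h : (0, 1) * r = (0, 1) * (0, r.2) := Prod.ext (by simp) (by simp)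
  refine (congrArg (M.act (T.rZero r)) (act_val x).symm).trans
    (Eq.trans ?_ (congrArg (M.act (T.rZero (0, r.2))) (act_val x)))
  refine (act_rZero_mul (0, 1) r _).trans (Eq.trans ?_ (act_rZero_mul (0, 1) (0, r.2) _).symm)
  rw [h]

lemma j1_mul_j2 : j1 S J 1 * j2 S J 1 = 0 := by
  refine (map_mul (T.rZeroHom (W₀ S J) (W₁ S J)) (1, 0) (0, 1)).symm.trans ?_
  rw [Prod.mk_mul_mk, mul_zero, zero_mul]
  exact map_zero (T.rZeroHom (W₀ S J) (W₁ S J))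

lemma j2_mul_j1 : j2 S J 1 * j1 S J 1 = 0 := by
  refine (map_mul (T.rZeroHom (W₀ S J) (W₁ S J)) (0, 1) (1, 0)).symm.trans ?_
  rw [Prod.mk_mul_mk, mul_zero, zero_mul]
  exact map_zero (T.rZeroHom (W₀ S J) (W₁ S J))

lemma proj₁_val (x : M₂ M) : proj₁ M (val x) = 0 := val_injective <| by
  rw [val_proj, ← act_val x, ← RightMod.act_mul, j2_mul_j1, map_zero]
  rfl

lemma proj₂_val (x : M₁ M) : proj₂ M (val x) = 0 := val_injective <| by
  rw [val_proj, ← act_val x, ← RightMod.act_mul, j1_mul_j2, map_zero]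
  rfl

lemma u_val₁ (γ : Dual S J) (x : M₁ M) : M.act (u S J γ) (val x) = val ((cAct M).c γ x) := rfl

/-- `w₁₂ γ = w₁ · w₁₂ γ`, and `w₂ w₁ = 0`: the element acts from `M₁` only. -/
lemma u_val₂ (γ : Dual S J) (x : M₂ M) : M.act (u S J γ) (val x) = 0 := by
  have h : u S J γ = j1 S J 1 * u S J γ := by rw [← u_smul, one_smul]
  rw [← act_val x, h, ← RightMod.act_mul, ← mul_assoc, j2_mul_j1, zero_mul, map_zero]
  rfl

lemma act_u (γ : Dual S J) (m : M) : M.act (u S J γ) m = val ((cAct M).c γ (proj₁ M m)) := by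
  conv_lhs => rw [← val_add_val m, map_add, u_val₁, u_val₂, add_zero]

lemma wOne_eq (w : W₁ S J) : T.wOne w = v1 S J w.1 + v2 S J w.2 := by
  have h : w = ((w.1, 0) : Dual S J × Dual S J) + (0, w.2) :=
    Prod.ext (add_zero _).symm (zero_add _).symm
  conv_lhs => rw [h]
  exact map_add T.wOne ((w.1, 0) : W₁ S J) ((0, w.2) : W₁ S J)

/-- `w₁ γ = w₁ · w₁ γ`, so a bimodule map evaluated there sees only the component of `m` in `M₁`. -/
lemma v1_apply (f : BMap M N) (γ : Dual S J) (m : M) :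
    f.toFun (v1 S J γ) m = f.toFun (v1 S J γ) (val (proj₁ M m)) := by
  conv_lhs => rw [← one_smul S γ, v1_smul, f.left]
  rfl

lemma v2_apply (f : BMap M N) (γ : Dual S J) (m : M) :
    f.toFun (v2 S J γ) m = f.toFun (v2 S J γ) (val (proj₂ M m)) := by
  conv_lhs => rw [← one_smul S γ, v2_smul, f.left]
  rfl

section hom

variable (φ₁ : CMap S J (M₁ M) (M₁ N)) (φ₂ : CMap S J (M₂ M) (M₂ N))

/-- The map `f⁰` with components given by two pairs. -/
def sumF₀ : M →ₗ[K] N :=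
  valL N (j1 S J) j1_mul ∘ₗ φ₁.f ∘ₗ proj₁ M + valL N (j2 S J) j2_mul ∘ₗ φ₂.f ∘ₗ proj₂ M

lemma sumF₀_apply (m : M) :
    sumF₀ φ₁ φ₂ m = val (φ₁.f (proj₁ M m)) + val (φ₂.f (proj₂ M m)) := rfl

/-- The map `f¹` on generators with components given by two pairs. -/
def sumW₁ : W₁ S J →ₗ[K] (M →ₗ[K] N) where
  toFun w := valL N (j1 S J) j1_mul ∘ₗ φ₁.c w.1 ∘ₗ proj₁ M +
    valL N (j2 S J) j2_mul ∘ₗ φ₂.c w.2 ∘ₗ proj₂ M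
  map_add' v w := by
    have h1 : (v + w).1 = v.1 + w.1 := rfl
    have h2 : (v + w).2 = v.2 + w.2 := rfl
    rw [h1, h2, map_add, map_add]
    simp only [LinearMap.add_comp, LinearMap.comp_add]
    abel
  map_smul' k w := by
    have h1 : (k • w).1 = k • w.1 := rfl
    have h2 : (k • w).2 = k • w.2 := rfl
    rw [h1, h2, map_smul, map_smul]
    simp only [LinearMap.smul_comp, LinearMap.comp_smul, smul_add, RingHom.id_apply]

lemma sumW₁_apply (w : W₁ S J) (m : M) :
    sumW₁ φ₁ φ₂ w m = val (φ₁.c w.1 (proj₁ M m)) + val (φ₂.c w.2 (proj₂ M m)) := rfl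

/-- The map `f¹` with components given by two pairs. -/
def sumF₁ : BMap M N := BMap.ofGen (sumW₁ φ₁ φ₂)
  (fun r w m => by
    rw [sumW₁_apply, sumW₁_apply, proj₁_rZero, proj₂_rZero, ← φ₁.left, ← φ₂.left]
    rfl)
  (fun r w m => by
    rw [sumW₁_apply, sumW₁_apply, map_add, rZero_val₁, rZero_val₂, ← φ₁.right, ← φ₂.right]
    rfl)

lemma sumF₁_wOne (w : W₁ S J) (m : M) : (sumF₁ φ₁ φ₂).toFun (T.wOne w) m =
    val (φ₁.c w.1 (proj₁ M m)) + val (φ₂.c w.2 (proj₂ M m)) := BMap.ofGen_wOne _ _ _ _ _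

lemma sumF₁_v1 (γ : Dual S J) (m : M) :
    (sumF₁ φ₁ φ₂).toFun (v1 S J γ) m = val (φ₁.c γ (proj₁ M m)) := by
  refine (sumF₁_wOne φ₁ φ₂ (γ, 0) m).trans ?_
  change _ + val (φ₂.c 0 _) = _
  rw [map_zero, LinearMap.zero_apply, val_zero, add_zero]

lemma sumF₁_v2 (γ : Dual S J) (m : M) :
    (sumF₁ φ₁ φ₂).toFun (v2 S J γ) m = val (φ₂.c γ (proj₂ M m)) := by
  refine (sumF₁_wOne φ₁ φ₂ (0, γ) m).trans ?_
  change val (φ₁.c 0 _) + _ = _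
  rw [map_zero, LinearMap.zero_apply, val_zero, zero_add]

lemma _root_.Dit.BMap.map_sum_sub_sum {K : Type u} [Field K] {R : Type u} [Ring R] [Algebra K R]
    {W₀ W₁ : Bimod K R} {M N : RightMod K (T.zero W₀ W₁)} (F : BMap M N) {ι : Type*}
    [Fintype ι] (a b : ι → T.zero W₀ W₁) (v w : ι → T.gr W₀ W₁ 1) (m : M) :
    F.toFun (∑ i, T.lmul (a i) (v i) - ∑ i, T.rmul (w i) (b i)) m =
      ∑ i, F.toFun (v i) (M.act (a i) m) - ∑ i, N.act (b i) (F.toFun (w i) m) := by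
  rw [map_sub, map_sum, map_sum, LinearMap.sub_apply, LinearMap.sum_apply, LinearMap.sum_apply]
  simp only [F.left, F.right]

/-- In `d(w₁₂ γ)` each summand is a product of a factor of degree zero and one of degree one, so the
bimodule rules move the degree zero factor to `M` or to `N`. -/
lemma map_d₀_u (F : BMap M N) (γ : Dual S J) (m : M) :
    F.toFun ((drozd B).d₀ (u S J γ)) m =
      ∑ i, F.toFun (v2 S J (γ.shift (B.p i))) (M.act (u S J (B.γ i)) m) -
        ∑ i, N.act (u S J (γ.shift (B.p i))) (F.toFun (v1 S J (B.γ i)) m) :=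
  (congrArg (fun v => F.toFun v m) (d₀_u B γ)).trans (BMap.map_sum_sub_sum F _ _ _ _ m)

/-- Contracting the commutative square with `γ`, at the component of `m` in `M₁` tensored with `1`,
gives an identity in the components of `N`. With the signs chosen in `d(w₁₂ γ)`, it is exactly the
compatibility required of a morphism at `w₁₂ γ`; the first components of `cAct` vanish, which
removes two terms. -/
lemma sum_map_u (hc : IsCompl (Subalgebra.toSubmodule S) (J.restrictScalars K))
    (h : (cAct N).map B ∘ₗ φ₁.map B = φ₂.map B ∘ₗ (cAct M).map B) (γ : Dual S J) (m : M) :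
    N.act (u S J γ) (sumF₀ φ₁ φ₂ m) = sumF₀ φ₁ φ₂ (M.act (u S J γ) m) +
      (sumF₁ φ₁ φ₂).toFun ((drozd B).d₀ (u S J γ)) m := by
  have h1 := congrArg (Tens.coef hc γ) (LinearMap.congr_fun h (Tens.mk (proj₁ M m) 1))
  rw [LinearMap.comp_apply, LinearMap.comp_apply, CMap.coef_map_map, CMap.coef_map_map] at h1
  have h2 := congrArg val h1
  have hf : ∀ L : RightMod K (T.zero (W₀ S J) (W₁ S J)), (cAct L).f = 0 := fun _ => rfl
  rw [hf, hf, LinearMap.zero_apply, LinearMap.zero_apply, map_zero, add_zero, zero_add, val_add,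
    val_add, val_sum, val_sum] at h2
  rw [map_d₀_u]
  simp only [sumF₁_v1, sumF₁_v2, act_u,
    sumF₀_apply, proj_val, proj₁_val, map_add, map_zero, val_zero, zero_add, add_zero]
  rw [← add_sub_assoc, ← h2, add_sub_cancel_right]

end hom

end Drozd

-- The two homomorphisms in `Ξ(f)` determine the pairs `c1` and `c2`. As `M = M₁ ⊕ M₂` and `W₁ = w₁
-- *J ⊕ w₂ *J`, these determine `f⁰`, and `f¹` on generators.
open Drozd in
lemma Ξ_faithful (hc : IsCompl (Subalgebra.toSubmodule S) (J.restrictScalars K)) :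
    (Ξ B).Faithful where
  map_injective {M N} f g h := by
    let f' : Ditalgebra.Mod.Hom M N := f
    let g' : Ditalgebra.Mod.Hom M N := g
    have h1 : c1 B f' = c1 B g' := CMap.map_injective B hc
      (congrArg (fun x : (Ξ B).obj M ⟶ (Ξ B).obj N => x.left.hom) h)
    have h2 : c2 B f' = c2 B g' := CMap.map_injective B hc
      (congrArg (fun x : (Ξ B).obj M ⟶ (Ξ B).obj N => x.right.hom) h)
    refine Ditalgebra.Mod.Hom.ext (LinearMap.ext fun m => ?_) (BMap.ext_gen fun w m => ?_)
    · have e1 := congrArg (fun c => piece.val (c.f (proj₁ M.mod m))) h1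
      have e2 := congrArg (fun c => piece.val (c.f (proj₂ M.mod m))) h2
      have e : ∀ k : Ditalgebra.Mod.Hom M N, k.f₀ m =
          piece.val ((c1 B k).f (proj₁ M.mod m)) + piece.val ((c2 B k).f (proj₂ M.mod m)) :=
        fun k => (congrArg k.f₀ (val_add_val m).symm).trans (map_add k.f₀ _ _)
      exact (e f').trans ((congrArg₂ (· + ·) e1 e2).trans (e g').symm)
    · have e1 := congrArg (fun c => piece.val (c.c w.1 (proj₁ M.mod m))) h1
      have e2 := congrArg (fun c => piece.val (c.c w.2 (proj₂ M.mod m))) h2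
      have e : ∀ k : Ditalgebra.Mod.Hom M N, k.f₁.toFun (T.wOne w) m =
          piece.val ((c1 B k).c w.1 (proj₁ M.mod m)) +
            piece.val ((c2 B k).c w.2 (proj₂ M.mod m)) := fun k => by
        rw [wOne_eq, map_add, LinearMap.add_apply, v1_apply, v2_apply]
        rfl
      exact (e f').trans ((congrArg₂ (· + ·) e1 e2).trans (e g').symm)

-- Each side of the square is given by a pair by `CMap.map_ofMap`. The two pairs are assembled into
-- `f⁰` and `f¹`, and the commutativity of the square supplies the compatibility on `W₀`.
open Drozd in
lemma Ξ_full (hc : IsCompl (Subalgebra.toSubmodule S) (J.restrictScalars K)) :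
    (Ξ B).Full where
  map_surjective {M N} g := by
    let φ₁ : CMap S J (M₁ M.mod) (M₁ N.mod) := CMap.ofMap hc g.left.hom
    let φ₂ : CMap S J (M₂ M.mod) (M₂ N.mod) := CMap.ofMap hc g.right.hom
    have e1 : φ₁.map B = g.left.hom := CMap.map_ofMap B hc _
    have e2 : φ₂.map B = g.right.hom := CMap.map_ofMap B hc _
    have hsq : (cAct N.mod).map B ∘ₗ φ₁.map B = φ₂.map B ∘ₗ (cAct M.mod).map B := by
      rw [e1, e2]
      exact congrArg ModuleCat.Hom.hom g.w
    let f : Ditalgebra.Mod.Hom M N := Ditalgebra.Mod.Hom.ofGen (sumF₀ φ₁ φ₂) (sumF₁ φ₁ φ₂)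
      (fun r m => by
        rw [sumF₀_apply, sumF₀_apply, map_add, proj₁_rZero, proj₂_rZero, rZero_val₁,
          rZero_val₂, φ₁.map_act, φ₂.map_act])
      (fun γ m => sum_map_u B φ₁ φ₂ hc hsq γ m)
    have h1 : c1 B f = φ₁ := CMap.ext'
      (LinearMap.ext fun x => piece.val_injective (by
        change sumF₀ φ₁ φ₂ (piece.val x) = _
        rw [sumF₀_apply, piece.proj_val, proj₂_val, map_zero, piece.val_zero, add_zero]))
      (LinearMap.ext fun γ => LinearMap.ext fun x => piece.val_injective (by
        refine (sumF₁_v1 φ₁ φ₂ γ (piece.val x)).trans ?_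
        rw [piece.proj_val]))
    have h2 : c2 B f = φ₂ := CMap.ext'
      (LinearMap.ext fun x => piece.val_injective (by
        change sumF₀ φ₁ φ₂ (piece.val x) = _
        rw [sumF₀_apply, piece.proj_val, proj₁_val, map_zero, piece.val_zero, zero_add]))
      (LinearMap.ext fun γ => LinearMap.ext fun x => piece.val_injective (by
        refine (sumF₁_v2 φ₁ φ₂ γ (piece.val x)).trans ?_
        rw [piece.proj_val]))
    refine ⟨f, ?_⟩
    ext1
    · exact ModuleCat.hom_ext ((congrArg (CMap.map B) h1).trans e1)
    · exact ModuleCat.hom_ext ((congrArg (CMap.map B) h2).trans e2)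

/-! ### Objects of `Mod 𝒟` built from pairs `(0, c)` -/

section object

variable {V₁ V₂ : RightMod K S} (φ : CMap S J V₁ V₂)

namespace Drozd

variable (V₁ V₂) in
/-- The right `S × S`-module `V₁ × V₂`. -/
def pairR : RightMod K (S × S) := RightMod.ofAct (V₁ × V₂)
  { toFun := fun r => LinearMap.prodMap (V₁.act r.1) (V₂.act r.2)
    map_add' := fun r t => by rw [Prod.fst_add, Prod.snd_add, map_add, map_add]; rfl
    map_smul' := fun k r => by rw [Prod.smul_fst, Prod.smul_snd, map_smul, map_smul]; rfl }
  (LinearMap.ext fun x => Prod.ext (V₁.act_one x.1) (V₂.act_one x.2))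
  (fun r t => LinearMap.ext fun x => Prod.ext (V₁.act_mul r.1 t.1 x.1) (V₂.act_mul r.2 t.2 x.2))

/-- The action of `w₁₂ *J` on `V₁ × V₂` given by the second component of a pair. -/
def pairW : W₀ S J →ₗ[K] Module.End K (V₁ × V₂) where
  toFun γ := LinearMap.inr K V₁ V₂ ∘ₗ φ.c γ ∘ₗ LinearMap.fst K V₁ V₂
  map_add' γ γ' := LinearMap.ext fun x => Prod.ext (add_zero _).symm
    (LinearMap.congr_fun (map_add φ.c γ γ') x.1)
  map_smul' k γ := LinearMap.ext fun x => Prod.ext (smul_zero _).symm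
    (LinearMap.congr_fun (map_smul φ.c k γ) x.1)

/-- The object of `Mod 𝒟` with `M₁ = V₁`, `M₂ = V₂` and the action of `w₁₂ *J` given by the second
component of a pair. -/
def pairMod : RightMod K (T.zero (W₀ S J) (W₁ S J)) :=
  RightMod.ofGen (W₁ S J) (pairR V₁ V₂) (pairW φ)
    (fun r γ x => Prod.ext rfl (φ.left r.1 γ x.1))
    (fun r γ x => Prod.ext (map_zero (V₁.act r.1)).symm (φ.right r.2 γ x.1))

lemma pairMod_rZero (r : S × S) (x : V₁ × V₂) :
    (pairMod φ).act (T.rZero r) x = (V₁.act r.1 x.1, V₂.act r.2 x.2) :=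
  RightMod.ofGen_rZero _ _ _ _ _ _ _

lemma pairMod_u (γ : Dual S J) (x : V₁ × V₂) :
    (pairMod φ).act (u S J γ) x = (0, φ.c γ x.1) := RightMod.ofGen_wZero _ _ _ _ _ _ _

/-- The first component of the object given by a pair. -/
def pairEquiv₁ : M₁ (pairMod φ) ≃ₗ[K] V₁ :=
  LinearEquiv.ofBijective (LinearMap.fst K V₁ V₂ ∘ₗ piece.valL (pairMod φ) (j1 S J) j1_mul) (by
    -- The idempotent `w₁` acts as the projection to the first factor, so its range is `V₁ × 0`.
    have h : ∀ x : V₁ × V₂, (pairMod φ).act (j1 S J 1) x = (x.1, 0) := fun x => by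
      refine (pairMod_rZero φ (1, 0) x).trans ?_
      rw [RightMod.act_one, map_zero, LinearMap.zero_apply]
    constructor
    · intro x y hxy
      refine piece.val_injective
        ((piece.act_val x).symm.trans (Eq.trans ?_ (piece.act_val y)))
      exact (h (piece.val x)).trans
        ((congrArg (fun v => ((v, 0) : V₁ × V₂)) hxy).trans (h (piece.val y)).symm)
    · exact fun v => ⟨proj₁ (pairMod φ) ((v, 0) : V₁ × V₂), congrArg Prod.fst (h (v, 0))⟩)

/-- The second component of the object given by a pair. -/
def pairEquiv₂ : M₂ (pairMod φ) ≃ₗ[K] V₂ :=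
  LinearEquiv.ofBijective (LinearMap.snd K V₁ V₂ ∘ₗ piece.valL (pairMod φ) (j2 S J) j2_mul) (by
    have h : ∀ x : V₁ × V₂, (pairMod φ).act (j2 S J 1) x = (0, x.2) := fun x => by
      refine (pairMod_rZero φ (0, 1) x).trans ?_
      rw [RightMod.act_one, map_zero, LinearMap.zero_apply]
    constructor
    · intro x y hxy
      refine piece.val_injective
        ((piece.act_val x).symm.trans (Eq.trans ?_ (piece.act_val y)))
      exact (h (piece.val x)).trans
        ((congrArg (fun v => ((0, v) : V₁ × V₂)) hxy).trans (h (piece.val y)).symm)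
    · exact fun v => ⟨proj₂ (pairMod φ) ((0, v) : V₁ × V₂), congrArg Prod.snd (h (0, v))⟩)

lemma pairEquiv₁_act (s : S) (x : M₁ (pairMod φ)) :
    pairEquiv₁ φ ((M₁ (pairMod φ)).act s x) = V₁.act s (pairEquiv₁ φ x) :=
  congrArg Prod.fst (pairMod_rZero φ (s, 0) (piece.val x))

lemma pairEquiv₂_act (s : S) (x : M₂ (pairMod φ)) :
    pairEquiv₂ φ ((M₂ (pairMod φ)).act s x) = V₂.act s (pairEquiv₂ φ x) :=
  congrArg Prod.snd (pairMod_rZero φ (0, s) (piece.val x))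

lemma pairEquiv₂_c (γ : Dual S J) (x : M₁ (pairMod φ)) :
    pairEquiv₂ φ ((cAct (pairMod φ)).c γ x) = φ.c γ (pairEquiv₁ φ x) :=
  congrArg Prod.snd (pairMod_u φ γ (piece.val x))

/-- `cAct` has zero first component, so the two homomorphisms can agree only because `φ.f = 0`;
their second components agree by construction of `pairMod`. -/
lemma congr_cAct (hφ : φ.f = 0) :
    (Tens.congr (pairEquiv₂ φ) (pairEquiv₂_act φ)).toLinearMap ∘ₗ (cAct (pairMod φ)).map B =
      φ.map B ∘ₗ (Tens.congr (pairEquiv₁ φ) (pairEquiv₁_act φ)).toLinearMap := by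
  refine Tens.hom_ext fun m a => ?_
  rw [LinearMap.comp_apply, LinearMap.comp_apply, LinearEquiv.coe_coe, LinearEquiv.coe_coe,
    Tens.congr_mk, CMap.map_mk, CMap.map_mk, map_add, map_sum, hφ]
  simp only [Tens.congr_mk, pairEquiv₂_c]
  refine congrArg (· + _) ?_
  exact congrArg (fun v => Tens.mk v a) (map_zero (pairEquiv₂ φ))

end Drozd

end object

/-- Homomorphisms of modules which are isomorphic by a commutative square are isomorphic objects
of the category of arrows. -/
def arrowIso {R : Type u} [Ring R] {X Y X' Y' : Type u} [AddCommGroup X] [Module R X]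
    [AddCommGroup Y] [Module R Y] [AddCommGroup X'] [Module R X'] [AddCommGroup Y'] [Module R Y']
    {f : X →ₗ[R] Y} {g : X' →ₗ[R] Y'} (a : X ≃ₗ[R] X') (b : Y ≃ₗ[R] Y')
    (h : b.toLinearMap ∘ₗ f = g ∘ₗ a.toLinearMap) :
    Arrow.mk (ModuleCat.ofHom f) ≅ Arrow.mk (ModuleCat.ofHom g) :=
  Arrow.isoMk a.toModuleIso b.toModuleIso (congrArg ModuleCat.ofHom h.symm)

variable [IsSemisimpleRing S]

/-- Both modules are induced, hence projective, so only the condition on the radical remains. -/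
lemma isM1_map_iff (hJ : IsNilpotent J)
    (hc : IsCompl (Subalgebra.toSubmodule S) (J.restrictScalars K)) {V V' : RightMod K S}
    (φ : CMap S J V V') : isM1 Λ (Arrow.mk (ModuleCat.ofHom (φ.map B))) ↔ φ.f = 0 :=
  ⟨fun h => (φ.range_le_jacobson_iff B hJ hc).1 h.2.2,
    fun h => ⟨Tens.projective, Tens.projective, (φ.range_le_jacobson_iff B hJ hc).2 h⟩⟩

lemma isM1_Ξ (hJ : IsNilpotent J)
    (hc : IsCompl (Subalgebra.toSubmodule S) (J.restrictScalars K)) (M : (drozd B).Mod) :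
    isM1 Λ ((Ξ B).obj M) := (isM1_map_iff B hJ hc _).2 rfl

/-- Every object of `M¹(Λ)` is isomorphic to the homomorphism `V₁ ⊗_S Λ → V₂ ⊗_S Λ` given by
a pair `(0, c)`. -/
lemma exists_cMap_iso (hJ : IsNilpotent J)
    (hc : IsCompl (Subalgebra.toSubmodule S) (J.restrictScalars K))
    (φ : Arrow (ModuleCat.{u} Λᵐᵒᵖ)) (h : isM1 Λ φ) :
    ∃ (V₁ V₂ : RightMod K S) (ψ : CMap S J V₁ V₂), ψ.f = 0 ∧
      Nonempty (Arrow.mk (ModuleCat.ofHom (ψ.map B)) ≅ φ) := by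
  obtain ⟨hP, hQ, hr⟩ := h
  obtain ⟨V₁, ⟨a⟩⟩ := Tens.exists_equiv B hJ hc φ.left
  obtain ⟨V₂, ⟨b⟩⟩ := Tens.exists_equiv B hJ hc φ.right
  let g : Tens V₁ →ₗ[Λᵐᵒᵖ] Tens V₂ := b.symm.toLinearMap ∘ₗ φ.hom.hom ∘ₗ a.toLinearMap
  let ψ : CMap S J V₁ V₂ := CMap.ofMap hc g
  have hg : ψ.map B = g := CMap.map_ofMap B hc g
  refine ⟨V₁, V₂, ψ, (ψ.range_le_jacobson_iff B hJ hc).1 ?_,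
    ⟨arrowIso (f := ψ.map B) (g := φ.hom.hom) a b ?_⟩⟩
  · rw [hg]
    rintro _ ⟨x, rfl⟩
    -- A homomorphism maps the radical into the radical; here it is used for the inverse of `b`.
    exact Module.map_jacobson_le b.symm.toLinearMap ⟨_, hr ⟨a x, rfl⟩, rfl⟩
  · rw [hg]
    exact LinearMap.ext fun x => b.apply_symm_apply _

lemma exists_Ξ_iso (hJ : IsNilpotent J)
    (hc : IsCompl (Subalgebra.toSubmodule S) (J.restrictScalars K))
    (φ : Arrow (ModuleCat.{u} Λᵐᵒᵖ)) (h : isM1 Λ φ) :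
    ∃ M, Nonempty ((Ξ B).obj M ≅ φ) := by
  obtain ⟨V₁, V₂, ψ, hψ, ⟨e⟩⟩ := exists_cMap_iso B hJ hc φ h
  exact ⟨⟨Drozd.pairMod ψ⟩, ⟨(arrowIso (f := (Drozd.cAct (Drozd.pairMod ψ)).map B)
    (Tens.congr _ (Drozd.pairEquiv₁_act ψ)) (Tens.congr _ (Drozd.pairEquiv₂_act ψ))
    (Drozd.congr_cAct B ψ hψ)).trans e⟩⟩

end XiEquivalence

/-- A full and faithful functor with values in a full subcategory, all of whose objects it
reaches, is an equivalence onto it. -/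
lemma isEquivalence_lift {C D : Type*} [Category* C] [Category* D] (P : ObjectProperty D)
    (G : C ⥤ D) [G.Full] [G.Faithful] (h : ∀ X, P (G.obj X))
    (hs : ∀ Y, P Y → ∃ X, Nonempty (G.obj X ≅ Y)) : (P.lift G h).IsEquivalence where
  essSurj := ⟨fun Y => by
    obtain ⟨X, ⟨e⟩⟩ := hs Y.obj Y.property
    exact ⟨X, ⟨P.isoMk e⟩⟩⟩

lemma Ξ_isEquivalence {K Λ : Type u} [Field K] [Ring Λ] [Algebra K Λ] {S : Subalgebra K Λ}
    {J : Ideal Λ} [J.IsTwoSided] (B : DualBasis S J) [IsSemisimpleRing S] (hJ : IsNilpotent J)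
    (hc : IsCompl (Subalgebra.toSubmodule S) (J.restrictScalars K)) :
    ((isM1 Λ).lift (Ξ B) (isM1_Ξ B hJ hc)).IsEquivalence :=
  have := Ξ_full B hc
  have := Ξ_faithful B hc
  isEquivalence_lift _ _ _ (exists_Ξ_iso B hJ hc)

instance {C D : Type*} [Category* C] [Category* D] (G : C ⥤ D) [G.Faithful] :
    G.mapArrow.Faithful where
  map_injective h := Arrow.hom_ext _ _ (G.map_injective (congrArg CommaMorphism.left h))
    (G.map_injective (congrArg CommaMorphism.right h))

/-- The two sides of a square lift because the functor is full, and the lifted square commutes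
because it is faithful. -/
instance {C D : Type*} [Category* C] [Category* D] (G : C ⥤ D) [G.Full] [G.Faithful] :
    G.mapArrow.Full where
  map_surjective {f g} x := by
    let a : G.obj f.left ⟶ G.obj g.left := x.left
    let b : G.obj f.right ⟶ G.obj g.right := x.right
    have hx : a ≫ G.map g.hom = G.map f.hom ≫ b := x.w
    have h : G.preimage a ≫ g.hom = f.hom ≫ G.preimage b := G.map_injective (by
      rw [G.map_comp, G.map_comp, G.map_preimage, G.map_preimage, hx])
    exact ⟨Arrow.homMk (G.preimage a) (G.preimage b) h,
      Arrow.hom_ext _ _ (G.map_preimage a) (G.map_preimage b)⟩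

/-! ## Projective modules and the ditalgebra of the dual of the radical -/

section ProjectiveModules

variable {K : Type u} [Field K] {Λ : Type u} [Ring Λ] [Algebra K Λ]
variable {S : Subalgebra K Λ} {J : Ideal Λ} [J.IsTwoSided] (B : DualBasis S J)

namespace Proj

/-- The right `S`-module underlying a right module over `T_0`. -/
abbrev res (M : RightMod K (T.zero (Bimod.zero K S) (Dual.bimod S J))) : RightMod K S :=
  M.restrict (T.rZeroHom (Bimod.zero K S) (Dual.bimod S J))

variable (S J) in
/-- The element `γ` of `T_1`. -/
def v : Dual S J →ₗ[K] T.gr (Bimod.zero K S) (Dual.bimod S J) 1 :=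
  (w S J).codRestrict _ w_mem

lemma v_smul (s : S) (γ : Dual S J) : v S J (s • γ) = T.lmul (T.rZero s) (v S J γ) :=
  Subtype.ext (w_smul s γ)

lemma v_op_smul (s : S) (γ : Dual S J) : v S J (op s • γ) = T.rmul (v S J γ) (T.rZero s) :=
  Subtype.ext (w_op_smul s γ)

variable {M N L : (projDit B).Mod}

/-- The pair `(f⁰, -f¹)` of a morphism of `Mod 𝒜`. -/
def cHom (f : Ditalgebra.Mod.Hom M N) : CMap S J (res M.mod) (res N.mod) where
  f := f.f₀
  -- Composition in `Mod 𝒜` subtracts the terms `g¹ f¹` given by `δ = μ`, while composition of pairs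
  -- adds them. Changing the sign of `f¹` reconciles the two; in Drozd's ditalgebra the sign is
  -- already in `d(w_k γ)`.
  c := -(f.f₁.toFun ∘ₗ v S J)
  map_act s m := f.map_R s m
  left s γ m := by
    change -(f.f₁.toFun (v S J (s • γ)) m) = -(f.f₁.toFun (v S J γ) (M.mod.act (T.rZero s) m))
    rw [v_smul, f.f₁.left]
  right s γ m := by
    change -(f.f₁.toFun (v S J (op s • γ)) m) = N.mod.act (T.rZero s) (-(f.f₁.toFun (v S J γ) m))
    rw [v_op_smul, f.f₁.right, map_neg]

lemma comp_d_v (f : Ditalgebra.Mod.Hom M N) (g : Ditalgebra.Mod.Hom N L) (γ : Dual S J)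
    (m : M.mod) :
    BMap.comp f.f₁ g.f₁ ((projDit B).d (v S J γ).1) m =
      ∑ i, g.f₁.toFun (v S J (γ.shift (B.p i))) (f.f₁.toFun (v S J (B.γ i)) m) := by
  have h : (projDit B).d (v S J γ).1 =
      ∑ i, (v S J (B.γ i)).1 * (v S J (γ.shift (B.p i))).1 := (d_w B γ).trans (B.mu_eq _ _ γ)
  rw [h, map_sum, LinearMap.sum_apply]
  exact Finset.sum_congr rfl fun i _ => BMap.comp_mul _ _ _ _ _

lemma map_cHom_comp (f : Ditalgebra.Mod.Hom M N) (g : Ditalgebra.Mod.Hom N L) :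
    (cHom B (Ditalgebra.Mod.Hom.comp f g)).map B = (cHom B g).map B ∘ₗ (cHom B f).map B := by
  refine Tens.hom_ext fun m a => ?_
  rw [LinearMap.comp_apply, CMap.map_map_mk, CMap.map_mk]
  refine congrArg₂ (· + ·) rfl (Finset.sum_congr rfl fun k _ => ?_)
  refine congrArg (fun x => Tens.mk x (B.p k * a)) ?_
  change -((Ditalgebra.Mod.Hom.comp f g).f₁.toFun (v S J (B.γ k)) m) =
    -(g.f₁.toFun (v S J (B.γ k)) (f.f₀ m)) + g.f₀ (-(f.f₁.toFun (v S J (B.γ k)) m)) +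
      ∑ i, -(g.f₁.toFun (v S J ((B.γ k).shift (B.p i))) (-(f.f₁.toFun (v S J (B.γ i)) m)))
  rw [Ditalgebra.Mod.Hom.comp_f₁, comp_d_v]
  simp only [map_neg, neg_neg]
  abel

lemma map_cHom_id : (cHom B (Ditalgebra.Mod.Hom.id M)).map B = LinearMap.id := by
  refine Tens.hom_ext fun m a => ?_
  rw [CMap.map_mk, Finset.sum_eq_zero, add_zero]
  · rfl
  · intro i _
    change Tens.mk (V := res M.mod) (-0) _ = 0
    rw [neg_zero, Tens.mk_zero_left]

/-- The functor `M ↦ M ⊗_S Λ`. -/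
def tens : (projDit B).Mod ⥤ ModuleCat.{u} Λᵐᵒᵖ where
  obj M := ModuleCat.of Λᵐᵒᵖ (Tens (res M.mod))
  map f := ModuleCat.ofHom ((cHom B f).map B)
  map_id M := congrArg ModuleCat.ofHom (map_cHom_id B)
  map_comp f g := congrArg ModuleCat.ofHom (map_cHom_comp B f g)

lemma tens_faithful (hc : IsCompl (Subalgebra.toSubmodule S) (J.restrictScalars K)) :
    (tens B).Faithful where
  map_injective {M N} f g h := by
    let f' : Ditalgebra.Mod.Hom M N := f
    let g' : Ditalgebra.Mod.Hom M N := g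
    have h1 : cHom B f' = cHom B g' := CMap.map_injective B hc (congrArg ModuleCat.Hom.hom h)
    refine Ditalgebra.Mod.Hom.ext (LinearMap.ext fun m => ?_) (BMap.ext_gen fun γ m => ?_)
    · exact congrArg (fun c => c.f m) h1
    · exact neg_injective (congrArg (fun c => c.c γ m) h1)

section hom

variable {M N : RightMod K (T.zero (Bimod.zero K S) (Dual.bimod S J))}
  (φ : CMap S J (res M) (res N))

/-- The map `f¹` given by the second component of a pair. -/
def bMap : BMap M N := BMap.ofGen (W₁ := Dual.bimod S J) (-φ.c)
  (fun s γ m => congrArg Neg.neg (φ.left s γ m))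
  (fun s γ m => (congrArg Neg.neg (φ.right s γ m)).trans (map_neg (N.act (T.rZero s)) _).symm)

lemma bMap_v (γ : Dual S J) (m : M) : (bMap φ).toFun (v S J γ) m = -φ.c γ m :=
  BMap.ofGen_wOne _ _ _ _ _

end hom

lemma wZero_eq_zero (x : Bimod.zero K S) :
    (T.wZero x : T.zero (Bimod.zero K S) (Dual.bimod S J)) = 0 :=
  map_zero (T.wZeroHom (Bimod.zero K S) (Dual.bimod S J))

/-- Since `W₀ = 0`, `S`-linearity of `f⁰` is the only condition on generators, and every pair comes
from a morphism. -/
lemma exists_tens_map {M N : (projDit B).Mod} (φ : CMap S J (res M.mod) (res N.mod)) :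
    ∃ f : Ditalgebra.Mod.Hom M N, f.f₀ = φ.f ∧ (cHom B f).map B = φ.map B := by
  let f : Ditalgebra.Mod.Hom M N := Ditalgebra.Mod.Hom.ofGen φ.f (bMap φ)
    (fun s m => φ.map_act s m)
    (fun x m => by
      have hx : (T.wZero x : (projDit B).T₀) = 0 := wZero_eq_zero x
      rw [hx]
      simp only [map_zero, LinearMap.zero_apply, add_zero])
  have h : cHom B f = φ := CMap.ext' rfl (LinearMap.ext fun γ => LinearMap.ext fun m =>
    (congrArg Neg.neg (bMap_v φ γ m)).trans (neg_neg _))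
  exact ⟨f, rfl, congrArg (CMap.map B) h⟩

lemma tens_full (hc : IsCompl (Subalgebra.toSubmodule S) (J.restrictScalars K)) :
    (tens B).Full where
  map_surjective g := by
    obtain ⟨f, -, hf⟩ := exists_tens_map B (CMap.ofMap hc g.hom)
    exact ⟨f, ModuleCat.hom_ext (hf.trans (CMap.map_ofMap B hc _))⟩

variable (J) in
/-- A right `S`-module as a right module over `T_0`. -/
def ofRight (V : RightMod K S) : RightMod K (T.zero (Bimod.zero K S) (Dual.bimod S J)) :=
  RightMod.ofGen (W₀ := Bimod.zero K S) (Dual.bimod S J) V 0 (fun _ _ _ => rfl)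
    (fun r _ _ => (map_zero (V.act r)).symm)

-- An equality rather than an isomorphism, so that a given `S`-module can be replaced by one
-- underlying an object of `Mod 𝒜`.
variable (J) in
lemma res_ofRight (V : RightMod K S) : res (ofRight J V) = V := by
  cases V with
  | mk X ρ =>
    change RightMod.mk X _ = _
    congr 1
    exact AlgHom.ext fun s => T.lift_ιR ρ _ _ _ s

/-- The functor induced by `M ↦ M ⊗_S Λ` on morphisms of the form `(0, ψ)`. -/
def radicalTens : (radicalMaps (projDit B)).FullSubcategory ⥤ Arrow (ModuleCat.{u} Λᵐᵒᵖ) :=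
  (radicalMaps (projDit B)).ι ⋙ (tens B).mapArrow

variable [IsSemisimpleRing S]

lemma isM1_radicalTens (hJ : IsNilpotent J)
    (hc : IsCompl (Subalgebra.toSubmodule S) (J.restrictScalars K))
    (φ : (radicalMaps (projDit B)).FullSubcategory) : isM1 Λ ((radicalTens B).obj φ) :=
  (isM1_map_iff B hJ hc (cHom B (M := φ.obj.left) (N := φ.obj.right) φ.obj.hom)).2 φ.property

lemma exists_radicalTens_iso (hJ : IsNilpotent J)
    (hc : IsCompl (Subalgebra.toSubmodule S) (J.restrictScalars K))
    (φ : Arrow (ModuleCat.{u} Λᵐᵒᵖ)) (h : isM1 Λ φ) :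
    ∃ ψ, Nonempty ((radicalTens B).obj ψ ≅ φ) := by
  obtain ⟨V₁, V₂, ψ, hψ, ⟨e⟩⟩ := exists_cMap_iso B hJ hc φ h
  -- The pair `ψ` becomes a pair between modules of the form `res`, where `exists_tens_map` applies.
  obtain ⟨M, rfl⟩ : ∃ M : (projDit B).Mod, res M.mod = V₁ := ⟨⟨ofRight J V₁⟩, res_ofRight J V₁⟩
  obtain ⟨N, rfl⟩ : ∃ N : (projDit B).Mod, res N.mod = V₂ := ⟨⟨ofRight J V₂⟩, res_ofRight J V₂⟩
  obtain ⟨f, h0, hf⟩ := exists_tens_map B ψ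
  exact ⟨⟨Arrow.mk f, h0.trans hψ⟩,
    ⟨(eqToIso (congrArg (fun g => Arrow.mk (ModuleCat.ofHom g)) hf)).trans e⟩⟩

/-- The morphisms of the form `(0, ψ)` and the homomorphisms of projective modules with image in
the radical form equivalent categories. -/
lemma radicalTens_isEquivalence (hJ : IsNilpotent J)
    (hc : IsCompl (Subalgebra.toSubmodule S) (J.restrictScalars K)) :
    ((isM1 Λ).lift (radicalTens B) (isM1_radicalTens B hJ hc)).IsEquivalence :=
  have := tens_full B hc
  have := tens_faithful B hc
  have : (radicalTens B).Full := inferInstanceAs ((radicalMaps (projDit B)).ι ⋙ (tens B).mapArrow).Full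
  have : (radicalTens B).Faithful := inferInstanceAs ((radicalMaps (projDit B)).ι ⋙ (tens B).mapArrow).Faithful
  isEquivalence_lift _ _ _ (exists_radicalTens_iso B hJ hc)

end Proj

/-- Both categories are equivalent to `M¹(Λ)`, one by `Ξ` and the other by `M ↦ M ⊗_S Λ`. -/
lemma nonempty_equivalence_radicalMaps [IsSemisimpleRing S] (hJ : IsNilpotent J)
    (hc : IsCompl (Subalgebra.toSubmodule S) (J.restrictScalars K)) :
    Nonempty ((drozd B).Mod ≌ (radicalMaps (projDit B)).FullSubcategory) :=
  have := Ξ_isEquivalence B hJ hc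
  have := Proj.radicalTens_isEquivalence B hJ hc
  ⟨((isM1 Λ).lift (Ξ B) (isM1_Ξ B hJ hc)).asEquivalence.trans
    ((isM1 Λ).lift (Proj.radicalTens B) (Proj.isM1_radicalTens B hJ hc)).asEquivalence.symm⟩

end ProjectiveModules

/-! ## Nilpotency of the radical -/

section Radical

variable {K : Type u} [Field K] {Λ : Type u} [Ring Λ] [Algebra K Λ] {S : Subalgebra K Λ}

/-- `1` generates the summand `S`, and the `p_i` generate `J`. -/
lemma DualBasis.module_finite {J : Ideal Λ} [J.IsTwoSided] (B : DualBasis S J)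
    (hc : IsCompl (Subalgebra.toSubmodule S) (J.restrictScalars K)) : Module.Finite S Λ := by
  refine ⟨Submodule.fg_def.2 ⟨insert 1 (Set.range fun i => (B.p i : Λ)),
    (Set.finite_range _).insert _, eq_top_iff.2 fun a _ => ?_⟩⟩
  rw [← parts_add hc a, ← B.sum (jPart hc a), AddSubmonoidClass.coe_finsetSum]
  refine add_mem ?_ (sum_mem fun i _ => ?_)
  · have h : (sPart hc a : Λ) = sPart hc a • (1 : Λ) := (mul_one _).symm
    rw [h]
    exact Submodule.smul_mem _ _ (Submodule.subset_span (Set.mem_insert _ _))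
  · exact Submodule.smul_mem _ (B.γ i (jPart hc a))
      (Submodule.subset_span (Set.mem_insert_of_mem _ ⟨i, rfl⟩))

/-- `Λ` is finite over the semisimple ring `S`, hence left artinian, and the radical of an artinian
ring is nilpotent. -/
lemma DualBasis.isNilpotent_jacobson [IsSemisimpleRing S] (B : DualBasis S (Ring.jacobson Λ))
    (hc : IsCompl (Subalgebra.toSubmodule S) ((Ring.jacobson Λ).restrictScalars K)) :
    IsNilpotent (Ring.jacobson Λ) :=
  have := B.module_finite hc
  have : IsArtinianRing Λ := IsArtinianRing.of_finite S Λ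
  IsSemiprimaryRing.isNilpotent

end Radical

/-- The left ideal generated by `e ≠ 0` is simple if `e` is a multiple of all its nonzero
elements. -/
lemma isSimpleModule_span_singleton {R : Type*} [Ring R] {e : R} (h0 : e ≠ 0)
    (h : ∀ x, x * e ≠ 0 → ∃ y, y * (x * e) = e) : IsSimpleModule R (Submodule.span R {e}) := by
  rw [isSimpleModule_iff_toSpanSingleton_surjective]
  refine ⟨⟨⟨e, Submodule.mem_span_singleton_self e⟩, 0, fun h' => h0 (congrArg Subtype.val h')⟩,
    ?_⟩
  rintro ⟨_, hx⟩ hx0 ⟨_, hz⟩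
  obtain ⟨a, rfl⟩ := Submodule.mem_span_singleton.1 hx
  obtain ⟨b, rfl⟩ := Submodule.mem_span_singleton.1 hz
  obtain ⟨y, hy⟩ := h a fun h' => hx0 (Subtype.ext h')
  refine ⟨b * y, Subtype.ext ?_⟩
  change b * y * (a * e) = b * e
  rw [mul_assoc, hy]

/-! ### The poset algebra: `Λ = S ⊕ J`, nilpotency of `J`, semisimplicity of `S` -/

namespace MultiplicativeSystem

open Alg

section height

variable {P : Type u} [PartialOrder P]

/-- The number of elements below `i`. -/
def height (i : P) : ℕ := {x | x < i}.ncard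

lemma height_lt [Finite P] {i j : P} (h : i < j) : height i < height j :=
  Set.ncard_lt_ncard ⟨fun _ hx => lt_trans hx h, fun h' => lt_irrefl i (h' h)⟩ (Set.toFinite _)

end height

variable {K P A : Type u} [Field K] [PartialOrder P] [Ring A] [Algebra K A] [Fintype P]
  [DecidableEq P] (ℛ : MultiplicativeSystem K P A)

/-- The diagonal matrix with given entries. -/
def diag (f : ∀ i, ℛ.space i i) : ℛ.S :=
  ⟨⟨Matrix.diagonal fun i => (f i : A), fun i j => by
    rcases eq_or_ne i j with rfl | h
    · rw [Matrix.diagonal_apply_eq]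
      exact (f i).2
    · rw [Matrix.diagonal_apply_ne _ h]
      exact zero_mem _⟩, fun _ _ h => Matrix.diagonal_apply_ne _ h⟩

lemma diag_val (f : ∀ i, ℛ.space i i) (i : P) : (ℛ.diag f).1.val i i = f i :=
  Matrix.diagonal_apply_eq _ _

variable {ℛ}

lemma S_ext {s t : ℛ.S} (h : ∀ i, s.1.val i i = t.1.val i i) : s = t :=
  Subtype.ext (val_injective (by
    ext i j
    rcases eq_or_ne i j with rfl | hij
    · exact h i
    · rw [s.2 i j hij, t.2 i j hij]))

variable (ℛ)

/-- Subtract from a matrix its diagonal; a diagonal matrix with zero diagonal vanishes. -/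
lemma isCompl : IsCompl (Subalgebra.toSubmodule ℛ.S) (ℛ.J.restrictScalars K) := by
  refine IsCompl.of_eq ?_ ?_
  · refine (Submodule.eq_bot_iff _).2 fun a ha => ?_
    have h : (⟨a, ha.1⟩ : ℛ.S) = 0 := S_ext ha.2
    exact congrArg Subtype.val h
  · refine eq_top_iff.2 fun a _ => ?_
    let s : ℛ.S := ℛ.diag fun i => ⟨a.val i i, a.val_mem i i⟩
    refine Submodule.mem_sup.2 ⟨s.1, s.2, a - s.1, fun i => ?_, add_sub_cancel _ _⟩
    change a.val i i - s.1.val i i = 0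
    rw [ℛ.diag_val, sub_self]

/-- A nonzero entry of an element of `J` sits at some `j < l` and so raises the height by at least
one. Hence nonzero entries of a product of `k` such elements raise it by at least `k`. -/
lemma J_pow_val (k : ℕ) : ∀ a ∈ ℛ.J ^ k, ∀ i j, height j < height i + k → a.val i j = 0 := by
  induction k with
  | zero =>
    intro a _ i j h
    refine a.val_eq_zero fun hij => ?_
    rcases hij.eq_or_lt with rfl | hij
    · exact lt_irrefl _ h
    · exact lt_asymm h (height_lt hij)
  | succ k ih =>
    intro a ha i l h
    rw [Submodule.pow_succ] at ha
    induction ha using Submodule.smul_induction_on' with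
    | smul a ha b hb =>
      change (a * b).val i l = 0
      rw [val_mul, Matrix.mul_apply]
      refine Finset.sum_eq_zero fun j _ => ?_
      by_cases hj : height j < height i + k
      · rw [ih a ha i j hj, zero_mul]
      · have hb' : b.val j l = 0 := by
          by_cases hjl : j ≤ l
          · rcases hjl.eq_or_lt with rfl | hjl
            · exact hb j
            · have := height_lt hjl
              omega
          · exact b.val_eq_zero hjl
        rw [hb', mul_zero]
    | add a _ b _ ha hb => rw [val_add, Matrix.add_apply, ha, hb, add_zero]

lemma isNilpotent_J : IsNilpotent ℛ.J := by
  -- Heights are at most the number of elements of `P`, so no pair of indices differs in height by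
  -- this exponent.
  refine ⟨Fintype.card P + 1, le_bot_iff.1 fun a ha => val_injective ?_⟩
  ext i j
  refine ℛ.J_pow_val _ a ha i j ?_
  have : height j ≤ Fintype.card P := by
    rw [← Nat.card_eq_fintype_card, ← Set.ncard_univ]
    exact Set.ncard_le_ncard (Set.subset_univ _) (Set.toFinite _)
  omega

variable {ℛ}

lemma S_mul_val (s t : ℛ.S) (i : P) : (s * t).1.val i i = s.1.val i i * t.1.val i i :=
  mul_val_diag ℛ s.1 t.1 i

/-- An element of `S` with nonzero entry at `i` divides the idempotent `e_i`. -/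
lemma exists_mul_eq (hd : ℛ.IsDivision) {i : P} {s : ℛ.S} (h : s.1.val i i ≠ 0) :
    ∃ t : ℛ.S, (∀ j, j ≠ i → t.1.val j j = 0) ∧
      s.1.val i i * t.1.val i i = ℛ.one i ∧ t.1.val i i * s.1.val i i = ℛ.one i := by
  obtain ⟨b, hb, h1, h2⟩ := (hd i).2 _ (s.1.val_mem i i) h
  refine ⟨ℛ.diag fun j => if hj : j = i then ⟨b, hj ▸ hb⟩ else 0, fun j hj => ?_, ?_, ?_⟩
  · rw [diag_val, dif_neg hj]
    rfl
  · rw [diag_val, dif_pos rfl, h1]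
  · rw [diag_val, dif_pos rfl, h2]

/-- The unit is the sum of the idempotents `e_i`. Each left ideal `S e_i` is simple, because a
nonzero multiple of `e_i` has an invertible entry at `i` and can be multiplied back to `e_i`. -/
lemma isSemisimpleRing_S (hd : ℛ.IsDivision) : IsSemisimpleRing ℛ.S := by
  let E : P → ℛ.S := fun i => ℛ.diag (Pi.single i ⟨ℛ.one i, ℛ.one_mem i⟩)
  have hE : ∀ i, (E i).1.val i i = ℛ.one i := fun i => by
    rw [diag_val, Pi.single_eq_same]
  have hE' : ∀ i j, j ≠ i → (E i).1.val j j = 0 := fun i j h => by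
    rw [diag_val, Pi.single_eq_of_ne h]
    rfl
  refine isSemisimpleModule_of_isSemisimpleModule_submodule'
    (p := fun i => Submodule.span ℛ.S {E i}) (fun i => ?_) ?_
  · have : IsSimpleModule ℛ.S (Submodule.span ℛ.S {E i}) := by
      refine isSimpleModule_span_singleton (fun h => (hd i).1 ?_) fun x hx => ?_
      · rw [← hE i, h]
        rfl
      · have hx' : x.1.val i i ≠ 0 := fun h => hx (S_ext fun j => by
          rcases eq_or_ne j i with rfl | hj
          · rw [S_mul_val, h, zero_mul]
            rfl
          · rw [S_mul_val, hE' i j hj, mul_zero]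
            rfl)
        obtain ⟨t, ht, -, ht'⟩ := exists_mul_eq hd hx'
        refine ⟨t, S_ext fun j => ?_⟩
        rcases eq_or_ne j i with rfl | hj
        · rw [S_mul_val, S_mul_val, ← mul_assoc, ht', hE]
          exact ℛ.one_mul _ _ _ (ℛ.one_mem j)
        · rw [S_mul_val, ht j hj, hE' i j hj, zero_mul]
    infer_instance
  · refine (Ideal.eq_top_iff_one _).2 ?_
    have h : (1 : ℛ.S) = ∑ i, E i := S_ext fun j => by
      have h1 : (∑ i, E i).1.val j j = ∑ i, (E i).1.val j j :=
        map_sum (⟨⟨fun s : ℛ.S => s.1.val j j, rfl⟩, fun _ _ => rfl⟩ : ℛ.S →+ A) E Finset.univ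
      rw [h1, Finset.sum_eq_single j (fun i _ hi => hE' i j hi.symm)
        (fun h => absurd (Finset.mem_univ j) h), hE]
      exact (Matrix.diagonal_apply_eq _ j).trans (if_pos trivial)
    rw [h]
    exact sum_mem fun i _ => Submodule.mem_iSup_of_mem i (Submodule.mem_span_singleton_self _)

end MultiplicativeSystem

/-! ## The subcategory given by the minimum of the poset -/

namespace MultiplicativeSystem

open Alg

variable {K P A : Type u} [Field K] [PartialOrder P] [Ring A] [Algebra K A] [Fintype P]
  [DecidableEq P] [OrderBot P] (ℛ : MultiplicativeSystem K P A)

/-- The idempotent `e_0` of `S`. -/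
def idem₀ : CIdem ℛ.S := ⟨ℛ.e₀S, ℛ.e₀S_mul_e₀S, ℛ.e₀S_comm⟩

variable {ℛ}

lemma e₀S_mul_val (s : ℛ.S) (i : P) :
    (ℛ.e₀S * s).1.val i i = if i = ⊥ then s.1.val i i else 0 := diagOne_mul _ s.1 i i

lemma e₀S_val_bot : ℛ.e₀S.1.val ⊥ ⊥ = ℛ.one ⊥ :=
  (Matrix.diagonal_apply_eq _ _).trans (if_pos rfl)

lemma corner_nontrivial (hd : ℛ.IsDivision) : Nontrivial ℛ.idem₀.Crn :=
  ⟨(1 : ℛ.idem₀.Crn), (0 : ℛ.idem₀.Crn), fun h => (hd ⊥).1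
    (e₀S_val_bot.symm.trans (congrArg (fun x => (ℛ.idem₀.val x).1.val ⊥ ⊥) h))⟩

lemma e₀S_val_ne {i : P} (h : i ≠ ⊥) : ℛ.e₀S.1.val i i = 0 :=
  (Matrix.diagonal_apply_eq _ _).trans (if_neg h)

lemma corner_val_ne (x : ℛ.idem₀.Crn) {i : P} (h : i ≠ ⊥) : (ℛ.idem₀.val x).1.val i i = 0 := by
  rw [← ℛ.idem₀.e_val x]
  exact (e₀S_mul_val _ i).trans (if_neg h)

/-- An element of `e_0 S e_0` is determined by its entry at `(0, 0)`, which is zero or invertible in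
`R_0`. -/
lemma corner_isUnit (hd : ℛ.IsDivision) (x : ℛ.idem₀.Crn) : IsUnit x ∨ x = 0 := by
  by_cases h : (ℛ.idem₀.val x).1.val ⊥ ⊥ = 0
  · refine Or.inr (ℛ.idem₀.val_injective (S_ext fun i => ?_))
    rcases eq_or_ne i ⊥ with rfl | hi
    · exact h
    · exact corner_val_ne x hi
  · obtain ⟨t, ht, h1, h2⟩ := exists_mul_eq hd h
    -- The inverse found in `S` has its only possibly nonzero entry at the minimum, so it already
    -- lies in the corner.
    have ht' : ℛ.idem₀.val (ℛ.idem₀.π t) = t := by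
      rw [CIdem.val_π]
      refine S_ext fun i => (e₀S_mul_val t i).trans ?_
      split_ifs with hi
      · rfl
      · exact (ht i hi).symm
    refine Or.inl ⟨⟨x, ℛ.idem₀.π t, ℛ.idem₀.val_injective (S_ext fun i => ?_),
      ℛ.idem₀.val_injective (S_ext fun i => ?_)⟩, rfl⟩
    · rw [CIdem.val_mul, ht', S_mul_val]
      rcases eq_or_ne i ⊥ with rfl | hi
      · exact h1.trans e₀S_val_bot.symm
      · rw [ht i hi, mul_zero]
        exact (e₀S_val_ne hi).symm
    · rw [CIdem.val_mul, ht', S_mul_val]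
      rcases eq_or_ne i ⊥ with rfl | hi
      · exact h2.trans e₀S_val_bot.symm
      · rw [ht i hi, zero_mul]
        exact (e₀S_val_ne hi).symm

/-- The corner `e_0 S e_0 = R_0` is a division ring. -/
abbrev cornerDivisionRing (hd : ℛ.IsDivision) : DivisionRing ℛ.idem₀.Crn :=
  have := corner_nontrivial hd
  DivisionRing.ofIsUnitOrEqZero (corner_isUnit hd)

/-- No element lies strictly below the minimum, so the column of index `0` has only its diagonal
entry. This is where the minimality of `0` enters. -/
lemma mul_e₀ (a : ℛ.Alg) : a * ℛ.e₀ = ℛ.e₀ * (a * ℛ.e₀) := val_injective (by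
  ext i j
  refine Eq.trans ?_ (diagOne_mul _ (a * ℛ.e₀) i j).symm
  split_ifs with hi
  · rfl
  · refine (mul_diagOne _ a i j).trans ?_
    split_ifs with hj
    · exact a.val_eq_zero fun h => hi (le_bot_iff.1 (hj ▸ h))
    · rfl)

/-- This is the row of index `0` with its diagonal entry removed. -/
lemma e₀_mul_mul_mem_J (a : ℛ.Alg) : ℛ.e₀ * a * (1 - ℛ.e₀) ∈ ℛ.J := fun i => by
  rw [mul_sub, _root_.mul_one]
  change (ℛ.e₀ * a).val i i - (ℛ.e₀ * a * ℛ.e₀).val i i = 0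
  have h1 : (ℛ.e₀ * a).val i i = if i = ⊥ then a.val i i else 0 := diagOne_mul _ a i i
  have h2 : (ℛ.e₀ * a * ℛ.e₀).val i i = if i = ⊥ then (ℛ.e₀ * a).val i i else 0 :=
    mul_diagOne _ (ℛ.e₀ * a) i i
  rw [h2, h1]
  split_ifs <;> exact sub_self _

lemma exists_eq_e₀_mul (x : ℛ.e₀Λ) : ∃ a, (x : ℛ.Alg) = ℛ.e₀ * a := by
  obtain ⟨a, ha⟩ := Submodule.mem_span_singleton.1 x.2
  exact ⟨a.unop, ha.symm⟩

/-- `(m ⊗ a) e_0 = m ⊗ e_0 a e_0 = m e_0 ⊗ a e_0`, using `Λ e_0 = e_0 Λ e_0`. -/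
lemma op_e₀_smul_tens {V : RightMod K ℛ.S} (hV : ∀ m, V.act ℛ.e₀S m = 0) (x : Tens V) :
    op ℛ.e₀ • x = 0 := by
  induction x using Tens.induction with
  | hmk m a =>
    have h := Tens.mk_act m ℛ.e₀S (a * ℛ.e₀)
    rw [hV, Tens.mk_zero_left] at h
    rw [← Tens.mk_smul, mul_e₀]
    exact h.symm
  | hadd x y hx hy => rw [smul_add, hx, hy, add_zero]

/-- The converse of `op_e₀_smul_tens`: `m e_0 ⊗ 1 = (m ⊗ 1) e_0`, and `m ↦ m ⊗ 1` is injective. -/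
lemma act_e₀S_eq_zero {V : RightMod K ℛ.S} (h : ∀ x : Tens V, op ℛ.e₀ • x = 0) (m : V) :
    V.act ℛ.e₀S m = 0 := by
  refine Tens.mk_one_injective ℛ.isCompl ?_
  rw [Tens.mk_act, _root_.mul_one, Tens.mk_eq_smul]
  exact h _

/-- In one copy, an element `e_0 a` of `e_0 Λ` satisfies `e_0 a (1 - e_0) = e_0 · (e_0 a (1 -
e_0))`, with the second factor in `J`. So `e_0` acts as the identity modulo the radical part. -/
lemma smul_mem_radJ {ν : Type u} (y : ν →₀ ℛ.e₀Λ) :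
    op (1 - ℛ.e₀) • y ∈ radJ ℛ.J (ν →₀ ℛ.e₀Λ) := by
  induction y using Finsupp.induction_linear with
  | zero => rw [smul_zero]; exact zero_mem _
  | add x y hx hy => rw [smul_add]; exact add_mem hx hy
  | single i x =>
    obtain ⟨a, ha⟩ := exists_eq_e₀_mul x
    let e : ℛ.e₀Λ := ⟨ℛ.e₀, Submodule.mem_span_singleton_self _⟩
    have h : op (1 - ℛ.e₀) • Finsupp.single i x =
        op (ℛ.e₀ * a * (1 - ℛ.e₀)) • Finsupp.single i e := by
      rw [Finsupp.smul_single, Finsupp.smul_single]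
      refine congrArg _ (Subtype.ext ?_)
      change x.1 * (1 - ℛ.e₀) = ℛ.e₀ * (ℛ.e₀ * a * (1 - ℛ.e₀))
      have hee : ℛ.e₀ * ℛ.e₀ = ℛ.e₀ := congrArg Subtype.val ℛ.e₀S_mul_e₀S
      rw [ha, ← mul_assoc, ← mul_assoc, hee]
    rw [h]
    exact Submodule.smul_mem_smul (e₀_mul_mul_mem_J a) Submodule.mem_top

/-- An isomorphism preserves the submodule `P J`, so `(m ⊗ 1)(1 - e_0)` lies in it by
`smul_mem_radJ`. Applying `π` gives `m (1 - e_0) = 0`. -/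
lemma act_e₀S_eq_self (B : DualBasis ℛ.S ℛ.J) {V : RightMod K ℛ.S} {ν : Type u}
    (e : Tens V ≃ₗ[ℛ.Algᵐᵒᵖ] (ν →₀ ℛ.e₀Λ)) (m : V) : V.act ℛ.e₀S m = m := by
  have h1 : op (1 - ℛ.e₀) • Tens.mk m (1 : ℛ.Alg) ∈ radJ ℛ.J (Tens V) := by
    rw [← e.symm_apply_apply (op (1 - ℛ.e₀) • Tens.mk m (1 : ℛ.Alg)), map_smul]
    refine Submodule.smul_induction_on (smul_mem_radJ (e (Tens.mk m 1)))
      (fun a ha y _ => ?_) (fun x y hx hy => ?_)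
    · rw [map_smul]
      exact Submodule.smul_mem_smul ha Submodule.mem_top
    · rw [map_add]
      exact add_mem hx hy
  have h2 := (Tens.mem_radJ_iff B ℛ.isCompl _).1 h1
  have h3 : sPart ℛ.isCompl (1 - ℛ.e₀) = 1 - ℛ.e₀S := sPart_coe ℛ.isCompl (1 - ℛ.e₀S)
  rw [Tens.π_smul, Tens.π_mk_one, h3, map_sub, LinearMap.sub_apply, RightMod.act_one] at h2
  exact (sub_eq_zero.1 h2).symm

section free

variable (V : RightMod K ℛ.S)

/-- A right `S`-module on which `e_0` acts as the identity, as a right module over `e_0 S e_0`. -/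
@[reducible] def cornerModule (hV : ∀ m, V.act ℛ.e₀S m = m) : Module ℛ.idem₀.Crnᵐᵒᵖ V where
  smul x m := V.act (ℛ.idem₀.val x.unop) m
  one_smul m := hV m
  mul_smul x y m := V.act_mul (ℛ.idem₀.val y.unop) (ℛ.idem₀.val x.unop) m
  smul_zero _ := map_zero _
  smul_add _ _ _ := map_add _ _ _
  add_smul x y m := by
    change V.act (ℛ.idem₀.val x.unop + ℛ.idem₀.val y.unop) m = _
    rw [map_add]
    rfl
  zero_smul m := by
    change V.act 0 m = 0
    rw [map_zero]
    rfl

/-- The inclusion of `e_0 S e_0` in `e_0 Λ`. -/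
def cornerIncl : ℛ.idem₀.Crnᵐᵒᵖ →+ ℛ.e₀Λ :=
  AddMonoidHom.mk' (fun x => ⟨(ℛ.idem₀.val x.unop : ℛ.Alg), Submodule.mem_span_singleton.2
    ⟨op (ℛ.idem₀.val x.unop : ℛ.Alg), congrArg Subtype.val (ℛ.idem₀.e_val x.unop)⟩⟩)
    fun _ _ => rfl

lemma cornerIncl_smul (s : ℛ.S) (x : ℛ.idem₀.Crnᵐᵒᵖ) :
    cornerIncl (op (ℛ.idem₀.π s) * x) = op (s : ℛ.Alg) • cornerIncl x := by
  have h : ℛ.idem₀.val (x.unop * ℛ.idem₀.π s) = ℛ.idem₀.val x.unop * s := by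
    rw [CIdem.val_mul, CIdem.val_π, ← mul_assoc, ← ℛ.idem₀.comm, ℛ.idem₀.e_val]
  refine Subtype.ext ?_
  exact congrArg (fun t : ℛ.S => (t : ℛ.Alg)) h

/-- `V` is a right vector space over the division ring `e_0 S e_0`. A basis indexed by `ν`
identifies it with copies of `e_0 S e_0`, and inducing to `Λ` turns each copy into `e_0 Λ`. -/
lemma exists_equiv_finsupp (hd : ℛ.IsDivision) (hV : ∀ m, V.act ℛ.e₀S m = m) :
    ∃ ν : Type u, Nonempty (Tens V ≃ₗ[ℛ.Algᵐᵒᵖ] (ν →₀ ℛ.e₀Λ)) := by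
  let _ := cornerDivisionRing hd
  let _ := cornerModule V hV
  let b := Module.Basis.ofVectorSpace ℛ.idem₀.Crnᵐᵒᵖ V
  let ν : Type u := Module.Basis.ofVectorSpaceIndex ℛ.idem₀.Crnᵐᵒᵖ V
  let L : (ν →₀ ℛ.idem₀.Crnᵐᵒᵖ) →+ (ν →₀ ℛ.e₀Λ) := Finsupp.mapRange.addMonoidHom cornerIncl
  have hL : ∀ i x, L (Finsupp.single i x) = Finsupp.single i (cornerIncl x) := fun i x =>
    Finsupp.mapRange_single (hf := map_zero _)
  let l : V →+ (ν →₀ ℛ.e₀Λ) := L.comp b.repr.toLinearMap.toAddMonoidHom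
  have hl : ∀ (s : ℛ.S) m, l (V.act s m) = op (s : ℛ.Alg) • l m := by
    intro s m
    have h1 : V.act s m = op (ℛ.idem₀.π s) • m := by
      change _ = V.act (ℛ.idem₀.val (ℛ.idem₀.π s)) m
      rw [CIdem.val_π, RightMod.act_mul]
      exact congrArg _ (hV m).symm
    change L (b.repr (V.act s m)) = op (s : ℛ.Alg) • L (b.repr m)
    rw [h1, map_smul]
    refine Finsupp.ext fun i => ?_
    exact cornerIncl_smul s (b.repr m i)
  let Ψ : Tens V →ₗ[ℛ.Algᵐᵒᵖ] (ν →₀ ℛ.e₀Λ) := Tens.extend (X := ν →₀ ℛ.e₀Λ) l hl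
  -- The inverse sends `x` in the copy of index `i` to `b_i ⊗ x`.
  let Φ : (ν →₀ ℛ.e₀Λ) →ₗ[ℛ.Algᵐᵒᵖ] Tens V := Finsupp.lsum ℕ fun i =>
    { toFun := fun x => Tens.mk (b i) (x : ℛ.Alg)
      map_add' := fun x y => Tens.mk_add_right _ _ _
      map_smul' := fun c x => Tens.mk_smul (b i) (x : ℛ.Alg) c.unop }
  have hΦ : ∀ i x, Φ (Finsupp.single i x) = Tens.mk (b i) (x : ℛ.Alg) := fun i x =>
    Finsupp.lsum_single _ _ _ _
  -- On coordinates in the corner, `Φ` recovers `m ⊗ 1`: a scalar in `S` moves across the tensor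
  -- sign.
  have hΦL : ∀ f, Φ (L f) = Tens.mk (b.repr.symm f) 1 := by
    intro f
    induction f using Finsupp.induction_linear with
    | zero => rw [map_zero, map_zero, map_zero, Tens.mk_zero_left]
    | add f g hf hg => rw [map_add, map_add, hf, hg, map_add, Tens.mk_add_left]
    | single i x =>
      rw [hL, hΦ, Module.Basis.repr_symm_single]
      refine Eq.trans ?_ (Tens.mk_act (b i) (ℛ.idem₀.val x.unop) 1).symm
      rw [_root_.mul_one]
      rfl
  refine ⟨ν, ⟨LinearEquiv.ofLinearMap Ψ Φ ?_ ?_⟩⟩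
  · refine Finsupp.lhom_ext fun i x => ?_
    rw [LinearMap.comp_apply, hΦ, LinearMap.id_apply]
    change op (x : ℛ.Alg) • L (b.repr (b i)) = _
    rw [Module.Basis.repr_self, hL, Finsupp.smul_single]
    refine congrArg _ (Subtype.ext ?_)
    change ℛ.e₀ * (x : ℛ.Alg) = x
    obtain ⟨a, ha⟩ := exists_eq_e₀_mul x
    have hee : ℛ.e₀ * ℛ.e₀ = ℛ.e₀ := congrArg Subtype.val ℛ.e₀S_mul_e₀S
    rw [ha, ← mul_assoc, hee]
  · refine Tens.hom_ext fun m a => ?_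
    change Φ (op a • L (b.repr m)) = Tens.mk m a
    rw [map_smul, hΦL, b.repr.symm_apply_apply, ← Tens.mk_eq_smul]

end free

section main

open Drozd

variable (B : DualBasis ℛ.S ℛ.J)

/-- The component of `e` at `w₁` is `1 - e_0` and the one at `w₂` is `e_0`, so the condition splits
along `M = M₁ ⊕ M₂`. -/
lemma act_idem_iff (M : RightMod K (T.zero (W₀ ℛ.S ℛ.J) (W₁ ℛ.S ℛ.J))) :
    (∀ m, M.act (T.rZero ℛ.idem.e) m = m) ↔
      (∀ x, (M₁ M).act ℛ.e₀S x = 0) ∧ ∀ x, (M₂ M).act ℛ.e₀S x = x := by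
  have h1 : ∀ x : M₁ M, (M₁ M).act (1 - ℛ.e₀S) x = x - (M₁ M).act ℛ.e₀S x := fun x => by
    rw [map_sub, LinearMap.sub_apply, RightMod.act_one]
  constructor
  · refine fun h => ⟨fun x => ?_, fun x => ?_⟩
    · have h2 : (M₁ M).act (1 - ℛ.e₀S) x = x := piece.val_injective
        ((rZero_val₁ ℛ.idem.e x).symm.trans (h _))
      rw [h1] at h2
      exact sub_eq_self.1 h2
    · exact piece.val_injective ((rZero_val₂ ℛ.idem.e x).symm.trans (h _))
  · rintro ⟨h, h'⟩ m
    have e1 : M.act (T.rZero ℛ.idem.e) (piece.val (proj₁ M m)) = piece.val (proj₁ M m) :=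
      (rZero_val₁ ℛ.idem.e _).trans (congrArg piece.val ((h1 _).trans (by rw [h, sub_zero])))
    have e2 : M.act (T.rZero ℛ.idem.e) (piece.val (proj₂ M m)) = piece.val (proj₂ M m) :=
      (rZero_val₂ ℛ.idem.e _).trans (congrArg piece.val (h' _))
    rw [← val_add_val m, map_add, e1, e2]

/-- On a restricted module `e` acts as the identity, so `M₁ e_0 = 0` and `e_0` is the identity on
`M₂`; these give the conditions on the source and on the target respectively. -/
lemma isM_F_Ξ (hd : ℛ.IsDivision) (N : ((drozd B).reduce ℛ.idem).Mod) :
    ℛ.isM (((drozd B).F ℛ.idem ⋙ Ξ B).obj N) := by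
  have := isSemisimpleRing_S hd
  obtain ⟨h1, h2⟩ := (act_idem_iff (((drozd B).F ℛ.idem).obj N).mod).1
    ((drozd B).F_act_e ℛ.idem N)
  exact ⟨isM1_Ξ B ℛ.isNilpotent_J ℛ.isCompl _, fun x => op_e₀_smul_tens h1 x,
    exists_equiv_finsupp _ hd h2⟩

/-- Choose `M` with `Ξ(M)` isomorphic to the given object. The conditions on source and target pass
to `M₁ ⊗ Λ` and `M₂ ⊗ Λ`, force `e` to act as the identity on `M`, and so put `M` in the essential
image of `F_η`. -/
lemma exists_F_Ξ_iso (hd : ℛ.IsDivision) (φ : Arrow (ModuleCat.{u} ℛ.Algᵐᵒᵖ)) (h : ℛ.isM φ) :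
    ∃ N, Nonempty (((drozd B).F ℛ.idem ⋙ Ξ B).obj N ≅ φ) := by
  have := isSemisimpleRing_S hd
  obtain ⟨hφ, h0, ν, ⟨e⟩⟩ := h
  obtain ⟨M, ⟨i⟩⟩ := exists_Ξ_iso B ℛ.isNilpotent_J ℛ.isCompl φ hφ
  let e₁ : Tens (M₁ M.mod) ≃ₗ[ℛ.Algᵐᵒᵖ] φ.left := (Arrow.leftFunc.mapIso i).toLinearEquiv
  let e₂ : Tens (M₂ M.mod) ≃ₗ[ℛ.Algᵐᵒᵖ] φ.right := (Arrow.rightFunc.mapIso i).toLinearEquiv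
  obtain ⟨N, ⟨j⟩⟩ := Ditalgebra.exists_F_iso (𝒜 := drozd B) (c := ℛ.idem) M ((act_idem_iff M.mod).2
    ⟨act_e₀S_eq_zero fun x => e₁.injective (by rw [map_smul, h0, map_zero]),
      act_e₀S_eq_self B (e₂.trans e)⟩)
  exact ⟨N, ⟨((Ξ B).mapIso j).trans i⟩⟩

lemma F_Ξ_isEquivalence (hd : ℛ.IsDivision) :
    (ℛ.isM.lift ((drozd B).F ℛ.idem ⋙ Ξ B) (isM_F_Ξ B hd)).IsEquivalence :=
  have := Ξ_full B ℛ.isCompl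
  have := Ξ_faithful B ℛ.isCompl
  have := Ditalgebra.F_full (drozd B) ℛ.idem
  have := Ditalgebra.F_faithful (drozd B) ℛ.idem
  isEquivalence_lift _ _ _ (exists_F_Ξ_iso B hd)

end main

end MultiplicativeSystem

end Dit

end

theorem mainTheorem8 :
    (∀ (K Λ : Type u) [Field K] [Ring Λ] [Algebra K Λ] (S : Subalgebra K Λ) [IsSemisimpleRing S]
        (_ : IsCompl (Subalgebra.toSubmodule S) ((Ring.jacobson Λ).restrictScalars K))
        (B : Dit.DualBasis S (Ring.jacobson Λ)),
      Nonempty ((Dit.drozd B).Mod ≌ (Dit.radicalMaps (Dit.projDit B)).FullSubcategory) ∧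
      ∃ h : ∀ M, Dit.isM1 Λ ((Dit.Ξ B).obj M),
        ((Dit.isM1 Λ).lift (Dit.Ξ B) h).IsEquivalence) ∧
    (∀ (K P A : Type u) [Field K] [PartialOrder P] [OrderBot P] [Fintype P] [DecidableEq P]
        [Ring A] [Algebra K A] (ℛ : Dit.MultiplicativeSystem K P A) (_ : ℛ.IsDivision)
        (B : Dit.DualBasis ℛ.S ℛ.J),
      (∃ h : ∀ M, Dit.isM1 ℛ.Alg ((Dit.Ξ B).obj M),
        ((Dit.isM1 ℛ.Alg).lift (Dit.Ξ B) h).IsEquivalence) ∧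
      ∃ h : ∀ M, ℛ.isM (((Dit.drozd B).F ℛ.idem ⋙ Dit.Ξ B).obj M),
        (ℛ.isM.lift ((Dit.drozd B).F ℛ.idem ⋙ Dit.Ξ B) h).IsEquivalence) := by
  refine ⟨fun K Λ _ _ _ S _ hc B => ?_, fun K P A _ _ _ _ _ _ _ ℛ hd B => ?_⟩
  -- From here on `J` enters only as a nilpotent ideal complementary to `S`, so both parts use the
  -- same results.
  · have hJ := B.isNilpotent_jacobson hc
    exact ⟨Dit.nonempty_equivalence_radicalMaps B hJ hc, Dit.isM1_Ξ B hJ hc,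
      Dit.Ξ_isEquivalence B hJ hc⟩
  · have := Dit.MultiplicativeSystem.isSemisimpleRing_S hd
    exact ⟨⟨Dit.isM1_Ξ B ℛ.isNilpotent_J ℛ.isCompl,
      Dit.Ξ_isEquivalence B ℛ.isNilpotent_J ℛ.isCompl⟩,
      Dit.MultiplicativeSystem.isM_F_Ξ B hd, Dit.MultiplicativeSystem.F_Ξ_isEquivalence B hd⟩
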